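/- **Theorem (global well-posedness and maximum principle).** Let $d\ge 1$, $\kappa>0$, and let $\mathbb T^d=[-\pi,\pi]^d$ be the torus, whose functions are identified with functions on $\mathbb R^d$ that are $2\pi$-periodic in each coordinate. Let $u_0\in L^\infty(\mathbb T^d)$ be real-valued with $\|u_0\|_\infty\le\pi$, and consider $$\partial_t u=\kappa^2\Delta u+\sin u\quad (t>0),\qquad u|_{t=0}=u_0. \tag{1}$$ A *mild solution* of (1) is a function $u$ on $[0,\infty)\times\mathbb T^d$, measurable in $(t,x)$, such that $u(0)=u_0$ a.e. and, for every $t>0$, almost everywhere on $\mathbb T^d$, $$u(t)=e^{\kappa^2t\Delta}u_0+\int_0^t e^{\kappa^2(t-s)\Delta}\sin u(s)\,ds .$$ A *classical solution* of (1) is a function $u$ on $(0,\infty)\times\mathbb T^d$ such that $u$ and its spatial derivatives up to order two exist and are continuous on $(0,\infty)\times\mathbb T^d$, $\partial_tu$ exists and $\partial_tu=\kappa^2\Delta u+\sin u$ at every point of $(0,\infty)\times\mathbb T^d$, and $\|u(t)-u_0\|_{L^1(\mathbb T^d)}\to0$ as $t\to0^+$. Then there is a function $u$ on $[0,\infty)\times\mathbb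 T^d$ that is a mild solution of (1) and, for $t>0$, a classical solution of (1), such that: 1. $u$ is $C^\infty$ in $(t,x)$ on $(0,\infty)\times\mathbb T^d$; 2. $\sup_{0\le t<\infty}\|u(t,\cdot)\|_\infty\le\pi$; 3. $u$ is unique: every mild solution $v$ of (1) satisfies $v(t)=u(t)$ a.e. for every $t\ge0$, and every classical solution $v$ of (1) satisfies $v=u$ everywhere on $(0,\infty)\times\mathbb T^d$. -/

import Mathlib

open MeasureTheory Filter Topology Set
open scoped ENNReal ContDiff

namespace ParabolicSineGordon

noncomputable section

/-- Functions on the torus `[-π, π]^d` are identified with the functions on `ℝ^d` that are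
`2π`-periodic in every coordinate. -/
def TorusPeriodic {d : ℕ} (f : EuclideanSpace ℝ (Fin d) → ℝ) : Prop :=
  ∀ (i : Fin d) (x : EuclideanSpace ℝ (Fin d)),
    f (x + EuclideanSpace.single i (2 * Real.pi)) = f x

/-- The cell `[-π, π]^d`, over which integrals on the torus are taken. -/
def torusCell (d : ℕ) : Set (EuclideanSpace ℝ (Fin d)) :=
  {x | ∀ i, x i ∈ Icc (-Real.pi) Real.pi}

/-- The norm of `L^∞` of the torus. The function being periodic, the essential supremum over the
cell is the one over `ℝ^d`. -/
def supNorm {d : ℕ} (f : EuclideanSpace ℝ (Fin d) → ℝ) : ℝ≥0∞ :=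
  eLpNorm f ∞ volume

/-- The Gauss kernel `(4πτ)^{-d/2} exp(-|x|² / (4τ))` on `ℝ^d`, for `τ > 0`. -/
def heatKernel {d : ℕ} (τ : ℝ) (x : EuclideanSpace ℝ (Fin d)) : ℝ :=
  (4 * Real.pi * τ) ^ (-((d : ℝ) / 2)) * Real.exp (-(‖x‖ ^ 2 / (4 * τ)))

/-- The heat semigroup `e^{τΔ} f`, for `τ > 0`. Convolving a periodic function on `ℝ^d` with the
Gauss kernel is convolving it on the torus with the periodized kernel. -/
def heatSemigroup {d : ℕ} (τ : ℝ) (f : EuclideanSpace ℝ (Fin d) → ℝ)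
    (x : EuclideanSpace ℝ (Fin d)) : ℝ :=
  ∫ y, heatKernel τ (x - y) * f y

/-- Global mild solutions of `∂ₜ u = κ² Δu + sin u`, `u(0) = u₀` on the torus:
`u(t) = e^{κ²tΔ} u₀ + ∫₀ᵗ e^{κ²(t-s)Δ} sin u(s) ds` for every `t > 0`, and `u(0) = u₀`, almost
everywhere in space. Only the values `u t`, `t ≥ 0`, matter. No bound on `u` is imposed: since
`|sin u| ≤ 1`, the formula implies `‖u(t)‖_∞ ≤ ‖u₀‖_∞ + t`. -/
structure IsMildSolution {d : ℕ} (κ : ℝ) (u₀ : EuclideanSpace ℝ (Fin d) → ℝ)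
    (u : ℝ → EuclideanSpace ℝ (Fin d) → ℝ) : Prop where
  periodic : ∀ t, 0 ≤ t → TorusPeriodic (u t)
  measurable : AEStronglyMeasurable (fun p : ℝ × EuclideanSpace ℝ (Fin d) => u p.1 p.2)
    ((volume.restrict (Ioi (0 : ℝ))).prod volume)
  initial : u 0 =ᵐ[volume] u₀
  duhamel : ∀ t, 0 < t → ∀ᵐ x : EuclideanSpace ℝ (Fin d),
    u t x = heatSemigroup (κ ^ 2 * t) u₀ x
      + ∫ s in (0 : ℝ)..t, heatSemigroup (κ ^ 2 * (t - s)) (fun y => Real.sin (u s y)) x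

/-- Global classical solutions of `∂ₜ u = κ² Δu + sin u` on the torus for `t > 0`, with initial
value `u₀` attained in `L¹` of the torus: `u` is `C²` in `x`, with `u`, `Dₓu`, `Dₓ²u` jointly
continuous on `t > 0`, and satisfies the equation at every point of `t > 0` (so that `∂ₜ u` is
continuous too). -/
structure IsClassicalSolution {d : ℕ} (κ : ℝ) (u₀ : EuclideanSpace ℝ (Fin d) → ℝ)
    (u : ℝ → EuclideanSpace ℝ (Fin d) → ℝ) : Prop where
  periodic : ∀ t, 0 < t → TorusPeriodic (u t)
  contDiff : ∀ t, 0 < t → ContDiff ℝ 2 (u t)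
  continuousOn : ∀ k : ℕ, k ≤ 2 → ContinuousOn
    (fun p : ℝ × EuclideanSpace ℝ (Fin d) => iteratedFDeriv ℝ k (u p.1) p.2)
    (Ioi (0 : ℝ) ×ˢ univ)
  equation : ∀ t, 0 < t → ∀ x : EuclideanSpace ℝ (Fin d),
    HasDerivAt (fun s => u s x) (κ ^ 2 * Laplacian.laplacian (u t) x + Real.sin (u t x)) t
  initial : Tendsto (fun t => eLpNorm (fun x => u t x - u₀ x) 1 (volume.restrict (torusCell d)))
    (𝓝[>] (0 : ℝ)) (𝓝 0)

end

end ParabolicSineGordon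

open ParabolicSineGordon

/-! Existence is a contraction argument. Since `sin` is bounded and Lipschitz, Duhamel's map is a
contraction for the norm weighted by `e^{-Mt}` with `M` large, on all of `t > 0` at once. The datum
is only bounded and measurable, so nothing continuous can be asked at `t = 0`; the unknown is
therefore a bounded continuous function of `(log t, x)` (`exists_duhamelEq`).

Smoothness is obtained without bootstrapping. For a solution `u`, the function `U(t, x) = u(l t, x +
t a)` solves `∂ₜU = κ² l ΔU + a · ∇U + l sin U` with the same datum. The corresponding contraction
depends smoothly on `(l, a)` near `(1, 0)`, because after parabolic scaling the Gaussian kernels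
form an exponential family, smooth in its parameters. By the implicit function theorem
(`contDiffAt_fixedPoint`) the fixed point `U` is smooth in `(l, a)`. Evaluated at `(T, x₀)` it is
`u(l T, x₀ + T a)`, so `u` is smooth near `(T, x₀)` (`DuhamelEq.contDiffAt`).

To recover the differential equation, put `g = ∂ₜu - κ²Δu`. Then `u` satisfies Duhamel's formula on
`[c, t]` both with forcing `g` (`SolvesHeat.duhamel`, by Green's formula) and with forcing `sin u`
(`DuhamelEq.restart`). The two integrals agree for every `c` close to `t`, hence `g = sin u` at time
`t`.

For the maximum principle, `eᵗ u` solves the heat equation with forcing `eᵗ (u + sin u)`, and `|y| ≤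
π + ε` implies `|y + sin y| ≤ π + 2ε`. So a bound `π + c tⁿ` improves to `π + 2c tⁿ⁺¹/(n+1)`;
starting from `π + t`, the excess is eventually beaten by a factorial.

Uniqueness of mild solutions is the same kind of iteration, from `|u - v| ≤ 2t`
(`ae_eq_of_duhamel`); it also gives periodicity. Classical solutions are mild: the defect in
Duhamel's formula is a limit of `e^{κ²(t-s)Δ}(v(s) - u₀)` as `s → 0`, which vanishes since the
semigroup contracts `L¹` of the torus. -/

open ParabolicSineGordon
namespace ParabolicSineGordon

/-! ### The heat kernel and the heat semigroup. -/

section HeatKernel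

variable {d : ℕ}

local notation "𝕏" => EuclideanSpace ℝ (Fin d)

theorem heatKernel_pos {τ : ℝ} (hτ : 0 < τ) (x : 𝕏) : 0 < heatKernel τ x := by
  unfold heatKernel; positivity

theorem measurable_heatKernel : Measurable fun p : ℝ × 𝕏 => heatKernel p.1 p.2 := by
  unfold heatKernel; fun_prop

theorem continuous_heatKernel (τ : ℝ) : Continuous fun x : 𝕏 => heatKernel τ x := by
  unfold heatKernel; fun_prop

theorem heatKernel_eq (τ : ℝ) (x : 𝕏) :
    heatKernel τ x = (4 * Real.pi * τ) ^ (-((d : ℝ) / 2)) * Real.exp (-(1 / (4 * τ)) * ‖x‖ ^ 2) := by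
  unfold heatKernel
  congr 2
  ring

theorem integrable_gaussian {b : ℝ} (hb : 0 < b) :
    Integrable fun x : 𝕏 => Real.exp (-b * ‖x‖ ^ 2) := by
  -- The integral of a non-integrable function is `0` by convention, while the Gaussian formula
  -- gives a positive number.
  by_contra h
  have h1 := integral_undef h
  rw [GaussianFourier.integral_rexp_neg_mul_sq_norm hb] at h1
  have : 0 < (Real.pi / b) ^ ((Module.finrank ℝ 𝕏 : ℝ) / 2) := by positivity
  exact this.ne' h1

theorem integral_heatKernel {τ : ℝ} (hτ : 0 < τ) : ∫ x : 𝕏, heatKernel τ x = 1 := by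
  simp_rw [heatKernel_eq]
  rw [integral_const_mul, GaussianFourier.integral_rexp_neg_mul_sq_norm (by positivity)]
  rw [finrank_euclideanSpace_fin, show Real.pi / (1 / (4 * τ)) = 4 * Real.pi * τ by field_simp,
    ← Real.rpow_add (by positivity)]
  simp

theorem integrable_heatKernel {τ : ℝ} (hτ : 0 < τ) : Integrable fun x : 𝕏 => heatKernel τ x := by
  simp_rw [heatKernel_eq]
  exact (integrable_gaussian (by positivity)).const_mul _

theorem integrable_heatKernel_sub {τ : ℝ} (hτ : 0 < τ) (x : 𝕏) :
    Integrable fun y : 𝕏 => heatKernel τ (x - y) :=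
  (integrable_heatKernel hτ).comp_sub_left x

theorem integral_heatKernel_sub {τ : ℝ} (hτ : 0 < τ) (x : 𝕏) :
    ∫ y : 𝕏, heatKernel τ (x - y) = 1 := by
  rw [integral_sub_left_eq_self (fun y : 𝕏 => heatKernel τ y), integral_heatKernel hτ]

theorem integrable_heatKernel_mul {τ : ℝ} (hτ : 0 < τ) {f : 𝕏 → ℝ} {C : ℝ}
    (hf : AEStronglyMeasurable f volume) (hC : ∀ᵐ y, |f y| ≤ C) (x : 𝕏) :
    Integrable fun y => heatKernel τ (x - y) * f y := by
  have := (integrable_heatKernel_sub hτ x).bdd_mul (c := C) hf (by simpa using hC)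
  simpa [mul_comm] using this

theorem abs_heatSemigroup_le {τ : ℝ} (hτ : 0 < τ) {f : 𝕏 → ℝ} {C : ℝ}
    (hC : ∀ᵐ y, |f y| ≤ C) (x : 𝕏) : |heatSemigroup τ f x| ≤ C := by
  have h := norm_integral_le_of_norm_le ((integrable_heatKernel_sub hτ x).mul_const C)
    (f := fun y => heatKernel τ (x - y) * f y) (by
      filter_upwards [hC] with y hy
      rw [norm_mul, Real.norm_eq_abs, Real.norm_eq_abs, abs_of_pos (heatKernel_pos hτ _)]
      exact mul_le_mul_of_nonneg_left hy (heatKernel_pos hτ _).le)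
  rw [integral_mul_const, integral_heatKernel_sub hτ, one_mul] at h
  exact h

theorem heatSemigroup_sub {τ : ℝ} (hτ : 0 < τ) {f g : 𝕏 → ℝ} {C C' : ℝ}
    (hf : AEStronglyMeasurable f volume) (hC : ∀ᵐ y, |f y| ≤ C)
    (hg : AEStronglyMeasurable g volume) (hC' : ∀ᵐ y, |g y| ≤ C') (x : 𝕏) :
    heatSemigroup τ (fun y => f y - g y) x = heatSemigroup τ f x - heatSemigroup τ g x := by
  unfold heatSemigroup
  rw [← integral_sub (integrable_heatKernel_mul hτ hf hC x)
    (integrable_heatKernel_mul hτ hg hC' x)]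
  simp_rw [mul_sub]

theorem heatSemigroup_congr_ae {τ : ℝ} {f g : 𝕏 → ℝ} (h : f =ᵐ[volume] g) (x : 𝕏) :
    heatSemigroup τ f x = heatSemigroup τ g x := by
  unfold heatSemigroup
  refine integral_congr_ae ?_
  filter_upwards [h] with y hy
  rw [hy]

theorem heatSemigroup_comp_add (τ : ℝ) (f : 𝕏 → ℝ) (a x : 𝕏) :
    heatSemigroup τ (fun y => f (y + a)) x = heatSemigroup τ f (x + a) := by
  unfold heatSemigroup
  rw [← integral_add_right_eq_self (fun y => heatKernel τ (x + a - y) * f y) a]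
  simp

theorem heatSemigroup_eq_integral_sub (τ : ℝ) (f : 𝕏 → ℝ) (x : 𝕏) :
    heatSemigroup τ f x = ∫ z, heatKernel τ z * f (x - z) := by
  unfold heatSemigroup
  rw [← integral_sub_left_eq_self (fun y => heatKernel τ (x - y) * f y) volume x]
  simp

/-- The Gaussian of diffusivity `μ` whose centre is moved by `-a`. -/
noncomputable def shiftedGaussian (μ : ℝ) (a z : 𝕏) : ℝ := heatKernel μ (z + a)

/-- The substitution `w = √τ z` turns the kernel at time `μτ` into a Gaussian of fixed width, in
which `τ` survives only through the shift `√τ a`. In this form nothing degenerates as `τ → 0`. -/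
theorem heatSemigroup_scaling {μ τ : ℝ} (hμ : 0 < μ) (hτ : 0 < τ) (f : 𝕏 → ℝ) (a x : 𝕏) :
    heatSemigroup (μ * τ) f (x + τ • a)
      = ∫ z, shiftedGaussian μ (√τ • a) z * f (x - √τ • z) := by
  have hs : 0 < √τ := Real.sqrt_pos.2 hτ
  have hss : √τ ^ 2 = τ := Real.sq_sqrt hτ.le
  have h1 : heatSemigroup (μ * τ) f (x + τ • a)
      = ∫ w, heatKernel (μ * τ) (w + τ • a) * f (x - w) := by
    unfold heatSemigroup
    rw [← integral_sub_left_eq_self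
      (fun y => heatKernel (μ * τ) (x + τ • a - y) * f y) volume x]
    refine integral_congr_ae (Eventually.of_forall fun w => ?_)
    simp only
    congr 2
    abel
  have h2 := Measure.integral_comp_smul (volume : Measure 𝕏)
    (fun w : 𝕏 => heatKernel (μ * τ) (w + τ • a) * f (x - w)) (√τ)
  rw [h1]
  have h3 : ∫ w : 𝕏, heatKernel (μ * τ) (w + τ • a) * f (x - w) = (√τ ^ d) *
      ∫ z : 𝕏, heatKernel (μ * τ) (√τ • z + τ • a) * f (x - √τ • z) := by
    rw [h2, finrank_euclideanSpace_fin, abs_of_pos (by positivity), smul_eq_mul]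
    field_simp
  rw [h3, ← integral_const_mul]
  refine integral_congr_ae (Eventually.of_forall fun z => ?_)
  simp only [shiftedGaussian]
  rw [← mul_assoc]
  congr 1
  have h4 : √τ • z + τ • a = √τ • (z + √τ • a) := by
    rw [smul_add, smul_smul, Real.mul_self_sqrt hτ.le]
  unfold heatKernel
  rw [h4, norm_smul, Real.norm_of_nonneg hs.le, mul_pow, hss,
    show 4 * Real.pi * (μ * τ) = 4 * Real.pi * μ * τ by ring,
    Real.mul_rpow (by positivity) hτ.le]
  -- The Jacobian of the scaling cancels the time factor of the kernel.
  have h5 : √τ ^ d * τ ^ (-((d : ℝ) / 2)) = 1 := by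
    rw [Real.sqrt_eq_rpow, ← Real.rpow_natCast, ← Real.rpow_mul hτ.le, ← Real.rpow_add hτ]
    ring_nf
    simp
  have h6 : τ * ‖z + √τ • a‖ ^ 2 / (4 * (μ * τ)) = ‖z + √τ • a‖ ^ 2 / (4 * μ) := by
    field_simp
  rw [h6]
  linear_combination (4 * Real.pi * μ) ^ (-((d : ℝ) / 2))
    * Real.exp (-(‖z + √τ • a‖ ^ 2 / (4 * μ))) * h5

/-- Completing the square: with `v = x - w`, the product is a constant times a Gaussian centred at
`(t / (s + t)) v`. -/
theorem integral_heatKernel_mul_heatKernel {s t : ℝ} (hs : 0 < s) (ht : 0 < t) (x w : 𝕏) :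
    ∫ y, heatKernel s (x - y) * heatKernel t (y - w) = heatKernel (s + t) (x - w) := by
  have hst : 0 < s + t := by positivity
  rw [← integral_add_right_eq_self (fun y => heatKernel s (x - y) * heatKernel t (y - w)) w]
  obtain ⟨v, hv⟩ : ∃ v, v = x - w := ⟨_, rfl⟩
  rw [← hv]
  have key : ∀ y : 𝕏, heatKernel s (x - (y + w)) * heatKernel t (y + w - w)
      = (4 * Real.pi * s) ^ (-((d : ℝ) / 2)) * (4 * Real.pi * t) ^ (-((d : ℝ) / 2))
        * Real.exp (-(‖v‖ ^ 2 / (4 * (s + t))))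
        * Real.exp (-((s + t) / (4 * s * t)) * ‖y - (t / (s + t)) • v‖ ^ 2) := by
    intro y
    have e1 : x - (y + w) = v - y := by rw [hv]; abel
    rw [e1, add_sub_cancel_right]
    unfold heatKernel
    have : -(‖v - y‖ ^ 2 / (4 * s)) + -(‖y‖ ^ 2 / (4 * t))
        = -(‖v‖ ^ 2 / (4 * (s + t)))
          + -((s + t) / (4 * s * t)) * ‖y - (t / (s + t)) • v‖ ^ 2 := by
      rw [norm_sub_sq_real, norm_sub_sq_real, norm_smul, inner_smul_right, real_inner_comm v y,
        mul_pow, Real.norm_eq_abs, sq_abs]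
      field_simp
      ring
    calc _ = (4 * Real.pi * s) ^ (-((d : ℝ) / 2)) * (4 * Real.pi * t) ^ (-((d : ℝ) / 2))
          * (Real.exp (-(‖v - y‖ ^ 2 / (4 * s))) * Real.exp (-(‖y‖ ^ 2 / (4 * t)))) := by ring
      _ = _ := by rw [← Real.exp_add, this, Real.exp_add]; ring
  simp_rw [key]
  rw [integral_const_mul, integral_sub_right_eq_self
    (fun y : 𝕏 => Real.exp (-((s + t) / (4 * s * t)) * ‖y‖ ^ 2)),
    GaussianFourier.integral_rexp_neg_mul_sq_norm (by positivity), finrank_euclideanSpace_fin]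
  unfold heatKernel
  have e : (4 * Real.pi * s) ^ (-((d : ℝ) / 2)) * (4 * Real.pi * t) ^ (-((d : ℝ) / 2))
      * (Real.pi / ((s + t) / (4 * s * t))) ^ ((d : ℝ) / 2)
      = (4 * Real.pi * (s + t)) ^ (-((d : ℝ) / 2)) := by
    rw [Real.rpow_neg (by positivity), Real.rpow_neg (by positivity), Real.rpow_neg (by positivity),
      ← Real.inv_rpow (by positivity), ← Real.inv_rpow (by positivity),
      ← Real.inv_rpow (by positivity), ← Real.mul_rpow (by positivity) (by positivity),
      ← Real.mul_rpow (by positivity) (by positivity)]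
    congr 1
    field_simp
  rw [← e]
  ring

theorem heatSemigroup_heatSemigroup {s t : ℝ} (hs : 0 < s) (ht : 0 < t) {f : 𝕏 → ℝ} {C : ℝ}
    (hf : AEStronglyMeasurable f volume) (hC : ∀ᵐ y, |f y| ≤ C) (x : 𝕏) :
    heatSemigroup s (heatSemigroup t f) x = heatSemigroup (s + t) f x := by
  have hint : Integrable (fun p : 𝕏 × 𝕏 => heatKernel s (x - p.1)
      * (heatKernel t (p.1 - p.2) * f p.2)) (volume.prod volume) := by
    have hm : AEStronglyMeasurable (fun p : 𝕏 × 𝕏 => heatKernel s (x - p.1)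
        * (heatKernel t (p.1 - p.2) * f p.2)) (volume.prod volume) := by
      refine AEStronglyMeasurable.mul ?_ (AEStronglyMeasurable.mul ?_ ?_)
      · exact ((continuous_heatKernel s).comp (by fun_prop)).aestronglyMeasurable
      · exact ((continuous_heatKernel t).comp (by fun_prop)).aestronglyMeasurable
      · exact hf.comp_snd
    rw [integrable_prod_iff hm]
    constructor
    · exact Eventually.of_forall fun y => (integrable_heatKernel_mul ht hf hC y).const_mul
        (heatKernel s (x - y))
    · refine Integrable.mono' ((integrable_heatKernel_sub hs x).mul_const C)
        hm.norm.integral_prod_right' (Eventually.of_forall fun y => ?_)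
      simp only [norm_mul, Real.norm_eq_abs]
      rw [integral_const_mul, abs_mul, abs_abs, abs_of_pos (heatKernel_pos hs _)]
      refine mul_le_mul_of_nonneg_left ?_ (heatKernel_pos hs _).le
      have := abs_heatSemigroup_le ht (f := fun y => |f y|) (C := C) (by simpa using hC) y
      simpa [heatSemigroup, abs_of_pos (heatKernel_pos ht _)] using this
  unfold heatSemigroup
  simp_rw [← integral_const_mul]
  rw [integral_integral_swap hint]
  refine integral_congr_ae (Eventually.of_forall fun w => ?_)
  simp only
  simp_rw [← mul_assoc]
  rw [integral_mul_const, integral_heatKernel_mul_heatKernel hs ht]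

end HeatKernel

end ParabolicSineGordon
namespace ParabolicSineGordon

/-! ### Smooth maps into bounded continuous functions: exponential families and the sine. -/

section BoundedContinuous

open scoped BoundedContinuousFunction

variable {Y : Type*} [TopologicalSpace Y]

open Classical in
/-- A function as a bounded continuous function, with value `0` if it is not one. -/
noncomputable def toBCF (f : Y → ℝ) : Y →ᵇ ℝ :=
  if h : Continuous f ∧ ∃ C, ∀ y, |f y| ≤ C then
    BoundedContinuousFunction.ofNormedAddCommGroup f h.1 h.2.choose h.2.choose_spec else 0

theorem toBCF_apply {f : Y → ℝ} (hf : Continuous f) {C : ℝ} (hC : ∀ y, |f y| ≤ C) (y : Y) :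
    toBCF f y = f y := by
  rw [toBCF, dif_pos ⟨hf, C, hC⟩]
  rfl

theorem abs_exp_sub_one_sub_le (b : ℝ) : |Real.exp b - 1 - b| ≤ b ^ 2 * Real.exp |b| := by
  have h := Complex.norm_exp_sub_sum_le_norm_mul_exp (b : ℂ) 2
  simp only [Finset.sum_range_succ, Finset.sum_range_zero] at h
  have e : Complex.exp (b : ℂ) - (0 + (b : ℂ) ^ 0 / (Nat.factorial 0 : ℂ)
      + (b : ℂ) ^ 1 / (Nat.factorial 1 : ℂ)) = ((Real.exp b - 1 - b : ℝ) : ℂ) := by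
    push_cast
    simp
    ring
  rw [e, Complex.norm_real, Complex.norm_real, Real.norm_eq_abs, Real.norm_eq_abs, sq_abs] at h
  exact h

section ExpFamily

variable {V : Type*} [NormedAddCommGroup V] [NormedSpace ℝ V]

/-- `W` stays bounded when multiplied by `exp (δ ‖Q‖)`, for all `δ < δ₀`. -/
structure ExpDecay (Q : Y → V →L[ℝ] ℝ) (δ₀ : ℝ) (W : Y → ℝ) : Prop where
  continuous : Continuous W
  bound : ∀ δ < δ₀, ∃ C, ∀ y, Real.exp (δ * ‖Q y‖) * |W y| ≤ C

/-- The bound is available for every `δ < δ₀`, so half of the margin `δ₀ - δ` can be spent on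
absorbing the factor `‖Q‖`. -/
theorem ExpDecay.norm_mul {Q : Y → V →L[ℝ] ℝ} {δ₀ : ℝ} {W : Y → ℝ} (hQ : Continuous Q)
    (hW : ExpDecay Q δ₀ W) : ExpDecay Q δ₀ (fun y => ‖Q y‖ * W y) where
  continuous := hQ.norm.mul hW.continuous
  bound := by
    intro δ hδ
    obtain ⟨C, hC⟩ := hW.bound ((δ + δ₀) / 2) (by linarith)
    have hε : 0 < (δ₀ - δ) / 2 := by linarith
    refine ⟨((δ₀ - δ) / 2)⁻¹ * C, fun y => ?_⟩
    have h1 : ‖Q y‖ ≤ ((δ₀ - δ) / 2)⁻¹ * Real.exp ((δ₀ - δ) / 2 * ‖Q y‖) := by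
      rw [inv_mul_eq_div, le_div_iff₀ hε]
      linarith [Real.add_one_le_exp ((δ₀ - δ) / 2 * ‖Q y‖)]
    calc Real.exp (δ * ‖Q y‖) * |‖Q y‖ * W y|
        = Real.exp (δ * ‖Q y‖) * |W y| * ‖Q y‖ := by rw [abs_mul, abs_norm]; ring
      _ ≤ Real.exp (δ * ‖Q y‖) * |W y|
          * (((δ₀ - δ) / 2)⁻¹ * Real.exp ((δ₀ - δ) / 2 * ‖Q y‖)) := by gcongr
      _ = ((δ₀ - δ) / 2)⁻¹ * (Real.exp ((δ + δ₀) / 2 * ‖Q y‖) * |W y|) := by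
          rw [show (δ + δ₀) / 2 * ‖Q y‖ = δ * ‖Q y‖ + (δ₀ - δ) / 2 * ‖Q y‖ by ring, Real.exp_add]
          ring
      _ ≤ _ := by gcongr; exact hC y

theorem ExpDecay.apply_mul {Q : Y → V →L[ℝ] ℝ} {δ₀ : ℝ} {W : Y → ℝ} (hQ : Continuous Q)
    (hW : ExpDecay Q δ₀ W) (v : V) : ExpDecay Q δ₀ (fun y => Q y v * W y) where
  continuous := (hQ.clm_apply continuous_const).mul hW.continuous
  bound := by
    intro δ hδ
    obtain ⟨C, hC⟩ := (hW.norm_mul hQ).bound δ hδ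
    refine ⟨‖v‖ * C, fun y => ?_⟩
    calc Real.exp (δ * ‖Q y‖) * |Q y v * W y|
        ≤ Real.exp (δ * ‖Q y‖) * ((‖Q y‖ * ‖v‖) * |W y|) := by
          rw [abs_mul]
          gcongr
          exact (Q y).le_opNorm v
      _ = ‖v‖ * (Real.exp (δ * ‖Q y‖) * |‖Q y‖ * W y|) := by rw [abs_mul, abs_norm]; ring
      _ ≤ _ := by gcongr; exact hC y

theorem ExpDecay.exp_mul_bound {Q : Y → V →L[ℝ] ℝ} {δ₀ : ℝ} {W : Y → ℝ}
    (hW : ExpDecay Q δ₀ W) {q : V} (hq : ‖q‖ < δ₀) :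
    ∃ C, ∀ y, |Real.exp (Q y q) * W y| ≤ C := by
  obtain ⟨C, hC⟩ := hW.bound _ hq
  refine ⟨C, fun y => le_trans ?_ (hC y)⟩
  rw [abs_mul, Real.abs_exp]
  gcongr
  exact (le_abs_self _).trans (((Q y).le_opNorm q).trans (mul_comm _ _).le)

theorem ExpDecay.continuous_exp_mul {Q : Y → V →L[ℝ] ℝ} {δ₀ : ℝ} {W : Y → ℝ}
    (hQ : Continuous Q) (hW : ExpDecay Q δ₀ W) (q : V) :
    Continuous fun y => Real.exp (Q y q) * W y :=
  (Real.continuous_exp.comp (hQ.clm_apply continuous_const)).mul hW.continuous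

theorem ExpDecay.toBCF_apply {Q : Y → V →L[ℝ] ℝ} {δ₀ : ℝ} {W : Y → ℝ}
    (hQ : Continuous Q) (hW : ExpDecay Q δ₀ W) {q : V} (hq : ‖q‖ < δ₀) (y : Y) :
    toBCF (fun y => Real.exp (Q y q) * W y) y = Real.exp (Q y q) * W y :=
  ParabolicSineGordon.toBCF_apply (hW.continuous_exp_mul hQ q) (hW.exp_mul_bound hq).choose_spec y

variable [FiniteDimensional ℝ V]

/-- The Taylor remainder of `exp` is at most `|Q h|² e^{|Q h|}`; the two factors `‖Q‖` and the small
exponential are absorbed by the decay of `W`, uniformly in `y`. -/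
theorem ExpDecay.hasFDerivAt {Q : Y → V →L[ℝ] ℝ} {δ₀ : ℝ} {W : Y → ℝ}
    (hQ : Continuous Q) (hW : ExpDecay Q δ₀ W) {q : V} (hq : ‖q‖ < δ₀) :
    ∃ L : V →L[ℝ] (Y →ᵇ ℝ), (∀ v, L v = toBCF (fun y => Real.exp (Q y q) * (Q y v * W y))) ∧
      HasFDerivAt (fun q => toBCF (fun y => Real.exp (Q y q) * W y)) L q := by
  let L₀ : V →ₗ[ℝ] (Y →ᵇ ℝ) :=
    { toFun := fun v => toBCF (fun y => Real.exp (Q y q) * (Q y v * W y))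
      map_add' := by
        intro v w
        ext y
        rw [BoundedContinuousFunction.add_apply, (hW.apply_mul hQ (v + w)).toBCF_apply hQ hq,
          (hW.apply_mul hQ v).toBCF_apply hQ hq, (hW.apply_mul hQ w).toBCF_apply hQ hq, map_add]
        ring
      map_smul' := by
        intro c v
        ext y
        rw [BoundedContinuousFunction.smul_apply, (hW.apply_mul hQ (c • v)).toBCF_apply hQ hq,
          (hW.apply_mul hQ v).toBCF_apply hQ hq, map_smul]
        simp only [smul_eq_mul, RingHom.id_apply]
        ring }
  refine ⟨LinearMap.toContinuousLinearMap L₀, fun v => rfl, ?_⟩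
  rw [hasFDerivAt_iff_isLittleO_nhds_zero]
  -- Half of the available room, so that the exponent `‖q‖ + ε` is still below `δ₀`.
  set ε := (δ₀ - ‖q‖) / 2 with hε
  have hε0 : 0 < ε := by rw [hε]; linarith
  obtain ⟨C, hC⟩ := ((hW.norm_mul hQ).norm_mul hQ).bound (‖q‖ + ε) (by rw [hε]; linarith)
  refine (Asymptotics.IsBigO.of_bound |C| (g := fun h : V => ‖h‖ ^ 2) ?_).trans_isLittleO
    (Asymptotics.isLittleO_norm_pow_id one_lt_two)
  filter_upwards [Metric.ball_mem_nhds (0 : V) hε0] with h hh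
  rw [mem_ball_zero_iff] at hh
  have hqh : ‖q + h‖ < δ₀ := by
    have := norm_add_le q h
    rw [hε] at hh
    linarith
  have hpt : ∀ y, |Real.exp (Q y (q + h)) * W y - Real.exp (Q y q) * W y
      - Real.exp (Q y q) * (Q y h * W y)| ≤ |C| * ‖h‖ ^ 2 := by
    intro y
    have hb : |Q y h| ≤ ‖Q y‖ * ‖h‖ := (Q y).le_opNorm h
    have hb2 : (Q y h) ^ 2 ≤ (‖Q y‖ * ‖h‖) ^ 2 := by
      rw [← sq_abs]; gcongr
    have hq1 : Q y q ≤ ‖q‖ * ‖Q y‖ :=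
      (le_abs_self _).trans (((Q y).le_opNorm q).trans (mul_comm _ _).le)
    have e1 : Real.exp (Q y (q + h)) * W y - Real.exp (Q y q) * W y
        - Real.exp (Q y q) * (Q y h * W y)
        = Real.exp (Q y q) * (Real.exp (Q y h) - 1 - Q y h) * W y := by
      rw [map_add, Real.exp_add]; ring
    rw [e1, abs_mul, abs_mul, Real.abs_exp]
    calc Real.exp (Q y q) * |Real.exp (Q y h) - 1 - Q y h| * |W y|
        ≤ Real.exp (‖q‖ * ‖Q y‖) * ((‖Q y‖ * ‖h‖) ^ 2 * Real.exp (‖Q y‖ * ε)) * |W y| := by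
          gcongr
          refine (abs_exp_sub_one_sub_le _).trans ?_
          gcongr
          exact hb.trans (by gcongr)
      _ = Real.exp ((‖q‖ + ε) * ‖Q y‖) * |‖Q y‖ * (‖Q y‖ * W y)| * ‖h‖ ^ 2 := by
          rw [abs_mul, abs_mul, abs_norm, add_mul, Real.exp_add, mul_comm ε]; ring
      _ ≤ |C| * ‖h‖ ^ 2 := by gcongr; exact (hC y).trans (le_abs_self C)
  rw [norm_pow, norm_norm, BoundedContinuousFunction.norm_le (by positivity)]
  intro y
  refine le_trans (le_of_eq ?_) (hpt y)
  rw [BoundedContinuousFunction.sub_apply, BoundedContinuousFunction.sub_apply,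
    hW.toBCF_apply hQ hqh, hW.toBCF_apply hQ hq, Real.norm_eq_abs]
  congr 2
  exact (hW.apply_mul hQ h).toBCF_apply hQ hq y

/-- Each directional derivative is a family of the same kind, with `W` replaced by `Q(·) v * W`, so
the induction closes. Finite dimension of `V` reduces smoothness of the derivative to one direction
at a time. -/
theorem ExpDecay.contDiffOn {Q : Y → V →L[ℝ] ℝ} {δ₀ : ℝ} {W : Y → ℝ}
    (hQ : Continuous Q) (hW : ExpDecay Q δ₀ W) (n : ℕ) :
    ContDiffOn ℝ n (fun q => toBCF (fun y => Real.exp (Q y q) * W y)) (Metric.ball (0 : V) δ₀) := by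
  induction n generalizing W with
  | zero =>
    rw [Nat.cast_zero, contDiffOn_zero]
    intro q hq
    obtain ⟨L, -, hL⟩ := hW.hasFDerivAt hQ (mem_ball_zero_iff.1 hq)
    exact hL.continuousAt.continuousWithinAt
  | succ n ih =>
    have hd : ∀ q ∈ Metric.ball (0 : V) δ₀,
        DifferentiableAt ℝ (fun q => toBCF (fun y => Real.exp (Q y q) * W y)) q := by
      intro q hq
      obtain ⟨L, -, hL⟩ := hW.hasFDerivAt hQ (mem_ball_zero_iff.1 hq)
      exact hL.differentiableAt
    rw [Nat.cast_succ, contDiffOn_succ_iff_fderiv_of_isOpen Metric.isOpen_ball]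
    refine ⟨fun q hq => (hd q hq).differentiableWithinAt, by simp, ?_⟩
    rw [contDiffOn_clm_apply]
    intro v
    refine (ih (hW.apply_mul hQ v)).congr fun q hq => ?_
    obtain ⟨L, hL1, hL⟩ := hW.hasFDerivAt hQ (mem_ball_zero_iff.1 hq)
    rw [hL.fderiv, hL1]

end ExpFamily

section Sine

/-- The superposition operator `W ↦ sin ∘ W` on bounded continuous functions. -/
noncomputable def sinBCF (W : Y →ᵇ ℝ) : Y →ᵇ ℝ := toBCF fun y => Real.sin (W y)

@[simp] theorem sinBCF_apply (W : Y →ᵇ ℝ) (y : Y) : sinBCF W y = Real.sin (W y) :=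
  toBCF_apply (Real.continuous_sin.comp W.continuous) (fun _ => Real.abs_sin_le_one _) y

theorem abs_sin_add_sub_sub_le (w : ℝ) {h : ℝ} (hh : |h| ≤ 1) :
    |Real.sin (w + h) - Real.sin w - Real.cos w * h| ≤ h ^ 2 := by
  have h1 : |Real.cos h - 1| ≤ h ^ 2 / 2 := by
    rw [abs_sub_comm, abs_of_nonneg (by linarith [Real.cos_le_one h])]
    linarith [Real.one_sub_sq_div_two_le_cos (x := h)]
  have h2 : |Real.sin h - h| ≤ h ^ 2 / 2 := by
    have h3 := Real.sin_bound hh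
    have h4 : |h| ^ 5 ≤ h ^ 2 := by
      rw [← sq_abs]
      exact pow_le_pow_of_le_one (abs_nonneg h) hh (by norm_num)
    have h5 : |h ^ 3 / 6| ≤ h ^ 2 / 6 := by
      rw [abs_div, abs_pow, abs_of_pos (by norm_num : (0 : ℝ) < 6)]
      gcongr
      rw [← sq_abs]
      exact pow_le_pow_of_le_one (abs_nonneg h) hh (by norm_num)
    calc |Real.sin h - h| = |(Real.sin h - (h - h ^ 3 / 6)) - h ^ 3 / 6| := by ring_nf
      _ ≤ _ := abs_sub _ _
      _ ≤ _ := by nlinarith [sq_nonneg h]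
  have e : Real.sin (w + h) - Real.sin w - Real.cos w * h
      = Real.sin w * (Real.cos h - 1) + Real.cos w * (Real.sin h - h) := by
    rw [Real.sin_add]; ring
  rw [e]
  calc _ ≤ |Real.sin w * (Real.cos h - 1)| + |Real.cos w * (Real.sin h - h)| := abs_add_le _ _
    _ ≤ 1 * (h ^ 2 / 2) + 1 * (h ^ 2 / 2) := by
        rw [abs_mul, abs_mul]
        gcongr
        · exact Real.abs_sin_le_one w
        · exact Real.abs_cos_le_one w
    _ = h ^ 2 := by ring

/-- The derivative is multiplication by `cos W`. Writing it as `sin (W + π/2)` expresses it by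
`sinBCF` itself, which lets the induction for smoothness close. -/
theorem hasFDerivAt_sinBCF (W : Y →ᵇ ℝ) :
    HasFDerivAt sinBCF (ContinuousLinearMap.mul ℝ (Y →ᵇ ℝ)
      (sinBCF (W + BoundedContinuousFunction.const Y (Real.pi / 2)))) W := by
  rw [hasFDerivAt_iff_isLittleO_nhds_zero]
  refine (Asymptotics.IsBigO.of_bound 1 (g := fun h : Y →ᵇ ℝ => ‖h‖ ^ 2) ?_).trans_isLittleO
    (Asymptotics.isLittleO_norm_pow_id one_lt_two)
  filter_upwards [Metric.ball_mem_nhds (0 : Y →ᵇ ℝ) one_pos] with h hh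
  rw [mem_ball_zero_iff] at hh
  rw [BoundedContinuousFunction.norm_le (by positivity)]
  intro y
  have hy := h.norm_coe_le_norm y
  rw [Real.norm_eq_abs] at hy
  have h1 := abs_sin_add_sub_sub_le (W y) (h := h y) (hy.trans hh.le)
  have h2 : (h y) ^ 2 ≤ ‖h‖ ^ 2 := by rw [← sq_abs]; gcongr
  simp only [BoundedContinuousFunction.sub_apply, ContinuousLinearMap.mul_apply',
    BoundedContinuousFunction.mul_apply, sinBCF_apply, BoundedContinuousFunction.add_apply,
    BoundedContinuousFunction.const_apply, Real.sin_add_pi_div_two, Real.norm_eq_abs, one_mul,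
    abs_pow, abs_norm]
  exact h1.trans h2

theorem contDiff_sinBCF : ContDiff ℝ ∞ (sinBCF (Y := Y)) := by
  rw [contDiff_infty]
  intro n
  induction n with
  | zero =>
    rw [Nat.cast_zero, contDiff_zero]
    exact continuous_iff_continuousAt.2 fun W => (hasFDerivAt_sinBCF W).continuousAt
  | succ n ih =>
    rw [Nat.cast_succ, contDiff_succ_iff_fderiv]
    refine ⟨fun W => (hasFDerivAt_sinBCF W).differentiableAt, by simp, ?_⟩
    have : fderiv ℝ (sinBCF (Y := Y)) = fun W => ContinuousLinearMap.mul ℝ (Y →ᵇ ℝ)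
        (sinBCF (W + BoundedContinuousFunction.const Y (Real.pi / 2))) :=
      funext fun W => (hasFDerivAt_sinBCF W).fderiv
    rw [this]
    exact (ContinuousLinearMap.contDiff _).comp (ih.comp (contDiff_id.add contDiff_const))

end Sine

end BoundedContinuous

end ParabolicSineGordon
namespace ParabolicSineGordon

/-! ### Free evolution and Duhamel integrals as bounded operators in logarithmic time. -/

section DuhamelOperators

open scoped BoundedContinuousFunction

variable {d : ℕ}

local notation "𝕏" => EuclideanSpace ℝ (Fin d)

/-- A continuous positive parametrization of time, in which `θ` near `-∞` is the logarithm of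
time. -/
structure IsClock (τ : ℝ → ℝ) : Prop where
  continuous : Continuous τ
  pos : ∀ θ, 0 < τ θ
  log_mul : ∀ θ, ∀ σ ∈ Ioo (0 : ℝ) 1, τ (Real.log (τ θ * σ)) = τ θ * σ

theorem isClock_exp : IsClock Real.exp where
  continuous := Real.continuous_exp
  pos := Real.exp_pos
  log_mul θ _ hσ := Real.exp_log (mul_pos (Real.exp_pos θ) hσ.1)

/-- Freezing time at `T` keeps the weight `e^{Mt}` bounded, hence a multiplier of bounded continuous
functions; smoothness of `weightedSin` rests on this. Duhamel integrals look only at earlier times,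
so `log_mul` survives. -/
theorem isClock_min {T : ℝ} (hT : 0 < T) : IsClock fun θ => min (Real.exp θ) T where
  continuous := Real.continuous_exp.min continuous_const
  pos θ := lt_min (Real.exp_pos θ) hT
  log_mul θ σ hσ := by
    have h : 0 < min (Real.exp θ) T := lt_min (Real.exp_pos θ) hT
    rw [Real.exp_log (mul_pos h hσ.1), min_eq_left]
    exact (mul_le_of_le_one_right h.le hσ.2.le).trans (min_le_right _ _)

/-- The measure on `(σ, z)` used to write Duhamel integrals. -/
noncomputable def slabMeasure (d : ℕ) : Measure (ℝ × EuclideanSpace ℝ (Fin d)) :=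
  (volume.restrict (Ioo (0 : ℝ) 1)).prod volume

theorem ae_slabMeasure : ∀ᵐ p ∂(slabMeasure d), p.1 ∈ Ioo (0 : ℝ) 1 :=
  Measure.quasiMeasurePreserving_fst.ae (ae_restrict_mem measurableSet_Ioo)

theorem integrable_slabMeasure {η : ℝ} (hη : 0 < η) :
    Integrable (fun p : ℝ × 𝕏 => Real.exp (-η * ‖p.2‖ ^ 2)) (slabMeasure d) := by
  have := Integrable.mul_prod (μ := volume.restrict (Ioo (0 : ℝ) 1)) (ν := (volume : Measure 𝕏))
    (integrable_const (1 : ℝ)) (integrable_gaussian hη)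
  simpa [slabMeasure] using this

/-- The integrand of the weighted Duhamel operator. -/
noncomputable def duhamelIntegrand (τ : ℝ → ℝ) (η M : ℝ) (k f : ℝ × 𝕏 →ᵇ ℝ) (q p : ℝ × 𝕏) : ℝ :=
  -- With `t = τ θ` the substitutions are `s = tσ`, whose Jacobian is the first factor, and `y = x -
  -- √(t - s) z`. The factor `e^{-M(t-s)}` is what the weights at times `t` and `s` leave, and time
  -- `s` is read off at `θ = log s`.
  τ q.1 * Real.exp (-M * (τ q.1 * (1 - p.1)))
    * (k (√(τ q.1 * (1 - p.1)), p.2) * Real.exp (-η * ‖p.2‖ ^ 2))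
    * f (Real.log (τ q.1 * p.1), q.2 - √(τ q.1 * (1 - p.1)) • p.2)

theorem measurable_duhamelIntegrand (τ : ℝ → ℝ) (η M : ℝ) (k f : ℝ × 𝕏 →ᵇ ℝ) (q : ℝ × 𝕏) :
    Measurable (duhamelIntegrand τ η M k f q) := by
  unfold duhamelIntegrand
  refine Measurable.mul (Measurable.mul ?_ (Measurable.mul ?_ ?_)) ?_
  · fun_prop
  · exact k.continuous.measurable.comp (by fun_prop)
  · fun_prop
  · exact f.continuous.measurable.comp (by fun_prop)

theorem abs_duhamelIntegrand_le {τ : ℝ → ℝ} (hτ : IsClock τ) (η M : ℝ) (k f : ℝ × 𝕏 →ᵇ ℝ)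
    (q p : ℝ × 𝕏) : |duhamelIntegrand τ η M k f q p|
      ≤ ‖k‖ * ‖f‖ * (τ q.1 * Real.exp (-M * (τ q.1 * (1 - p.1))) * Real.exp (-η * ‖p.2‖ ^ 2)) := by
  unfold duhamelIntegrand
  rw [abs_mul, abs_mul, abs_mul, abs_mul, Real.abs_exp, Real.abs_exp, abs_of_pos (hτ.pos _)]
  have h1 := k.norm_coe_le_norm (√(τ q.1 * (1 - p.1)), p.2)
  have h2 := f.norm_coe_le_norm (Real.log (τ q.1 * p.1), q.2 - √(τ q.1 * (1 - p.1)) • p.2)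
  rw [Real.norm_eq_abs] at h1 h2
  have h0 := (hτ.pos q.1).le
  calc _ ≤ τ q.1 * Real.exp (-M * (τ q.1 * (1 - p.1))) * (‖k‖ * Real.exp (-η * ‖p.2‖ ^ 2)) * ‖f‖ := by
        gcongr
    _ = _ := by ring

theorem abs_duhamelIntegrand_le' {τ : ℝ → ℝ} (hτ : IsClock τ) (η : ℝ) {M : ℝ} (hM : 0 ≤ M)
    (k f : ℝ × 𝕏 →ᵇ ℝ) (q p : ℝ × 𝕏) (hp : p.1 ∈ Ioo (0 : ℝ) 1) : |duhamelIntegrand τ η M k f q p|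
      ≤ ‖k‖ * ‖f‖ * τ q.1 * Real.exp (-η * ‖p.2‖ ^ 2) := by
  refine (abs_duhamelIntegrand_le hτ η M k f q p).trans ?_
  have h0 := (hτ.pos q.1).le
  have h1 : Real.exp (-M * (τ q.1 * (1 - p.1))) ≤ 1 := by
    rw [Real.exp_le_one_iff, neg_mul, neg_nonpos]
    exact mul_nonneg hM (mul_nonneg h0 (by linarith [hp.2]))
  calc _ ≤ ‖k‖ * ‖f‖ * (τ q.1 * 1 * Real.exp (-η * ‖p.2‖ ^ 2)) := by gcongr
    _ = _ := by ring

theorem integrable_duhamelIntegrand {τ : ℝ → ℝ} (hτ : IsClock τ) {η M : ℝ} (hη : 0 < η)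
    (hM : 0 ≤ M) (k f : ℝ × 𝕏 →ᵇ ℝ) (q : ℝ × 𝕏) :
    Integrable (duhamelIntegrand τ η M k f q) (slabMeasure d) := by
  refine ((integrable_slabMeasure hη).const_mul (‖k‖ * ‖f‖ * τ q.1)).mono'
    (measurable_duhamelIntegrand τ η M k f q).aestronglyMeasurable ?_
  filter_upwards [ae_slabMeasure] with p hp
  exact abs_duhamelIntegrand_le' hτ η hM k f q p hp

theorem continuous_integral_duhamelIntegrand {τ : ℝ → ℝ} (hτ : IsClock τ) {η M : ℝ} (hη : 0 < η)
    (hM : 0 ≤ M) (k f : ℝ × 𝕏 →ᵇ ℝ) :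
    Continuous fun q => ∫ p, duhamelIntegrand τ η M k f q p ∂(slabMeasure d) := by
  rw [continuous_iff_continuousAt]
  intro q₀
  refine continuousAt_of_dominated
    (bound := fun p => ‖k‖ * ‖f‖ * (τ q₀.1 + 1) * Real.exp (-η * ‖p.2‖ ^ 2))
    (Eventually.of_forall fun q => (measurable_duhamelIntegrand τ η M k f q).aestronglyMeasurable)
    ?_ ((integrable_slabMeasure hη).const_mul _) ?_
  · have : ∀ᶠ q : ℝ × 𝕏 in 𝓝 q₀, τ q.1 < τ q₀.1 + 1 :=
      (hτ.continuous.comp continuous_fst).continuousAt.eventually_lt continuousAt_const (by simp)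
    filter_upwards [this] with q hq
    filter_upwards [ae_slabMeasure] with p hp
    refine (abs_duhamelIntegrand_le' hτ η hM k f q p hp).trans ?_
    gcongr
  · filter_upwards [ae_slabMeasure] with p hp
    have hc : Continuous fun q : ℝ × 𝕏 => τ q.1 := hτ.continuous.comp continuous_fst
    have hne : ∀ q : ℝ × 𝕏, τ q.1 * p.1 ≠ 0 := fun q => (mul_pos (hτ.pos _) hp.1).ne'
    have hl : Continuous fun q : ℝ × 𝕏 => Real.log (τ q.1 * p.1) :=
      (hc.mul continuous_const).log hne
    have hr : Continuous fun q : ℝ × 𝕏 => √(τ q.1 * (1 - p.1)) :=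
      (hc.mul continuous_const).sqrt
    unfold duhamelIntegrand
    refine Continuous.continuousAt ?_
    refine Continuous.mul (Continuous.mul ?_ (Continuous.mul ?_ continuous_const)) ?_
    · exact hc.mul (Real.continuous_exp.comp (continuous_const.mul (hc.mul continuous_const)))
    · exact k.continuous.comp (hr.prodMk continuous_const)
    · exact f.continuous.comp (hl.prodMk (continuous_snd.sub (hr.smul continuous_const)))

/-- The integral equals `(1 - e^{-Mt}) / M`. The bound does not depend on `t`, which is why a large
`M` gives a contraction globally in time. -/
theorem integral_mul_exp_le {t M : ℝ} (hM : 0 < M) :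
    ∫ σ in Ioo (0 : ℝ) 1, t * Real.exp (-M * (t * (1 - σ))) ≤ M⁻¹ := by
  rw [← integral_Ioc_eq_integral_Ioo, ← intervalIntegral.integral_of_le zero_le_one]
  have hd : ∀ σ ∈ uIcc (0 : ℝ) 1, HasDerivAt (fun σ => M⁻¹ * Real.exp (-M * (t * (1 - σ))))
      (t * Real.exp (-M * (t * (1 - σ)))) σ := by
    intro σ _
    have h1 : HasDerivAt (fun σ : ℝ => -M * (t * (1 - σ))) (-M * (t * (0 - 1))) σ :=
      (((hasDerivAt_const σ (1 : ℝ)).sub (hasDerivAt_id σ)).const_mul t).const_mul (-M)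
    convert! h1.exp.const_mul M⁻¹ using 1
    field_simp
    ring
  rw [intervalIntegral.integral_eq_sub_of_hasDerivAt hd (by
    apply Continuous.intervalIntegrable; fun_prop)]
  have : 0 < M⁻¹ * Real.exp (-M * (t * (1 - 0))) := by positivity
  simp only [sub_self, mul_zero, Real.exp_zero, mul_one] at this ⊢
  linarith

theorem norm_integral_duhamelIntegrand_le {τ : ℝ → ℝ} (hτ : IsClock τ) {η M : ℝ} (hη : 0 < η)
    (hM : 0 < M) (k f : ℝ × 𝕏 →ᵇ ℝ) (q : ℝ × 𝕏) :
    ‖∫ p, duhamelIntegrand τ η M k f q p ∂(slabMeasure d)‖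
      ≤ (M⁻¹ * ∫ z : 𝕏, Real.exp (-η * ‖z‖ ^ 2)) * ‖k‖ * ‖f‖ := by
  have hprod : Integrable (fun p : ℝ × 𝕏 => τ q.1 * Real.exp (-M * (τ q.1 * (1 - p.1)))
      * Real.exp (-η * ‖p.2‖ ^ 2)) (slabMeasure d) := by
    refine Integrable.mul_prod (μ := volume.restrict (Ioo (0 : ℝ) 1)) (ν := (volume : Measure 𝕏))
      (f := fun σ => τ q.1 * Real.exp (-M * (τ q.1 * (1 - σ)))) ?_ (integrable_gaussian hη)
    exact ((Continuous.integrableOn_Icc (by fun_prop)).mono_set Ioo_subset_Icc_self)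
  have h := norm_integral_le_of_norm_le (hprod.const_mul (‖k‖ * ‖f‖))
    (Eventually.of_forall fun p => (Real.norm_eq_abs _).le.trans
      (abs_duhamelIntegrand_le hτ η M k f q p))
  rw [integral_const_mul] at h
  refine h.trans ?_
  rw [slabMeasure, integral_prod_mul (fun σ => τ q.1 * Real.exp (-M * (τ q.1 * (1 - σ))))
    (fun z : 𝕏 => Real.exp (-η * ‖z‖ ^ 2))]
  have h2 : 0 ≤ ∫ z : 𝕏, Real.exp (-η * ‖z‖ ^ 2) := integral_nonneg fun z => (Real.exp_pos _).le
  calc _ ≤ ‖k‖ * ‖f‖ * (M⁻¹ * ∫ z : 𝕏, Real.exp (-η * ‖z‖ ^ 2)) := by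
        gcongr
        exact integral_mul_exp_le hM
    _ = _ := by ring

/-- The weighted Duhamel operator, as a bounded bilinear map of the kernel and the forcing. -/
noncomputable def duhamelOp {τ : ℝ → ℝ} (hτ : IsClock τ) {η M : ℝ} (hη : 0 < η) (hM : 0 < M) :
    (ℝ × 𝕏 →ᵇ ℝ) →L[ℝ] (ℝ × 𝕏 →ᵇ ℝ) →L[ℝ] (ℝ × 𝕏 →ᵇ ℝ) :=
  LinearMap.mkContinuous₂ (LinearMap.mk₂ ℝ
    (fun k f => BoundedContinuousFunction.ofNormedAddCommGroup _
      (continuous_integral_duhamelIntegrand hτ hη hM.le k f) _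
      (norm_integral_duhamelIntegrand_le hτ hη hM k f))
    (by
      intro k₁ k₂ f
      ext q
      simp only [BoundedContinuousFunction.coe_ofNormedAddCommGroup,
        BoundedContinuousFunction.add_apply]
      rw [← integral_add (integrable_duhamelIntegrand hτ hη hM.le _ _ _)
        (integrable_duhamelIntegrand hτ hη hM.le _ _ _)]
      congr 1
      ext p
      simp only [duhamelIntegrand, BoundedContinuousFunction.add_apply]
      ring)
    (by
      intro c k f
      ext q
      simp only [BoundedContinuousFunction.coe_ofNormedAddCommGroup,
        BoundedContinuousFunction.smul_apply]
      rw [← integral_smul]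
      congr 1
      ext p
      simp only [duhamelIntegrand, BoundedContinuousFunction.smul_apply, smul_eq_mul]
      ring)
    (by
      intro k f₁ f₂
      ext q
      simp only [BoundedContinuousFunction.coe_ofNormedAddCommGroup,
        BoundedContinuousFunction.add_apply]
      rw [← integral_add (integrable_duhamelIntegrand hτ hη hM.le _ _ _)
        (integrable_duhamelIntegrand hτ hη hM.le _ _ _)]
      congr 1
      ext p
      simp only [duhamelIntegrand, BoundedContinuousFunction.add_apply]
      ring)
    (by
      intro c k f
      ext q
      simp only [BoundedContinuousFunction.coe_ofNormedAddCommGroup,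
        BoundedContinuousFunction.smul_apply]
      rw [← integral_smul]
      congr 1
      ext p
      simp only [duhamelIntegrand, BoundedContinuousFunction.smul_apply, smul_eq_mul]
      ring))
    (M⁻¹ * ∫ z : 𝕏, Real.exp (-η * ‖z‖ ^ 2))
    (fun k f => BoundedContinuousFunction.norm_ofNormedAddCommGroup_le _
      (by
        have : 0 ≤ ∫ z : 𝕏, Real.exp (-η * ‖z‖ ^ 2) := integral_nonneg fun z => (Real.exp_pos _).le
        positivity) (norm_integral_duhamelIntegrand_le hτ hη hM k f))

theorem duhamelOp_apply {τ : ℝ → ℝ} (hτ : IsClock τ) {η M : ℝ} (hη : 0 < η) (hM : 0 < M)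
    (k f : ℝ × 𝕏 →ᵇ ℝ) (q : ℝ × 𝕏) : duhamelOp hτ hη hM k f q
      = ∫ p, duhamelIntegrand τ η M k f q p ∂(slabMeasure d) := rfl

theorem norm_duhamelOp_apply_le {τ : ℝ → ℝ} (hτ : IsClock τ) {η M : ℝ} (hη : 0 < η) (hM : 0 < M)
    (k f : ℝ × 𝕏 →ᵇ ℝ) :
    ‖duhamelOp hτ hη hM k f‖ ≤ (M⁻¹ * ∫ z : 𝕏, Real.exp (-η * ‖z‖ ^ 2)) * ‖k‖ * ‖f‖ := by
  have : 0 ≤ ∫ z : 𝕏, Real.exp (-η * ‖z‖ ^ 2) := integral_nonneg fun z => (Real.exp_pos _).le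
  rw [BoundedContinuousFunction.norm_le (by positivity)]
  exact norm_integral_duhamelIntegrand_le hτ hη hM k f

/-- The integrand of the weighted free evolution. -/
noncomputable def freeIntegrand (τ : ℝ → ℝ) (η : ℝ) (u₀ : 𝕏 → ℝ) (k : ℝ × 𝕏 →ᵇ ℝ)
    (q : ℝ × 𝕏) (z : 𝕏) : ℝ :=
  k (√(τ q.1), z) * Real.exp (-η * ‖z‖ ^ 2) * u₀ (q.2 - √(τ q.1) • z)

theorem abs_freeIntegrand_le (τ : ℝ → ℝ) (η : ℝ) {u₀ : 𝕏 → ℝ} {B : ℝ} (hB : ∀ y, |u₀ y| ≤ B)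
    (k : ℝ × 𝕏 →ᵇ ℝ) (q : ℝ × 𝕏) (z : 𝕏) :
    |freeIntegrand τ η u₀ k q z| ≤ ‖k‖ * B * Real.exp (-η * ‖z‖ ^ 2) := by
  unfold freeIntegrand
  rw [abs_mul, abs_mul, Real.abs_exp]
  have h1 := k.norm_coe_le_norm (√(τ q.1), z)
  rw [Real.norm_eq_abs] at h1
  calc _ ≤ ‖k‖ * Real.exp (-η * ‖z‖ ^ 2) * B := by
        gcongr
        exact hB _
    _ = _ := by ring

theorem integrable_freeIntegrand (τ : ℝ → ℝ) {η : ℝ} (hη : 0 < η) {u₀ : 𝕏 → ℝ} {B : ℝ}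
    (hu₀ : Measurable u₀) (hB : ∀ y, |u₀ y| ≤ B) (k : ℝ × 𝕏 →ᵇ ℝ) (q : ℝ × 𝕏) :
    Integrable (freeIntegrand τ η u₀ k q) := by
  refine ((integrable_gaussian hη).const_mul (‖k‖ * B)).mono' ?_
    (Eventually.of_forall (abs_freeIntegrand_le τ η hB k q))
  unfold freeIntegrand
  refine (Measurable.mul (Measurable.mul ?_ (by fun_prop)) (by fun_prop)).aestronglyMeasurable
  exact k.continuous.measurable.comp (by fun_prop)

/-- Undoes the parabolic scaling. As `u₀` is only measurable, continuity in `(θ, x)` must be carried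
by the kernel, so `u₀` has to be evaluated at the integration variable alone. -/
theorem integral_freeIntegrand_eq {τ : ℝ → ℝ} (hτ : IsClock τ) (η : ℝ) (u₀ : 𝕏 → ℝ)
    (k : ℝ × 𝕏 →ᵇ ℝ) (q : ℝ × 𝕏) : ∫ z, freeIntegrand τ η u₀ k q z
      = ∫ y, (√(τ q.1) ^ d)⁻¹ * (k (√(τ q.1), (√(τ q.1))⁻¹ • (q.2 - y))
        * Real.exp (-η * ‖(√(τ q.1))⁻¹ • (q.2 - y)‖ ^ 2)) * u₀ y := by
  set r := √(τ q.1) with hr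
  have hr0 : 0 < r := Real.sqrt_pos.2 (hτ.pos _)
  have h1 := Measure.integral_comp_smul (volume : Measure 𝕏) (fun w : 𝕏 =>
    k (r, r⁻¹ • w) * Real.exp (-η * ‖r⁻¹ • w‖ ^ 2) * u₀ (q.2 - w)) r
  simp_rw [smul_smul, inv_mul_cancel₀ hr0.ne', one_smul] at h1
  unfold freeIntegrand
  rw [← hr, h1, finrank_euclideanSpace_fin, abs_of_pos (by positivity), smul_eq_mul,
    ← integral_sub_left_eq_self (fun w : 𝕏 =>
      k (r, r⁻¹ • w) * Real.exp (-η * ‖r⁻¹ • w‖ ^ 2) * u₀ (q.2 - w)) volume q.2,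
    ← integral_const_mul]
  simp only [sub_sub_cancel, mul_assoc]

theorem continuous_integral_freeIntegrand {τ : ℝ → ℝ} (hτ : IsClock τ) {η : ℝ} (hη : 0 < η)
    {u₀ : 𝕏 → ℝ} {B : ℝ} (hu₀ : Measurable u₀) (hB : ∀ y, |u₀ y| ≤ B) (k : ℝ × 𝕏 →ᵇ ℝ) :
    Continuous fun q => ∫ z, freeIntegrand τ η u₀ k q z := by
  have hB0 : 0 ≤ B := (abs_nonneg _).trans (hB 0)
  simp_rw [integral_freeIntegrand_eq hτ]
  have hc : Continuous fun q : ℝ × 𝕏 => √(τ q.1) := (hτ.continuous.comp continuous_fst).sqrt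
  have hpos : ∀ q : ℝ × 𝕏, 0 < √(τ q.1) := fun q => Real.sqrt_pos.2 (hτ.pos _)
  rw [continuous_iff_continuousAt]
  intro q₀
  set r₀ := √(τ q₀.1) with hr₀
  have hr₀0 : 0 < r₀ := hpos q₀
  -- For `r < 2 r₀` one has `η / r² ≥ 2c`, and `‖x₀ - y‖² ≤ 2‖x - y‖² + 2` for `‖x - x₀‖ < 1`. Hence
  -- the exponent is at most `2c - c‖x₀ - y‖²`, a single Gaussian for all nearby points.
  set c := η / (8 * r₀ ^ 2) with hcdef
  have hc0 : 0 < c := by positivity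
  refine continuousAt_of_dominated (bound := fun y => ((r₀ / 2) ^ d)⁻¹
    * (‖k‖ * (Real.exp (2 * c) * Real.exp (-c * ‖q₀.2 - y‖ ^ 2))) * B) ?_ ?_ ?_ ?_
  · refine Eventually.of_forall fun q => Measurable.aestronglyMeasurable ?_
    refine Measurable.mul (Measurable.mul measurable_const (Measurable.mul ?_ ?_)) hu₀
    · exact k.continuous.measurable.comp (by fun_prop)
    · fun_prop
  · have h1 : ∀ᶠ q : ℝ × 𝕏 in 𝓝 q₀, r₀ / 2 < √(τ q.1) :=
      continuousAt_const.eventually_lt hc.continuousAt (by rw [← hr₀]; linarith)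
    have h2 : ∀ᶠ q : ℝ × 𝕏 in 𝓝 q₀, √(τ q.1) < 2 * r₀ :=
      hc.continuousAt.eventually_lt continuousAt_const (by rw [← hr₀]; linarith)
    have h3 : ∀ᶠ q : ℝ × 𝕏 in 𝓝 q₀, ‖q.2 - q₀.2‖ < 1 :=
      ((continuous_snd.sub continuous_const).norm.continuousAt).eventually_lt continuousAt_const
        (by simp)
    filter_upwards [h1, h2, h3] with q hq1 hq2 hq3
    refine Eventually.of_forall fun y => ?_
    rw [Real.norm_eq_abs, abs_mul, abs_mul, abs_mul, Real.abs_exp,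
      abs_of_pos (inv_pos.2 (pow_pos (hpos q) d))]
    have hk := k.norm_coe_le_norm (√(τ q.1), (√(τ q.1))⁻¹ • (q.2 - y))
    rw [Real.norm_eq_abs] at hk
    have hexp : Real.exp (-η * ‖(√(τ q.1))⁻¹ • (q.2 - y)‖ ^ 2)
        ≤ Real.exp (2 * c) * Real.exp (-c * ‖q₀.2 - y‖ ^ 2) := by
      rw [← Real.exp_add, Real.exp_le_exp, norm_smul, mul_pow, norm_inv, inv_pow,
        Real.norm_of_nonneg (hpos q).le]
      have hs : √(τ q.1) ^ 2 ≤ 4 * r₀ ^ 2 := by nlinarith [hpos q]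
      have hn : ‖q₀.2 - y‖ ^ 2 ≤ 2 * ‖q.2 - y‖ ^ 2 + 2 := by
        have h4 : ‖q₀.2 - y‖ ≤ ‖q.2 - y‖ + 1 := by
          have := norm_sub_le (q.2 - y) (q.2 - q₀.2)
          rw [show q.2 - y - (q.2 - q₀.2) = q₀.2 - y by abel] at this
          linarith
        nlinarith [norm_nonneg (q₀.2 - y), norm_nonneg (q.2 - y), sq_nonneg (‖q.2 - y‖ - 1)]
      have h5 : 2 * c * ‖q.2 - y‖ ^ 2 ≤ η * ((√(τ q.1) ^ 2)⁻¹ * ‖q.2 - y‖ ^ 2) := by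
        have h6 : 2 * c ≤ η * (√(τ q.1) ^ 2)⁻¹ := by
          rw [hcdef, ← div_eq_mul_inv, le_div_iff₀ (pow_pos (hpos q) 2)]
          calc 2 * (η / (8 * r₀ ^ 2)) * √(τ q.1) ^ 2 ≤ 2 * (η / (8 * r₀ ^ 2)) * (4 * r₀ ^ 2) := by
                gcongr
            _ = η := by field_simp; ring
        calc _ ≤ η * (√(τ q.1) ^ 2)⁻¹ * ‖q.2 - y‖ ^ 2 := by gcongr
          _ = _ := by ring
      nlinarith
    gcongr
    exact hB y
  · refine ((((integrable_gaussian hc0).comp_sub_left q₀.2).const_mul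
      (((r₀ / 2) ^ d)⁻¹ * ‖k‖ * Real.exp (2 * c))).mul_const B).congr
      (Eventually.of_forall fun y => ?_)
    simp only
    ring
  · refine Eventually.of_forall fun y => Continuous.continuousAt ?_
    have hi : Continuous fun q : ℝ × 𝕏 => (√(τ q.1))⁻¹ := hc.inv₀ fun q => (hpos q).ne'
    have hsm : Continuous fun q : ℝ × 𝕏 => (√(τ q.1))⁻¹ • (q.2 - y) :=
      hi.smul (continuous_snd.sub continuous_const)
    refine Continuous.mul (Continuous.mul ?_ (Continuous.mul ?_ ?_)) continuous_const
    · exact (hc.pow d).inv₀ fun q => (pow_pos (hpos q) d).ne'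
    · exact k.continuous.comp (hc.prodMk hsm)
    · exact Real.continuous_exp.comp (continuous_const.mul (hsm.norm.pow 2))

theorem abs_integral_freeIntegrand_le (τ : ℝ → ℝ) {η : ℝ} (hη : 0 < η) {u₀ : 𝕏 → ℝ} {B : ℝ}
    (hB : ∀ y, |u₀ y| ≤ B) (k : ℝ × 𝕏 →ᵇ ℝ) (q : ℝ × 𝕏) :
    |∫ z, freeIntegrand τ η u₀ k q z| ≤ (B * ∫ z : 𝕏, Real.exp (-η * ‖z‖ ^ 2)) * ‖k‖ := by
  have h := norm_integral_le_of_norm_le ((integrable_gaussian hη).const_mul (‖k‖ * B))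
    (Eventually.of_forall fun z => (Real.norm_eq_abs _).le.trans
      (abs_freeIntegrand_le τ η hB k q z))
  rw [integral_const_mul] at h
  rw [← Real.norm_eq_abs]
  refine h.trans (le_of_eq ?_)
  ring

theorem abs_weighted_free_le {τ : ℝ → ℝ} (hτ : IsClock τ) {η M : ℝ} (hη : 0 < η) (hM : 0 < M)
    {u₀ : 𝕏 → ℝ} {B : ℝ} (hB : ∀ y, |u₀ y| ≤ B) (k : ℝ × 𝕏 →ᵇ ℝ) (q : ℝ × 𝕏) :
    ‖Real.exp (-M * τ q.1) * ∫ z, freeIntegrand τ η u₀ k q z‖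
      ≤ (B * ∫ z : 𝕏, Real.exp (-η * ‖z‖ ^ 2)) * ‖k‖ := by
  rw [Real.norm_eq_abs, abs_mul, Real.abs_exp]
  refine le_trans ?_ (abs_integral_freeIntegrand_le τ hη hB k q)
  refine mul_le_of_le_one_left (abs_nonneg _) ?_
  rw [Real.exp_le_one_iff, neg_mul, neg_nonpos]
  exact mul_nonneg hM.le (hτ.pos _).le

/-- The weighted free evolution of `u₀`, as a bounded linear map of the kernel. -/
noncomputable def freeOp {τ : ℝ → ℝ} (hτ : IsClock τ) {η M : ℝ} (hη : 0 < η) (hM : 0 < M)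
    {u₀ : 𝕏 → ℝ} {B : ℝ} (hu₀ : Measurable u₀) (hB : ∀ y, |u₀ y| ≤ B) :
    (ℝ × 𝕏 →ᵇ ℝ) →L[ℝ] (ℝ × 𝕏 →ᵇ ℝ) :=
  LinearMap.mkContinuous
    { toFun := fun k => BoundedContinuousFunction.ofNormedAddCommGroup
        (fun q => Real.exp (-M * τ q.1) * ∫ z, freeIntegrand τ η u₀ k q z)
        ((Real.continuous_exp.comp (continuous_const.mul (hτ.continuous.comp continuous_fst))).mul
          (continuous_integral_freeIntegrand hτ hη hu₀ hB k)) _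
        (abs_weighted_free_le hτ hη hM hB k)
      map_add' := by
        intro k₁ k₂
        ext q
        simp only [BoundedContinuousFunction.coe_ofNormedAddCommGroup,
          BoundedContinuousFunction.add_apply]
        rw [← mul_add, ← integral_add (integrable_freeIntegrand τ hη hu₀ hB _ _)
          (integrable_freeIntegrand τ hη hu₀ hB _ _)]
        congr 1
        refine integral_congr_ae (Eventually.of_forall fun z => ?_)
        simp only [freeIntegrand, BoundedContinuousFunction.add_apply]
        ring
      map_smul' := by
        intro c k
        ext q
        simp only [BoundedContinuousFunction.coe_ofNormedAddCommGroup,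
          BoundedContinuousFunction.smul_apply, RingHom.id_apply]
        rw [smul_eq_mul, mul_left_comm]
        congr 1
        rw [← integral_const_mul]
        refine integral_congr_ae (Eventually.of_forall fun z => ?_)
        simp only [freeIntegrand, BoundedContinuousFunction.smul_apply, smul_eq_mul]
        ring }
    (B * ∫ z : 𝕏, Real.exp (-η * ‖z‖ ^ 2))
    (fun k => BoundedContinuousFunction.norm_ofNormedAddCommGroup_le _
      (by
        have : 0 ≤ ∫ z : 𝕏, Real.exp (-η * ‖z‖ ^ 2) := integral_nonneg fun z => (Real.exp_pos _).le
        have : 0 ≤ B := (abs_nonneg _).trans (hB 0)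
        positivity) (abs_weighted_free_le hτ hη hM hB k))

theorem freeOp_apply {τ : ℝ → ℝ} (hτ : IsClock τ) {η M : ℝ} (hη : 0 < η) (hM : 0 < M)
    {u₀ : 𝕏 → ℝ} {B : ℝ} (hu₀ : Measurable u₀) (hB : ∀ y, |u₀ y| ≤ B) (k : ℝ × 𝕏 →ᵇ ℝ)
    (q : ℝ × 𝕏) : freeOp hτ hη hM hu₀ hB k q
      = Real.exp (-M * τ q.1) * ∫ z, freeIntegrand τ η u₀ k q z := rfl

end DuhamelOperators

end ParabolicSineGordon
namespace ParabolicSineGordon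

/-! ### The Picard map and the family of Gaussian kernels. -/

section Construction

open scoped BoundedContinuousFunction

variable {d : ℕ}

local notation "𝕏" => EuclideanSpace ℝ (Fin d)

/-- The right-hand side of Duhamel's formula for `∂ₜ U = μ Δ U + a · ∇U + l sin U`. -/
noncomputable def movingDuhamel (μ l : ℝ) (a : 𝕏) (u₀ : 𝕏 → ℝ) (U : ℝ → 𝕏 → ℝ) (t : ℝ)
    (x : 𝕏) : ℝ :=
  heatSemigroup (μ * t) u₀ (x + t • a)
    + l * ∫ s in (0 : ℝ)..t,
      heatSemigroup (μ * (t - s)) (fun y => Real.sin (U s y)) (x + (t - s) • a)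

theorem freeOp_eq {τ : ℝ → ℝ} (hτ : IsClock τ) {η M : ℝ} (hη : 0 < η) (hM : 0 < M)
    {u₀ : 𝕏 → ℝ} {B : ℝ} (hu₀ : Measurable u₀) (hB : ∀ y, |u₀ y| ≤ B) {k : ℝ × 𝕏 →ᵇ ℝ}
    {μ : ℝ} (hμ : 0 < μ) {a : 𝕏} {q : ℝ × 𝕏}
    (hk : ∀ r, 0 ≤ r → r ≤ √(τ q.1) → ∀ z,
      k (r, z) * Real.exp (-η * ‖z‖ ^ 2) = shiftedGaussian μ (r • a) z) :
    freeOp hτ hη hM hu₀ hB k q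
      = Real.exp (-M * τ q.1) * heatSemigroup (μ * τ q.1) u₀ (q.2 + τ q.1 • a) := by
  rw [freeOp_apply, heatSemigroup_scaling hμ (hτ.pos _)]
  congr 1
  refine integral_congr_ae (Eventually.of_forall fun z => ?_)
  simp only [freeIntegrand]
  rw [hk _ (Real.sqrt_nonneg _) le_rfl]

/-- The link with the actual Duhamel integral. The kernel has to be the Gaussian only for `r ≤ √t`,
since the diffusion times involved are at most `t`; this tolerates kernels truncated in `r`. -/
theorem duhamelOp_eq {τ : ℝ → ℝ} (hτ : IsClock τ) {η M : ℝ} (hη : 0 < η) (hM : 0 < M)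
    {k f : ℝ × 𝕏 →ᵇ ℝ} {G : ℝ → 𝕏 → ℝ}
    (hf : ∀ θ y, f (θ, y) = Real.exp (-M * τ θ) * G (τ θ) y)
    {μ : ℝ} (hμ : 0 < μ) {a : 𝕏} {q : ℝ × 𝕏}
    (hk : ∀ r, 0 ≤ r → r ≤ √(τ q.1) → ∀ z,
      k (r, z) * Real.exp (-η * ‖z‖ ^ 2) = shiftedGaussian μ (r • a) z) :
    duhamelOp hτ hη hM k f q = Real.exp (-M * τ q.1)
      * ∫ s in (0 : ℝ)..τ q.1, heatSemigroup (μ * (τ q.1 - s)) (G s) (q.2 + (τ q.1 - s) • a) := by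
  have hint := integrable_duhamelIntegrand hτ hη hM.le k f q
  rw [duhamelOp_apply]
  unfold slabMeasure at hint ⊢
  rw [integral_prod _ hint]
  set t := τ q.1 with ht
  have ht0 : 0 < t := hτ.pos _
  have h1 : ∫ s in (0 : ℝ)..t, heatSemigroup (μ * (t - s)) (G s) (q.2 + (t - s) • a)
      = t * ∫ σ in (0 : ℝ)..1,
        heatSemigroup (μ * (t - t * σ)) (G (t * σ)) (q.2 + (t - t * σ) • a) := by
    have := intervalIntegral.smul_integral_comp_mul_left
      (f := fun s => heatSemigroup (μ * (t - s)) (G s) (q.2 + (t - s) • a)) (a := 0) (b := 1) t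
    rw [mul_zero, mul_one, smul_eq_mul] at this
    exact this.symm
  rw [h1, intervalIntegral.integral_of_le zero_le_one, integral_Ioc_eq_integral_Ioo,
    ← integral_const_mul, ← integral_const_mul]
  refine setIntegral_congr_fun measurableSet_Ioo fun σ hσ => ?_
  have hσ' : 0 < t * (1 - σ) := mul_pos ht0 (by linarith [hσ.2])
  rw [show t - t * σ = t * (1 - σ) by ring, heatSemigroup_scaling hμ hσ', ← integral_const_mul,
    ← integral_const_mul]
  refine integral_congr_ae (Eventually.of_forall fun z => ?_)
  simp only [duhamelIntegrand]
  rw [← ht, hk _ (Real.sqrt_nonneg _)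
    (Real.sqrt_le_sqrt (mul_le_of_le_one_right ht0.le (by linarith [hσ.1]))), hf,
    ht, hτ.log_mul _ _ hσ, ← ht]
  have : Real.exp (-M * (t * (1 - σ))) * Real.exp (-M * (t * σ)) = Real.exp (-M * t) := by
    rw [← Real.exp_add]; ring_nf
  rw [← this]
  ring

/-- The sine nonlinearity in weighted unknowns. -/
noncomputable def weightedSin (τ : ℝ → ℝ) (M : ℝ) (W : ℝ × 𝕏 →ᵇ ℝ) : ℝ × 𝕏 →ᵇ ℝ :=
  toBCF fun q => Real.exp (-M * τ q.1) * Real.sin (Real.exp (M * τ q.1) * W q)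

theorem weightedSin_apply {τ : ℝ → ℝ} (hτ : IsClock τ) {M : ℝ} (hM : 0 < M) (W : ℝ × 𝕏 →ᵇ ℝ)
    (q : ℝ × 𝕏) :
    weightedSin τ M W q = Real.exp (-M * τ q.1) * Real.sin (Real.exp (M * τ q.1) * W q) := by
  have hc : Continuous fun q : ℝ × 𝕏 => τ q.1 := hτ.continuous.comp continuous_fst
  refine toBCF_apply (C := 1) ?_ (fun q => ?_) q
  · exact (Real.continuous_exp.comp (continuous_const.mul hc)).mul
      (Real.continuous_sin.comp ((Real.continuous_exp.comp (continuous_const.mul hc)).mul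
        W.continuous))
  · rw [abs_mul, Real.abs_exp]
    refine mul_le_one₀ ?_ (abs_nonneg _) (Real.abs_sin_le_one _)
    rw [Real.exp_le_one_iff, neg_mul, neg_nonpos]
    exact mul_nonneg hM.le (hτ.pos _).le

/-- The weights `e^{-Mτ}` and `e^{Mτ}` cancel, so the Lipschitz constant is independent of `M`,
which remains free to be large. -/
theorem norm_weightedSin_sub_le {τ : ℝ → ℝ} (hτ : IsClock τ) {M : ℝ} (hM : 0 < M)
    (W₁ W₂ : ℝ × 𝕏 →ᵇ ℝ) : ‖weightedSin τ M W₁ - weightedSin τ M W₂‖ ≤ ‖W₁ - W₂‖ := by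
  rw [BoundedContinuousFunction.norm_le (norm_nonneg _)]
  intro q
  rw [BoundedContinuousFunction.sub_apply, weightedSin_apply hτ hM, weightedSin_apply hτ hM,
    ← mul_sub, Real.norm_eq_abs, abs_mul, Real.abs_exp]
  have h1 := (W₁ - W₂).norm_coe_le_norm q
  rw [BoundedContinuousFunction.sub_apply, Real.norm_eq_abs] at h1
  have h2 := Real.abs_sin_sub_sin_le (Real.exp (M * τ q.1) * W₁ q) (Real.exp (M * τ q.1) * W₂ q)
  rw [← mul_sub, abs_mul, Real.abs_exp] at h2
  calc _ ≤ Real.exp (-M * τ q.1) * (Real.exp (M * τ q.1) * |W₁ q - W₂ q|) := by gcongr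
    _ = |W₁ q - W₂ q| := by
        rw [← mul_assoc, ← Real.exp_add]
        simp
    _ ≤ _ := h1

/-- The map whose fixed points are the weighted solutions of Duhamel's formula. -/
noncomputable def picardMap {τ : ℝ → ℝ} (hτ : IsClock τ) {η M : ℝ} (hη : 0 < η) (hM : 0 < M)
    {u₀ : 𝕏 → ℝ} {B : ℝ} (hu₀ : Measurable u₀) (hB : ∀ y, |u₀ y| ≤ B) (l : ℝ)
    (k W : ℝ × 𝕏 →ᵇ ℝ) : ℝ × 𝕏 →ᵇ ℝ :=
  freeOp hτ hη hM hu₀ hB k + l • duhamelOp hτ hη hM k (weightedSin τ M W)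

theorem picardMap_apply_eq {τ : ℝ → ℝ} (hτ : IsClock τ) {η M : ℝ} (hη : 0 < η) (hM : 0 < M)
    {u₀ : 𝕏 → ℝ} {B : ℝ} (hu₀ : Measurable u₀) (hB : ∀ y, |u₀ y| ≤ B) {l : ℝ}
    {k W : ℝ × 𝕏 →ᵇ ℝ} {U : ℝ → 𝕏 → ℝ}
    (hW : ∀ θ y, W (θ, y) = Real.exp (-M * τ θ) * U (τ θ) y)
    {μ : ℝ} (hμ : 0 < μ) {a : 𝕏} {q : ℝ × 𝕏}
    (hk : ∀ r, 0 ≤ r → r ≤ √(τ q.1) → ∀ z,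
      k (r, z) * Real.exp (-η * ‖z‖ ^ 2) = shiftedGaussian μ (r • a) z) :
    picardMap hτ hη hM hu₀ hB l k W q
      = Real.exp (-M * τ q.1) * movingDuhamel μ l a u₀ U (τ q.1) q.2 := by
  have hN : ∀ θ y, weightedSin τ M W (θ, y) = Real.exp (-M * τ θ) * Real.sin (U (τ θ) y) := by
    intro θ y
    rw [weightedSin_apply hτ hM, hW, ← mul_assoc, ← Real.exp_add]
    simp
  rw [picardMap, BoundedContinuousFunction.add_apply, BoundedContinuousFunction.smul_apply,
    freeOp_eq hτ hη hM hu₀ hB hμ hk,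
    duhamelOp_eq hτ hη hM (G := fun s y => Real.sin (U s y)) hN hμ hk, movingDuhamel, smul_eq_mul]
  ring

theorem norm_picardMap_sub_le {τ : ℝ → ℝ} (hτ : IsClock τ) {η M : ℝ} (hη : 0 < η) (hM : 0 < M)
    {u₀ : 𝕏 → ℝ} {B : ℝ} (hu₀ : Measurable u₀) (hB : ∀ y, |u₀ y| ≤ B) (l : ℝ)
    (k W₁ W₂ : ℝ × 𝕏 →ᵇ ℝ) :
    ‖picardMap hτ hη hM hu₀ hB l k W₁ - picardMap hτ hη hM hu₀ hB l k W₂‖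
      ≤ |l| * ((M⁻¹ * ∫ z : 𝕏, Real.exp (-η * ‖z‖ ^ 2)) * ‖k‖) * ‖W₁ - W₂‖ := by
  have h0 : 0 ≤ ∫ z : 𝕏, Real.exp (-η * ‖z‖ ^ 2) := integral_nonneg fun z => (Real.exp_pos _).le
  have e : picardMap hτ hη hM hu₀ hB l k W₁ - picardMap hτ hη hM hu₀ hB l k W₂
      = l • duhamelOp hτ hη hM k (weightedSin τ M W₁ - weightedSin τ M W₂) := by
    rw [map_sub]
    ext q
    simp only [picardMap, BoundedContinuousFunction.sub_apply,
      BoundedContinuousFunction.add_apply, BoundedContinuousFunction.smul_apply, smul_eq_mul]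
    ring
  rw [e, norm_smul, Real.norm_eq_abs]
  calc _ ≤ |l| * ((M⁻¹ * ∫ z : 𝕏, Real.exp (-η * ‖z‖ ^ 2)) * ‖k‖
        * ‖weightedSin τ M W₁ - weightedSin τ M W₂‖) := by
        gcongr
        exact norm_duhamelOp_apply_le hτ hη hM _ _
    _ ≤ |l| * ((M⁻¹ * ∫ z : 𝕏, Real.exp (-η * ‖z‖ ^ 2)) * ‖k‖ * ‖W₁ - W₂‖) := by
        gcongr
        exact norm_weightedSin_sub_le hτ hM _ _
    _ = _ := by ring

/-- Exponents of the Gaussian family: quadratic, linear and constant part. -/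
noncomputable def gaussExponent (R : ℝ) (y : ℝ × 𝕏) : (ℝ × 𝕏 × ℝ) →L[ℝ] ℝ :=
  (‖y.2‖ ^ 2) • ContinuousLinearMap.fst ℝ ℝ (𝕏 × ℝ)
    + (max 0 (min y.1 R)) • ((innerSL ℝ y.2).comp
      ((ContinuousLinearMap.fst ℝ 𝕏 ℝ).comp (ContinuousLinearMap.snd ℝ ℝ (𝕏 × ℝ))))
    + ((max 0 (min y.1 R)) ^ 2) •
      ((ContinuousLinearMap.snd ℝ 𝕏 ℝ).comp (ContinuousLinearMap.snd ℝ ℝ (𝕏 × ℝ)))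

theorem gaussExponent_apply (R : ℝ) (y : ℝ × 𝕏) (q : ℝ × 𝕏 × ℝ) :
    gaussExponent R y q = ‖y.2‖ ^ 2 * q.1 + max 0 (min y.1 R) * inner ℝ y.2 q.2.1
      + (max 0 (min y.1 R)) ^ 2 * q.2.2 := by
  simp [gaussExponent]

theorem continuous_gaussExponent (R : ℝ) : Continuous (gaussExponent (d := d) R) := by
  unfold gaussExponent
  have : Continuous fun y : ℝ × 𝕏 => innerSL ℝ y.2 := (innerSL ℝ).continuous.comp continuous_snd
  fun_prop

/-- Truncating `r` at `R` bounds the drift terms, so that the exponent grows no faster than the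
quadratic `2‖z‖²`, which a Gaussian can control. -/
theorem norm_gaussExponent_le {R : ℝ} (hR : 0 ≤ R) (y : ℝ × 𝕏) :
    ‖gaussExponent R y‖ ≤ 2 * ‖y.2‖ ^ 2 + 2 * R ^ 2 := by
  refine ContinuousLinearMap.opNorm_le_bound _ (by positivity) fun q => ?_
  rw [gaussExponent_apply, Real.norm_eq_abs]
  set c := max 0 (min y.1 R) with hc
  have hc0 : 0 ≤ c := le_max_left _ _
  have hcR : c ≤ R := max_le hR (min_le_right _ _)
  have h1 : |q.1| ≤ ‖q‖ := norm_fst_le q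
  have h2 : ‖q.2.1‖ ≤ ‖q‖ := (norm_fst_le q.2).trans (norm_snd_le q)
  have h3 : |q.2.2| ≤ ‖q‖ := (norm_snd_le q.2).trans (norm_snd_le q)
  have h4 : |inner ℝ y.2 q.2.1| ≤ ‖y.2‖ * ‖q‖ :=
    (abs_real_inner_le_norm _ _).trans (by gcongr)
  calc _ ≤ |‖y.2‖ ^ 2 * q.1| + |c * inner ℝ y.2 q.2.1| + |c ^ 2 * q.2.2| := abs_add_three _ _ _
    _ = ‖y.2‖ ^ 2 * |q.1| + c * |inner ℝ y.2 q.2.1| + c ^ 2 * |q.2.2| := by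
        rw [abs_mul, abs_mul, abs_mul, abs_of_nonneg hc0, abs_of_nonneg (sq_nonneg c),
          abs_of_nonneg (sq_nonneg ‖y.2‖)]
    _ ≤ ‖y.2‖ ^ 2 * ‖q‖ + R * (‖y.2‖ * ‖q‖) + R ^ 2 * ‖q‖ := by gcongr
    _ = (‖y.2‖ ^ 2 + R * ‖y.2‖ + R ^ 2) * ‖q‖ := by ring
    _ ≤ _ := by
        refine mul_le_mul_of_nonneg_right ?_ (norm_nonneg q)
        nlinarith [sq_nonneg (‖y.2‖ - R), sq_nonneg ‖y.2‖, sq_nonneg R]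

/-- The radius `η / 2` is matched to the growth `2‖z‖²` of the exponent: their product is the
`η‖z‖²` of the Gaussian, and only `e^{ηR²}` remains. -/
theorem expDecay_gaussian {R η : ℝ} (hR : 0 ≤ R) (hη : 0 < η) :
    ExpDecay (gaussExponent (d := d) R) (η / 2) (fun y => Real.exp (-η * ‖y.2‖ ^ 2)) where
  continuous := by fun_prop
  bound := by
    intro δ hδ
    refine ⟨Real.exp (η * R ^ 2), fun y => ?_⟩
    rw [Real.abs_exp, ← Real.exp_add, Real.exp_le_exp]
    have h1 := norm_gaussExponent_le hR y
    have h2 : δ * ‖gaussExponent R y‖ ≤ η / 2 * ‖gaussExponent R y‖ := by gcongr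
    have h3 : η / 2 * ‖gaussExponent R y‖ ≤ η / 2 * (2 * ‖y.2‖ ^ 2 + 2 * R ^ 2) := by gcongr
    linarith

/-- The exponent parameters of the Gaussian of diffusivity `κ² l` and drift `a`, relative to
diffusivity `κ²` and drift `0`. -/
noncomputable def gaussParam (κ : ℝ) (p : ℝ × 𝕏) : ℝ × 𝕏 × ℝ :=
  (-(1 / (4 * κ ^ 2)) * p.1⁻¹ + 1 / (4 * κ ^ 2), (-(1 / (2 * κ ^ 2)) * p.1⁻¹) • p.2,
    -(1 / (4 * κ ^ 2)) * p.1⁻¹ * ‖p.2‖ ^ 2)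

/-- The Gaussian of diffusivity `κ² l` and drift `a`, relative to `exp (-‖z‖² / (8κ²))`. -/
noncomputable def kernelFamily (κ R : ℝ) (p : ℝ × 𝕏) : ℝ × 𝕏 →ᵇ ℝ :=
  ((4 * Real.pi * (κ ^ 2 * p.1)) ^ (-((d : ℝ) / 2))) • toBCF (fun y =>
    Real.exp (gaussExponent R y (gaussParam κ p)) * Real.exp (-(1 / (8 * κ ^ 2)) * ‖y.2‖ ^ 2))

theorem gaussParam_one (κ : ℝ) : gaussParam (d := d) κ (1, 0) = 0 := by
  simp [gaussParam]

theorem contDiffAt_gaussParam (κ : ℝ) : ContDiffAt ℝ ∞ (gaussParam (d := d) κ) (1, 0) := by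
  unfold gaussParam
  have h1 : ContDiffAt ℝ ∞ (fun p : ℝ × 𝕏 => p.1⁻¹) (1, 0) := contDiffAt_fst.inv (by simp)
  have h2 : ContDiffAt ℝ ∞ (fun p : ℝ × 𝕏 => ‖p.2‖ ^ 2) (1, 0) := contDiffAt_snd.norm_sq ℝ
  exact ((contDiffAt_const.mul h1).add contDiffAt_const).prodMk
    (((contDiffAt_const.mul h1).smul contDiffAt_snd).prodMk ((contDiffAt_const.mul h1).mul h2))

theorem gaussParam_mem {κ : ℝ} (hκ : 0 < κ) : ∀ᶠ p in 𝓝 ((1, 0) : ℝ × 𝕏),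
    gaussParam κ p ∈ Metric.ball (0 : ℝ × 𝕏 × ℝ) (1 / (8 * κ ^ 2) / 2) := by
  refine (contDiffAt_gaussParam κ).continuousAt.eventually_mem ?_
  rw [gaussParam_one]
  exact Metric.ball_mem_nhds _ (by positivity)

theorem contDiffAt_kernelFamily {κ R : ℝ} (hκ : 0 < κ) (hR : 0 ≤ R) :
    ContDiffAt ℝ ∞ (kernelFamily (d := d) κ R) (1, 0) := by
  unfold kernelFamily
  have hc : ContDiffAt ℝ ∞ (fun p : ℝ × 𝕏 => (4 * Real.pi * (κ ^ 2 * p.1)) ^ (-((d : ℝ) / 2)))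
      (1, 0) := by
    refine ContDiffAt.rpow_const_of_ne ?_ (by simp; positivity)
    exact contDiffAt_const.mul (contDiffAt_const.mul contDiffAt_fst)
  refine hc.smul ?_
  have hη : 0 < 1 / (8 * κ ^ 2) := by positivity
  rw [contDiffAt_infty]
  intro n
  have h1 := ((expDecay_gaussian (d := d) hR hη).contDiffOn (continuous_gaussExponent R) n)
  have h2 : ContDiffAt ℝ n (fun q => toBCF (fun y : ℝ × 𝕏 =>
      Real.exp (gaussExponent R y q) * Real.exp (-(1 / (8 * κ ^ 2)) * ‖y.2‖ ^ 2)))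
      (gaussParam κ (1, 0)) := by
    rw [gaussParam_one]
    exact h1.contDiffAt (Metric.ball_mem_nhds _ (by positivity))
  exact h2.comp _ ((contDiffAt_gaussParam κ).of_le (by exact_mod_cast le_top))

/-- The Gaussian `exp (-‖z‖² / (4κ²))` is shared equally: one half stays in the family and pays for
changes of the parameters, the other is the integrable weight of the operators. The remaining
exponent is linear in `gaussParam`, by expanding `‖z + r a‖²`. Truncation in `r` is invisible if `r
≤ R` or if there is no drift. -/
theorem kernelFamily_mul_exp {κ R : ℝ} (hκ : 0 < κ) (hR : 0 ≤ R) {p : ℝ × 𝕏} (hp : 0 < p.1)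
    (hpm : gaussParam κ p ∈ Metric.ball (0 : ℝ × 𝕏 × ℝ) (1 / (8 * κ ^ 2) / 2)) {r : ℝ}
    (hr : 0 ≤ r) (hrR : r ≤ R ∨ p.2 = 0) (z : 𝕏) :
    kernelFamily κ R p (r, z) * Real.exp (-(1 / (8 * κ ^ 2)) * ‖z‖ ^ 2)
      = shiftedGaussian (κ ^ 2 * p.1) (r • p.2) z := by
  have hη : 0 < 1 / (8 * κ ^ 2) := by positivity
  rw [kernelFamily, BoundedContinuousFunction.smul_apply,
    (expDecay_gaussian (d := d) hR hη).toBCF_apply (continuous_gaussExponent R)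
      (mem_ball_zero_iff.1 hpm), shiftedGaussian, heatKernel, smul_eq_mul, mul_assoc]
  congr 1
  rw [← Real.exp_add, ← Real.exp_add, gaussExponent_apply]
  congr 1
  have hc : (max 0 (min r R)) • p.2 = r • p.2 := by
    rcases hrR with h | h
    · rw [min_eq_left h, max_eq_right hr]
    · rw [h, smul_zero, smul_zero]
  rw [← hc, norm_add_sq_real, norm_smul, inner_smul_right, mul_pow, Real.norm_eq_abs, sq_abs]
  simp only [gaussParam, inner_smul_right]
  field_simp
  ring

end Construction

end ParabolicSineGordon
namespace ParabolicSineGordon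

/-! ### Existence of a mild solution and its smoothness. -/

section Solution

open scoped BoundedContinuousFunction

variable {d : ℕ}

local notation "𝕏" => EuclideanSpace ℝ (Fin d)

/-- Duhamel's formula, at every point. -/
def DuhamelEq (κ : ℝ) (u₀ : 𝕏 → ℝ) (u : ℝ → 𝕏 → ℝ) : Prop :=
  ∀ t, 0 < t → ∀ x, u t x = heatSemigroup (κ ^ 2 * t) u₀ x
    + ∫ s in (0 : ℝ)..t, heatSemigroup (κ ^ 2 * (t - s)) (fun y => Real.sin (u s y)) x

theorem abs_duhamel_sin_le {κ : ℝ} (hκ : 0 < κ) (u : ℝ → 𝕏 → ℝ) {t : ℝ} (ht : 0 < t) (x : 𝕏) :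
    |∫ s in (0 : ℝ)..t, heatSemigroup (κ ^ 2 * (t - s)) (fun y => Real.sin (u s y)) x| ≤ t := by
  rw [intervalIntegral.integral_of_le ht.le, integral_Ioc_eq_integral_Ioo]
  have h := norm_setIntegral_le_of_norm_le_const (μ := volume) (s := Ioo 0 t) (C := 1)
    (f := fun s => heatSemigroup (κ ^ 2 * (t - s)) (fun y => Real.sin (u s y)) x)
    (by simp) (fun s hs => abs_heatSemigroup_le (mul_pos (by positivity) (by linarith [hs.2]))
      (Eventually.of_forall fun y => Real.abs_sin_le_one _) x)
  simpa [ht.le] using h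

theorem DuhamelEq.abs_le {κ : ℝ} (hκ : 0 < κ) {u₀ : 𝕏 → ℝ} {u : ℝ → 𝕏 → ℝ}
    (hu : DuhamelEq κ u₀ u) {B : ℝ} (hB : ∀ᵐ y, |u₀ y| ≤ B) {t : ℝ} (ht : 0 < t) (x : 𝕏) :
    |u t x| ≤ B + t := by
  rw [hu t ht x]
  exact (abs_add_le _ _).trans (add_le_add (abs_heatSemigroup_le (by positivity) hB x)
    (abs_duhamel_sin_le hκ u ht x))

/-- The value `1 / 4` leaves room for the constant `1 / 2` once the parameters `(l, a)` move away
from `(1, 0)`. -/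
theorem exists_contraction_weight {c K : ℝ} (h : 0 ≤ c * K) : ∃ M : ℝ, 0 < M ∧ M⁻¹ * c * K ≤ 1 / 4 := by
  refine ⟨4 * (c * K) + 1, by positivity, ?_⟩
  rw [mul_assoc, inv_mul_eq_div, div_le_div_iff₀ (by positivity) (by norm_num)]
  linarith

theorem integral_exp_nonneg (η : ℝ) : 0 ≤ ∫ z : 𝕏, Real.exp (-η * ‖z‖ ^ 2) :=
  integral_nonneg fun _ => (Real.exp_pos _).le

theorem movingDuhamel_one_zero (κ : ℝ) (u₀ : 𝕏 → ℝ) (u : ℝ → 𝕏 → ℝ) (t : ℝ) (x : 𝕏) :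
    movingDuhamel (κ ^ 2) 1 0 u₀ u t x = heatSemigroup (κ ^ 2 * t) u₀ x
      + ∫ s in (0 : ℝ)..t, heatSemigroup (κ ^ 2 * (t - s)) (fun y => Real.sin (u s y)) x := by
  simp [movingDuhamel]

theorem exists_duhamelEq {κ : ℝ} (hκ : 0 < κ) {u₀ : 𝕏 → ℝ} {B : ℝ} (hu₀ : Measurable u₀)
    (hB : ∀ y, |u₀ y| ≤ B) : ∃ u : ℝ → 𝕏 → ℝ, DuhamelEq κ u₀ u ∧
      ContinuousOn (fun p : ℝ × 𝕏 => u p.1 p.2) (Ioi (0 : ℝ) ×ˢ univ) := by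
  have hη : 0 < 1 / (8 * κ ^ 2) := by positivity
  obtain ⟨M, hM, hMk⟩ := exists_contraction_weight (mul_nonneg
    (integral_exp_nonneg (d := d) (1 / (8 * κ ^ 2)))
    (norm_nonneg (kernelFamily (d := d) κ 0 (1, 0))))
  -- Without drift the variable `r` plays no role, so the truncation `R = 0` is allowed.
  set k := kernelFamily (d := d) κ 0 (1, 0) with hk
  have hcontr : ContractingWith (1 / 4) (picardMap isClock_exp hη hM hu₀ hB 1 k) := by
    refine ⟨by norm_num, LipschitzWith.of_dist_le_mul fun W₁ W₂ => ?_⟩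
    rw [dist_eq_norm, dist_eq_norm]
    refine (norm_picardMap_sub_le isClock_exp hη hM hu₀ hB 1 k W₁ W₂).trans ?_
    refine mul_le_mul_of_nonneg_right ?_ (norm_nonneg _)
    simpa using hMk
  set W := hcontr.fixedPoint with hW
  have hfix : picardMap isClock_exp hη hM hu₀ hB 1 k W = W := hcontr.fixedPoint_isFixedPt
  -- The fixed point is `e^{-Mt} u(t)` in the variable `log t`; the weight is removed.
  refine ⟨fun t x => Real.exp (M * t) * W (Real.log t, x), ?_, ?_⟩
  · intro t ht x
    have h1 : ∀ θ y, W (θ, y) = Real.exp (-M * Real.exp θ)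
        * (Real.exp (M * Real.exp θ) * W (Real.log (Real.exp θ), y)) := by
      intro θ y
      rw [Real.log_exp, ← mul_assoc, ← Real.exp_add]
      simp
    have h2 := picardMap_apply_eq isClock_exp hη hM hu₀ hB (l := 1) (k := k)
      (U := fun t x => Real.exp (M * t) * W (Real.log t, x)) h1 (μ := κ ^ 2) (by positivity)
      (a := 0) (q := (Real.log t, x)) (by
        intro r hr _ z
        have := kernelFamily_mul_exp (d := d) hκ le_rfl (p := (1, 0)) one_pos
          (by rw [gaussParam_one]; exact Metric.mem_ball_self (by positivity)) hr (Or.inr rfl) z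
        simpa using this)
    simp only [hfix, Real.exp_log ht, movingDuhamel_one_zero] at h2
    rw [← movingDuhamel_one_zero] at h2 ⊢
    change Real.exp (M * t) * W (Real.log t, x) = _
    rw [h2, ← mul_assoc, ← Real.exp_add]
    simp
  · refine ContinuousOn.mul (by fun_prop) (W.continuous.comp_continuousOn ?_)
    exact (continuousOn_fst.log fun p hp => (show (0 : ℝ) < p.1 from hp.1).ne').prodMk
      continuousOn_snd

/-- Rescaled and moved solutions, which satisfy the rescaled and moved Duhamel formula. -/
theorem DuhamelEq.movingDuhamel_eq {κ : ℝ} {u₀ : 𝕏 → ℝ} {u : ℝ → 𝕏 → ℝ}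
    (hu : DuhamelEq κ u₀ u) {l : ℝ} (hl : 0 < l) (a : 𝕏) {t : ℝ} (ht : 0 < t) (x : 𝕏) :
    movingDuhamel (κ ^ 2 * l) l a u₀ (fun t x => u (l * t) (x + t • a)) t x
      = u (l * t) (x + t • a) := by
  rw [hu (l * t) (by positivity), movingDuhamel, mul_assoc]
  congr 1
  have h := intervalIntegral.smul_integral_comp_mul_left (f := fun s =>
    heatSemigroup (κ ^ 2 * (l * t - s)) (fun y => Real.sin (u s y)) (x + t • a))
    (a := 0) (b := t) l
  rw [mul_zero, smul_eq_mul] at h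
  rw [← h]
  congr 1
  refine intervalIntegral.integral_congr fun s _ => ?_
  rw [heatSemigroup_comp_add _ (fun y => Real.sin (u (l * s) y)), mul_assoc, mul_sub,
    add_assoc, ← add_smul, sub_add_cancel]

/-- Weighted rescaled and moved solutions, up to time `T`. -/
noncomputable def movedSolution (M T : ℝ) (u : ℝ → 𝕏 → ℝ) (p : ℝ × 𝕏) : ℝ × 𝕏 →ᵇ ℝ :=
  toBCF fun q => Real.exp (-M * min (Real.exp q.1) T)
    * u (p.1 * min (Real.exp q.1) T) (q.2 + min (Real.exp q.1) T • p.2)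

theorem movedSolution_apply {κ : ℝ} (hκ : 0 < κ) {u₀ : 𝕏 → ℝ} {B : ℝ} (hB : ∀ᵐ y, |u₀ y| ≤ B)
    {u : ℝ → 𝕏 → ℝ} (hu : DuhamelEq κ u₀ u)
    (hc : ContinuousOn (fun p : ℝ × 𝕏 => u p.1 p.2) (Ioi (0 : ℝ) ×ˢ univ)) {M T : ℝ} (hM : 0 < M)
    (hT : 0 < T) {p : ℝ × 𝕏} (hp : 0 < p.1) (q : ℝ × 𝕏) :
    movedSolution M T u p q = Real.exp (-M * min (Real.exp q.1) T)
      * u (p.1 * min (Real.exp q.1) T) (q.2 + min (Real.exp q.1) T • p.2) := by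
  have hm : Continuous fun q : ℝ × 𝕏 => min (Real.exp q.1) T := by fun_prop
  have hpos : ∀ q : ℝ × 𝕏, 0 < min (Real.exp q.1) T := fun q => lt_min (Real.exp_pos _) hT
  refine toBCF_apply (C := B + p.1 * T) ?_ (fun q => ?_) q
  · refine Continuous.mul (by fun_prop) ?_
    exact hc.comp_continuous (f := fun q : ℝ × 𝕏 =>
      (p.1 * min (Real.exp q.1) T, q.2 + min (Real.exp q.1) T • p.2)) (by fun_prop)
      (fun q => ⟨mul_pos hp (hpos q), mem_univ _⟩)
  · rw [abs_mul, Real.abs_exp]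
    have h1 := hu.abs_le hκ hB (mul_pos hp (hpos q)) (q.2 + min (Real.exp q.1) T • p.2)
    have h2 : Real.exp (-M * min (Real.exp q.1) T) ≤ 1 := by
      rw [Real.exp_le_one_iff, neg_mul, neg_nonpos]
      exact mul_nonneg hM.le (hpos q).le
    refine (mul_le_of_le_one_left (abs_nonneg _) h2).trans (h1.trans ?_)
    have := mul_le_mul_of_nonneg_left (min_le_right (Real.exp q.1) T) hp.le
    linarith

/-- With bounded time both weights are themselves bounded continuous functions, so the map is
`sinBCF` between two multiplications. -/
theorem contDiff_weightedSin {M T : ℝ} (hM : 0 < M) (hT : 0 < T) :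
    ContDiff ℝ ∞ (weightedSin (d := d) (fun θ => min (Real.exp θ) T) M) := by
  have hm : Continuous fun q : ℝ × 𝕏 => min (Real.exp q.1) T := by fun_prop
  have hpos : ∀ q : ℝ × 𝕏, 0 < min (Real.exp q.1) T := fun q => lt_min (Real.exp_pos _) hT
  have hn : ∀ q : ℝ × 𝕏, toBCF (fun q : ℝ × 𝕏 => Real.exp (-M * min (Real.exp q.1) T)) q
      = Real.exp (-M * min (Real.exp q.1) T) := by
    refine toBCF_apply (C := 1) (by fun_prop) fun q => ?_
    rw [Real.abs_exp, Real.exp_le_one_iff, neg_mul, neg_nonpos]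
    exact mul_nonneg hM.le (hpos q).le
  have hp : ∀ q : ℝ × 𝕏, toBCF (fun q : ℝ × 𝕏 => Real.exp (M * min (Real.exp q.1) T)) q
      = Real.exp (M * min (Real.exp q.1) T) := by
    refine toBCF_apply (C := Real.exp (M * T)) (by fun_prop) fun q => ?_
    rw [Real.abs_exp, Real.exp_le_exp]
    exact mul_le_mul_of_nonneg_left (min_le_right _ _) hM.le
  have e : weightedSin (d := d) (fun θ => min (Real.exp θ) T) M = fun W =>
      toBCF (fun q : ℝ × 𝕏 => Real.exp (-M * min (Real.exp q.1) T))
        * sinBCF (toBCF (fun q : ℝ × 𝕏 => Real.exp (M * min (Real.exp q.1) T)) * W) := by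
    funext W
    ext q
    rw [weightedSin_apply (isClock_min hT) hM, BoundedContinuousFunction.mul_apply, sinBCF_apply,
      BoundedContinuousFunction.mul_apply, hn, hp]
  rw [e]
  exact contDiff_const.mul (contDiff_sinBCF.comp (contDiff_const.mul contDiff_id))

theorem isInvertible_id_sub {E : Type*} [NormedAddCommGroup E] [NormedSpace ℝ E] [CompleteSpace E]
    {L : E →L[ℝ] E} (hL : ‖L‖ < 1) : (ContinuousLinearMap.id ℝ E - L).IsInvertible := by
  have h1 := (Units.oneSub L hL).mul_inv
  have h2 := (Units.oneSub L hL).inv_mul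
  exact ContinuousLinearMap.IsInvertible.of_inverse h1 h2

/-- A fixed point of a uniform contraction which depends smoothly on a parameter is a smooth
function of the parameter. -/
theorem contDiffAt_fixedPoint {P E : Type*} [NormedAddCommGroup P] [NormedSpace ℝ P]
    [CompleteSpace P] [NormedAddCommGroup E] [NormedSpace ℝ E] [CompleteSpace E]
    {Φ : P → E → E} {p₀ : P} {W : P → E}
    (hΦ : ContDiffAt ℝ ∞ (fun z : P × E => Φ z.1 z.2) (p₀, W p₀))
    (hLip : ∀ᶠ p in 𝓝 p₀, ∀ w₁ w₂, ‖Φ p w₁ - Φ p w₂‖ ≤ 1 / 2 * ‖w₁ - w₂‖)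
    (hfix : ∀ᶠ p in 𝓝 p₀, Φ p (W p) = W p) : ContDiffAt ℝ ∞ W p₀ := by
  -- The implicit function theorem is applied to `w - Φ(p, w) = 0`. The partial derivative in `w` is
  -- the identity minus an operator of norm at most `1 / 2`, invertible by a Neumann series.
  set F : P × E → E := fun z => z.2 - Φ z.1 z.2 with hF
  have hFc : ContDiffAt ℝ ∞ F (p₀, W p₀) := contDiffAt_snd.sub hΦ
  have hne : (∞ : WithTop ℕ∞) ≠ 0 := by simp
  have hder : fderiv ℝ F (p₀, W p₀) ∘L ContinuousLinearMap.inr ℝ P E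
      = ContinuousLinearMap.id ℝ E - fderiv ℝ (Φ p₀) (W p₀) := by
    have h1 : HasFDerivAt (fun w : E => (p₀, w)) (ContinuousLinearMap.inr ℝ P E) (W p₀) :=
      hasFDerivAt_prodMk_right p₀ (W p₀)
    have h2 : HasFDerivAt (fun w => F (p₀, w)) (fderiv ℝ F (p₀, W p₀) ∘L
        ContinuousLinearMap.inr ℝ P E) (W p₀) :=
      (hFc.differentiableAt hne).hasFDerivAt.comp (W p₀) h1
    have h3 : DifferentiableAt ℝ (Φ p₀) (W p₀) :=
      (hΦ.differentiableAt hne).comp (W p₀) h1.differentiableAt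
    exact h2.unique ((hasFDerivAt_id (W p₀)).sub h3.hasFDerivAt)
  have hnorm : ‖fderiv ℝ (Φ p₀) (W p₀)‖ ≤ 1 / 2 := by
    have h1 : LipschitzWith (1 / 2) (Φ p₀) := LipschitzWith.of_dist_le_mul fun w₁ w₂ => by
      rw [dist_eq_norm, dist_eq_norm]
      simpa using hLip.self_of_nhds w₁ w₂
    simpa using norm_fderiv_le_of_lipschitz ℝ h1 (x₀ := W p₀)
  have hinv : (fderiv ℝ F (p₀, W p₀) ∘L ContinuousLinearMap.inr ℝ P E).IsInvertible := by
    rw [hder]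
    exact isInvertible_id_sub (hnorm.trans_lt (by norm_num))
  -- The implicit function and `W` are both fixed points of the contraction `Φ p`, hence equal; no
  -- continuity of `W` is needed beforehand.
  refine (hFc.contDiffAt_implicitFunction hne hinv).congr_of_eventuallyEq ?_
  filter_upwards [hFc.eventually_apply_implicitFunction hne hinv, hLip, hfix] with p h1 h2 h3
  have h0 : F (p₀, W p₀) = 0 := by simp [hF, hfix.self_of_nhds]
  have h5 : hFc.implicitFunction hne hinv p - Φ p (hFc.implicitFunction hne hinv p) = 0 :=
    h1.trans h0
  rw [sub_eq_zero] at h5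
  have h4 := h2 (W p) (hFc.implicitFunction hne hinv p)
  rw [h3, ← h5] at h4
  have h6 : ‖W p - hFc.implicitFunction hne hinv p‖ = 0 := by
    linarith [norm_nonneg (W p - hFc.implicitFunction hne hinv p)]
  rwa [norm_eq_zero, sub_eq_zero] at h6

/-- Space-time regularity is read off from regularity in the parameters: `u(l t, x + t a)` is the
fixed point of a contraction that is smooth in `(l, a)`, although the datum is rough. -/
theorem DuhamelEq.contDiffAt {κ : ℝ} (hκ : 0 < κ) {u₀ : 𝕏 → ℝ} {B : ℝ} (hu₀ : Measurable u₀)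
    (hB : ∀ y, |u₀ y| ≤ B) {u : ℝ → 𝕏 → ℝ} (hu : DuhamelEq κ u₀ u)
    (hc : ContinuousOn (fun p : ℝ × 𝕏 => u p.1 p.2) (Ioi (0 : ℝ) ×ˢ univ))
    {T : ℝ} (hT : 0 < T) (x₀ : 𝕏) : ContDiffAt ℝ ∞ (fun p : ℝ × 𝕏 => u p.1 p.2) (T, x₀) := by
  have hη : 0 < 1 / (8 * κ ^ 2) := by positivity
  have hR : 0 ≤ √T := Real.sqrt_nonneg _
  obtain ⟨M, hM, hMk⟩ := exists_contraction_weight (mul_nonneg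
    (integral_exp_nonneg (d := d) (1 / (8 * κ ^ 2)))
    (norm_nonneg (kernelFamily (d := d) κ √T (1, 0))))
  have hτ := isClock_min hT
  have hkc := contDiffAt_kernelFamily (d := d) hκ hR
  have hpos : ∀ᶠ p in 𝓝 ((1, 0) : ℝ × 𝕏), 0 < p.1 :=
    continuousAt_const.eventually_lt continuousAt_fst (by simp)
  have hW : ContDiffAt ℝ ∞ (movedSolution M T u) ((1, 0) : ℝ × 𝕏) := by
    refine contDiffAt_fixedPoint (Φ := fun p W =>
      picardMap hτ hη hM hu₀ hB p.1 (kernelFamily κ √T p) W) ?_ ?_ ?_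
    · unfold picardMap
      have h1 : ContDiffAt ℝ ∞ (fun z : (ℝ × 𝕏) × (ℝ × 𝕏 →ᵇ ℝ) => kernelFamily κ √T z.1)
          ((1, 0), movedSolution M T u (1, 0)) :=
        ContDiffAt.comp (g := kernelFamily κ √T) (f := Prod.fst) _ hkc contDiffAt_fst
      have h2 : ContDiffAt ℝ ∞ (fun z : (ℝ × 𝕏) × (ℝ × 𝕏 →ᵇ ℝ) =>
          weightedSin (d := d) (fun θ => min (Real.exp θ) T) M z.2)
          ((1, 0), movedSolution M T u (1, 0)) :=
        (contDiff_weightedSin hM hT).contDiffAt.comp _ contDiffAt_snd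
      have h3 : ContDiffAt ℝ ∞ (fun z : (ℝ × 𝕏) × (ℝ × 𝕏 →ᵇ ℝ) => z.1.1)
          ((1, 0), movedSolution M T u (1, 0)) := contDiffAt_fst.comp _ contDiffAt_fst
      have h4 : ContDiffAt ℝ ∞ (fun z : (ℝ × 𝕏) × (ℝ × 𝕏 →ᵇ ℝ) => duhamelOp hτ hη hM
          (kernelFamily κ √T z.1) (weightedSin (fun θ => min (Real.exp θ) T) M z.2))
          ((1, 0), movedSolution M T u (1, 0)) :=
        (duhamelOp (d := d) hτ hη hM).isBoundedBilinearMap.contDiff.contDiffAt.comp _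
          (h1.prodMk h2)
      exact ((freeOp hτ hη hM hu₀ hB).contDiff.contDiffAt.comp _ h1).add (h3.smul h4)
    · have h1 : ContinuousAt (fun p : ℝ × 𝕏 => |p.1| * ((M⁻¹ * ∫ z : 𝕏,
          Real.exp (-(1 / (8 * κ ^ 2)) * ‖z‖ ^ 2)) * ‖kernelFamily κ √T p‖)) (1, 0) :=
        continuousAt_fst.abs.mul (continuousAt_const.mul hkc.continuousAt.norm)
      have h2 := h1.eventually_lt (continuousAt_const (y := (1 / 2 : ℝ)))
        (by simp only [abs_one, one_mul]; linarith)
      filter_upwards [h2] with p hp w₁ w₂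
      refine (norm_picardMap_sub_le hτ hη hM hu₀ hB _ _ w₁ w₂).trans ?_
      gcongr
    · filter_upwards [hpos, gaussParam_mem hκ] with p hp hpm
      ext q
      have h1 := movedSolution_apply hκ (Eventually.of_forall hB) hu hc hM hT hp
      rw [picardMap_apply_eq hτ hη hM hu₀ hB
        (U := fun t x => u (p.1 * t) (x + t • p.2)) (fun θ y => h1 (θ, y))
        (μ := κ ^ 2 * p.1) (by positivity) (a := p.2) (q := q) (by
          intro r hr hr' z
          refine kernelFamily_mul_exp hκ hR hp hpm hr (Or.inl ?_) z
          exact hr'.trans (Real.sqrt_le_sqrt (min_le_right _ _))),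
        hu.movingDuhamel_eq hp p.2 (hτ.pos q.1), h1]
  -- The parameters `l = t / T`, `a = (x - x₀) / T` satisfy `(l T, x₀ + T a) = (t, x)`, so
  -- evaluation at the one point `(log T, x₀)` yields `u(t, x)`.
  have hev : ContDiffAt ℝ ∞ (fun p : ℝ × 𝕏 => Real.exp (M * T)
      * movedSolution M T u (T⁻¹ * p.1, T⁻¹ • (p.2 - x₀)) (Real.log T, x₀)) (T, x₀) := by
    refine contDiffAt_const.mul ?_
    have h1 : ContDiffAt ℝ ∞ (fun p : ℝ × 𝕏 => (T⁻¹ * p.1, T⁻¹ • (p.2 - x₀))) (T, x₀) := by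
      fun_prop
    have h2 : ContDiffAt ℝ ∞ (movedSolution M T u)
        ((fun p : ℝ × 𝕏 => (T⁻¹ * p.1, T⁻¹ • (p.2 - x₀))) (T, x₀)) := by
      simpa [hT.ne'] using hW
    exact (BoundedContinuousFunction.evalCLM ℝ (Real.log T, x₀)).contDiff.contDiffAt.comp _
      (ContDiffAt.comp (g := movedSolution M T u)
        (f := fun p : ℝ × 𝕏 => (T⁻¹ * p.1, T⁻¹ • (p.2 - x₀))) _ h2 h1)
  refine hev.congr_of_eventuallyEq ?_
  have hp0 : ∀ᶠ p in 𝓝 ((T, x₀) : ℝ × 𝕏), 0 < p.1 :=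
    continuousAt_const.eventually_lt continuousAt_fst (by simpa using hT)
  filter_upwards [hp0] with p hp
  rw [movedSolution_apply hκ (Eventually.of_forall hB) hu hc hM hT (mul_pos (inv_pos.2 hT) hp)]
  simp only [Real.exp_log hT, min_self]
  rw [← mul_assoc, ← Real.exp_add, smul_smul, mul_inv_cancel₀ hT.ne', one_smul,
    add_sub_cancel, mul_comm T⁻¹, mul_assoc, inv_mul_cancel₀ hT.ne', mul_one]
  simp

end Solution

end ParabolicSineGordon
namespace ParabolicSineGordon

/-! ### Gaussian bounds and Green's formula for the heat kernel. -/

section Duhamel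

variable {d : ℕ}

local notation "𝕏" => EuclideanSpace ℝ (Fin d)

theorem aestronglyMeasurable_heatSemigroup {I : Set ℝ} {g : ℝ → 𝕏 → ℝ} {φ : ℝ → ℝ}
    (hφ : Measurable φ) (hg : AEStronglyMeasurable (fun p : ℝ × 𝕏 => g p.1 p.2)
      ((volume.restrict I).prod volume)) (x : 𝕏) :
    AEStronglyMeasurable (fun s => heatSemigroup (φ s) (g s) x) (volume.restrict I) := by
  have h : AEStronglyMeasurable (fun p : ℝ × 𝕏 => heatKernel (φ p.1) (x - p.2) * g p.1 p.2)
      ((volume.restrict I).prod volume) := by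
    refine AEStronglyMeasurable.mul (Measurable.aestronglyMeasurable ?_) hg
    exact measurable_heatKernel.comp ((hφ.comp measurable_fst).prodMk
      (measurable_const.sub measurable_snd))
  exact h.integral_prod_right'

theorem integrableOn_heatSemigroup {κ a b C : ℝ} (hκ : 0 < κ) {g : ℝ → 𝕏 → ℝ}
    (hg : AEStronglyMeasurable (fun p : ℝ × 𝕏 => g p.1 p.2)
      ((volume.restrict (Ioo a b)).prod volume))
    (hC : ∀ s ∈ Ioo a b, ∀ᵐ y, |g s y| ≤ C) (x : 𝕏) :
    IntegrableOn (fun s => heatSemigroup (κ ^ 2 * (b - s)) (g s) x) (Ioo a b) := by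
  refine Integrable.mono' (g := fun _ => C) (by simp)
    (aestronglyMeasurable_heatSemigroup (by fun_prop) hg x) ?_
  filter_upwards [ae_restrict_mem measurableSet_Ioo] with s hs
  exact abs_heatSemigroup_le (mul_pos (by positivity) (by linarith [hs.2])) (hC s hs) x

theorem hasDerivAt_heatKernel {τ : ℝ} (hτ : 0 < τ) (z : 𝕏) :
    HasDerivAt (fun τ => heatKernel τ z)
      ((‖z‖ ^ 2 / (4 * τ ^ 2) - d / (2 * τ)) * heatKernel τ z) τ := by
  have h1 : HasDerivAt (fun τ : ℝ => (4 * Real.pi * τ) ^ (-((d : ℝ) / 2)))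
      (4 * Real.pi * (-((d : ℝ) / 2)) * (4 * Real.pi * τ) ^ (-((d : ℝ) / 2) - 1)) τ := by
    have h := ((hasDerivAt_id τ).const_mul (4 * Real.pi)).rpow_const (p := -((d : ℝ) / 2))
      (Or.inl (by simp only [id]; positivity))
    simpa using h
  have h2 : HasDerivAt (fun τ : ℝ => Real.exp (-(‖z‖ ^ 2 / (4 * τ))))
      (Real.exp (-(‖z‖ ^ 2 / (4 * τ))) * (‖z‖ ^ 2 / (4 * τ ^ 2))) τ := by
    refine HasDerivAt.exp ?_
    have h := ((hasDerivAt_inv hτ.ne').const_mul (‖z‖ ^ 2 / 4)).neg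
    convert! h using 1
    · funext τ
      simp only [Pi.neg_apply]
      ring
    · field_simp
  convert! h1.mul h2 using 1
  rw [Real.rpow_sub_one (by positivity), heatKernel]
  field_simp
  ring

theorem heatKernel_le {τ τ₁ τ₂ : ℝ} (h1 : 0 < τ₁) (h : τ₁ ≤ τ) (h2 : τ ≤ τ₂) (z : 𝕏) :
    heatKernel τ z ≤ (4 * Real.pi * τ₁) ^ (-((d : ℝ) / 2))
      * Real.exp (-(1 / (4 * τ₂)) * ‖z‖ ^ 2) := by
  have h0 : 0 < τ := h1.trans_le h
  rw [heatKernel_eq]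
  gcongr ?_ * ?_
  · refine Real.rpow_le_rpow_of_nonpos (by positivity) (by gcongr) ?_
    rw [neg_nonpos]; positivity
  · rw [Real.exp_le_exp, neg_mul, neg_mul, neg_le_neg_iff]
    gcongr

theorem norm_sq_mul_exp_le {b : ℝ} (hb : 0 < b) (z : 𝕏) :
    ‖z‖ ^ 2 * Real.exp (-b * ‖z‖ ^ 2) ≤ 2 / b * Real.exp (-(b / 2) * ‖z‖ ^ 2) := by
  have h1 : ‖z‖ ^ 2 ≤ 2 / b * Real.exp (b / 2 * ‖z‖ ^ 2) := by
    have := Real.add_one_le_exp (b / 2 * ‖z‖ ^ 2)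
    calc ‖z‖ ^ 2 = 2 / b * (b / 2 * ‖z‖ ^ 2) := by field_simp
      _ ≤ _ := by gcongr; linarith
  calc _ ≤ 2 / b * Real.exp (b / 2 * ‖z‖ ^ 2) * Real.exp (-b * ‖z‖ ^ 2) := by gcongr
    _ = _ := by
      rw [mul_assoc, ← Real.exp_add]
      ring_nf

/-- One Gaussian dominates all kernels with `τ` in a compact interval, together with the factor `1 +
‖z‖²` that derivatives of the kernel produce. It serves as majorant under integral signs. -/
theorem exists_gaussian_bound {τ₁ τ₂ : ℝ} (h1 : 0 < τ₁) (h12 : τ₁ ≤ τ₂) :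
    ∃ A β : ℝ, 0 < A ∧ 0 < β ∧ ∀ τ, τ₁ ≤ τ → τ ≤ τ₂ → ∀ z : 𝕏,
      (1 + ‖z‖ ^ 2) * heatKernel τ z ≤ A * Real.exp (-β * ‖z‖ ^ 2) := by
  have h2 : 0 < τ₂ := h1.trans_le h12
  set b := 1 / (4 * τ₂) with hb
  have hb0 : 0 < b := by positivity
  set c := (4 * Real.pi * τ₁) ^ (-((d : ℝ) / 2)) with hc
  have hc0 : 0 < c := by positivity
  refine ⟨c * (1 + 2 / b), b / 2, by positivity, by positivity, fun τ h h' z => ?_⟩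
  have e1 : Real.exp (-b * ‖z‖ ^ 2) ≤ Real.exp (-(b / 2) * ‖z‖ ^ 2) := by
    rw [Real.exp_le_exp]
    nlinarith [sq_nonneg ‖z‖, mul_nonneg hb0.le (sq_nonneg ‖z‖)]
  calc (1 + ‖z‖ ^ 2) * heatKernel τ z ≤ (1 + ‖z‖ ^ 2) * (c * Real.exp (-b * ‖z‖ ^ 2)) := by
        gcongr
        exact heatKernel_le h1 h h' z
    _ = c * (Real.exp (-b * ‖z‖ ^ 2) + ‖z‖ ^ 2 * Real.exp (-b * ‖z‖ ^ 2)) := by ring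
    _ ≤ c * (Real.exp (-(b / 2) * ‖z‖ ^ 2) + 2 / b * Real.exp (-(b / 2) * ‖z‖ ^ 2)) := by
        refine mul_le_mul_of_nonneg_left (add_le_add e1 (norm_sq_mul_exp_le hb0 z)) hc0.le
    _ = _ := by ring

theorem integrable_mul_of_gaussian_le {f h : 𝕏 → ℝ} {A β C : ℝ} (hβ : 0 < β) {x : 𝕏}
    (hf : Continuous f) (hh : Continuous h)
    (hfA : ∀ y, |f y| ≤ A * Real.exp (-β * ‖x - y‖ ^ 2)) (hC : ∀ y, |h y| ≤ C) :
    Integrable fun y => f y * h y := by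
  refine (((integrable_gaussian hβ).comp_sub_left x).const_mul (A * C)).mono'
    (hf.mul hh).aestronglyMeasurable (Eventually.of_forall fun y => ?_)
  rw [norm_mul, Real.norm_eq_abs, Real.norm_eq_abs]
  calc _ ≤ A * Real.exp (-β * ‖x - y‖ ^ 2) * C :=
        mul_le_mul (hfA y) (hC y) (abs_nonneg _) ((abs_nonneg _).trans (hfA y))
    _ = _ := by ring

theorem hasFDerivAt_heatKernel_sub {τ : ℝ} (x y : 𝕏) :
    HasFDerivAt (fun y => heatKernel τ (x - y))
      ((1 / (2 * τ) * heatKernel τ (x - y)) • innerSL ℝ (x - y)) y := by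
  have h1 : HasFDerivAt (fun y : 𝕏 => ‖x - y‖ ^ 2) (-(2 • innerSL ℝ (x - y))) y := by
    have h := ((hasFDerivAt_const x y).sub (hasFDerivAt_id y)).norm_sq
    convert! h using 1
    ext w
    simp
    ring
  have h2 := ((h1.const_mul (-(1 / (4 * τ)))).exp).const_mul
    ((4 * Real.pi * τ) ^ (-((d : ℝ) / 2)))
  have e : (fun y : 𝕏 => heatKernel τ (x - y)) = fun y => (4 * Real.pi * τ) ^ (-((d : ℝ) / 2))
      * Real.exp (-(1 / (4 * τ)) * ‖x - y‖ ^ 2) := by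
    funext y
    rw [heatKernel_eq]
  rw [e]
  convert! h2 using 1
  ext w
  simp [heatKernel_eq]
  ring

theorem fderiv_heatKernel_sub {τ : ℝ} (x y e : 𝕏) :
    fderiv ℝ (fun y => heatKernel τ (x - y)) y e
      = inner ℝ (x - y) e / (2 * τ) * heatKernel τ (x - y) := by
  rw [(hasFDerivAt_heatKernel_sub x y).fderiv]
  simp only [smul_apply, innerSL_apply_apply, smul_eq_mul]
  ring

theorem hasFDerivAt_inner_mul_heatKernel {τ : ℝ} (x y e : 𝕏) :
    HasFDerivAt (fun y => inner ℝ (x - y) e / (2 * τ) * heatKernel τ (x - y))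
      ((inner ℝ (x - y) e / (2 * τ)) • ((1 / (2 * τ) * heatKernel τ (x - y)) • innerSL ℝ (x - y))
        + heatKernel τ (x - y) • ((-(1 / (2 * τ))) • innerSL ℝ e)) y := by
  refine HasFDerivAt.mul (𝔸' := ℝ) ?_ (hasFDerivAt_heatKernel_sub x y)
  have h := ((innerSL ℝ e).hasFDerivAt (x := y)).const_mul (-(1 / (2 * τ)))
  have h' := h.add_const (inner ℝ x e / (2 * τ))
  convert! h' using 1
  funext y
  rw [innerSL_apply_apply, inner_sub_left, real_inner_comm y e]
  ring

/-- Green's formula for the heat kernel, in one direction. -/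
theorem integral_heatKernel_mul_fderiv_fderiv {τ : ℝ} (hτ : 0 < τ) {h : 𝕏 → ℝ} {C : ℝ}
    (hh : ContDiff ℝ 2 h) (hC : ∀ k ≤ 2, ∀ x, ‖iteratedFDeriv ℝ k h x‖ ≤ C) (x : 𝕏) {e : 𝕏}
    (he : ‖e‖ = 1) :
    Integrable (fun y => heatKernel τ (x - y) * iteratedFDeriv ℝ 2 h y ![e, e]) ∧
    Integrable (fun y => ((inner ℝ (x - y) e) ^ 2 / (4 * τ ^ 2) - 1 / (2 * τ))
      * heatKernel τ (x - y) * h y) ∧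
    ∫ y, heatKernel τ (x - y) * iteratedFDeriv ℝ 2 h y ![e, e]
      = ∫ y, ((inner ℝ (x - y) e) ^ 2 / (4 * τ ^ 2) - 1 / (2 * τ))
        * heatKernel τ (x - y) * h y := by
  obtain ⟨A, β, hA, hβ, hAβ⟩ := exists_gaussian_bound (d := d) hτ le_rfl
  replace hAβ := hAβ τ le_rfl le_rfl
  have hk0 : ∀ z : 𝕏, 0 < heatKernel τ z := heatKernel_pos hτ
  have hkc : Continuous fun y : 𝕏 => heatKernel τ (x - y) :=
    (continuous_heatKernel τ).comp (by fun_prop)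
  have hin : ∀ y : 𝕏, |inner ℝ (x - y) e| ≤ ‖x - y‖ := fun y => by
    simpa [he] using abs_real_inner_le_norm (x - y) e
  have hin2 : ∀ y : 𝕏, (inner ℝ (x - y) e) ^ 2 ≤ ‖x - y‖ ^ 2 := fun y => by
    rw [← sq_abs]; exact pow_le_pow_left₀ (abs_nonneg _) (hin y) 2
  -- The first and second derivatives of `y ↦ heatKernel τ (x - y)` along `e`. Two integrations by
  -- parts move both derivatives from `h` onto the kernel, and their signs cancel.
  set k₁ : 𝕏 → ℝ := fun y => inner ℝ (x - y) e / (2 * τ) * heatKernel τ (x - y) with hk₁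
  set k₂ : 𝕏 → ℝ := fun y => ((inner ℝ (x - y) e) ^ 2 / (4 * τ ^ 2) - 1 / (2 * τ))
    * heatKernel τ (x - y) with hk₂
  have hic : Continuous fun y : 𝕏 => inner ℝ (x - y) e := by fun_prop
  have hk₁c : Continuous k₁ := (hic.div_const _).mul hkc
  have hk₂c : Continuous k₂ := (((hic.pow 2).div_const _).sub continuous_const).mul hkc
  have b0 : ∀ y, |heatKernel τ (x - y)| ≤ A * Real.exp (-β * ‖x - y‖ ^ 2) := fun y => by
    rw [abs_of_pos (hk0 _)]
    refine le_trans ?_ (hAβ (x - y))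
    exact le_mul_of_one_le_left (hk0 _).le (by nlinarith [sq_nonneg ‖x - y‖])
  have b1 : ∀ y, |k₁ y| ≤ (1 / (2 * τ) * A) * Real.exp (-β * ‖x - y‖ ^ 2) := fun y => by
    rw [hk₁, abs_mul, abs_div, abs_of_pos (hk0 _), abs_of_pos (by positivity : 0 < 2 * τ)]
    calc _ ≤ (1 + ‖x - y‖ ^ 2) / (2 * τ) * heatKernel τ (x - y) := by
          have := hk0 (x - y)
          gcongr
          nlinarith [hin y, sq_nonneg (‖x - y‖ - 1)]
      _ = 1 / (2 * τ) * ((1 + ‖x - y‖ ^ 2) * heatKernel τ (x - y)) := by ring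
      _ ≤ 1 / (2 * τ) * (A * Real.exp (-β * ‖x - y‖ ^ 2)) :=
          mul_le_mul_of_nonneg_left (hAβ _) (by positivity)
      _ = _ := by ring
  have b2 : ∀ y, |k₂ y| ≤ ((1 / (4 * τ ^ 2) + 1 / (2 * τ)) * A)
      * Real.exp (-β * ‖x - y‖ ^ 2) := fun y => by
    rw [hk₂, abs_mul, abs_of_pos (hk0 _)]
    have h3 : |inner ℝ (x - y) e ^ 2 / (4 * τ ^ 2) - 1 / (2 * τ)|
        ≤ (1 / (4 * τ ^ 2) + 1 / (2 * τ)) * (1 + ‖x - y‖ ^ 2) := by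
      refine (abs_sub _ _).trans ?_
      rw [abs_of_nonneg (by positivity), abs_of_nonneg (by positivity)]
      have h4 : inner ℝ (x - y) e ^ 2 / (4 * τ ^ 2) ≤ 1 / (4 * τ ^ 2) * ‖x - y‖ ^ 2 := by
        rw [div_eq_mul_one_div, mul_comm]
        exact mul_le_mul_of_nonneg_left (hin2 y) (by positivity)
      have h5 : 0 ≤ 1 / (2 * τ) * ‖x - y‖ ^ 2 := by positivity
      have h6 : 0 ≤ 1 / (4 * τ ^ 2) := by positivity
      linarith
    calc _ ≤ (1 / (4 * τ ^ 2) + 1 / (2 * τ)) * (1 + ‖x - y‖ ^ 2) * heatKernel τ (x - y) :=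
          mul_le_mul_of_nonneg_right h3 (hk0 _).le
      _ = (1 / (4 * τ ^ 2) + 1 / (2 * τ)) * ((1 + ‖x - y‖ ^ 2) * heatKernel τ (x - y)) := by ring
      _ ≤ (1 / (4 * τ ^ 2) + 1 / (2 * τ)) * (A * Real.exp (-β * ‖x - y‖ ^ 2)) :=
          mul_le_mul_of_nonneg_left (hAβ _) (by positivity)
      _ = _ := by ring
  have hh0 : ∀ y, |h y| ≤ C := fun y => by simpa using hC 0 (by norm_num) y
  have hh1 : ∀ y, |fderiv ℝ h y e| ≤ C := fun y => by
    have := (fderiv ℝ h y).le_opNorm e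
    rw [he, mul_one] at this
    refine this.trans ?_
    simpa [norm_iteratedFDeriv_one] using hC 1 (by norm_num) y
  have hd2 : ∀ y, fderiv ℝ (fun y => fderiv ℝ h y e) y e = iteratedFDeriv ℝ 2 h y ![e, e] := by
    intro y
    rw [iteratedFDeriv_two_apply]
    have hdd : DifferentiableAt ℝ (fderiv ℝ h) y :=
      ((hh.fderiv_right (m := 1) (by norm_num)).differentiable (by norm_num)) y
    have := (hdd.hasFDerivAt.clm_apply (hasFDerivAt_const e y)).fderiv
    rw [this]
    simp
  have hh2 : ∀ y, |iteratedFDeriv ℝ 2 h y ![e, e]| ≤ C := fun y => by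
    have := (iteratedFDeriv ℝ 2 h y).le_opNorm ![e, e]
    simp only [Fin.prod_univ_two, Matrix.cons_val_zero, Matrix.cons_val_one, he, mul_one] at this
    exact this.trans (hC 2 le_rfl y)
  have hc1 : Continuous fun y => fderiv ℝ h y e :=
    (hh.continuous_fderiv (by norm_num)).clm_apply continuous_const
  have hc2 : Continuous fun y => iteratedFDeriv ℝ 2 h y ![e, e] :=
    (ContinuousMultilinearMap.apply ℝ (fun _ : Fin 2 => 𝕏) ℝ ![e, e]).continuous.comp
      (hh.continuous_iteratedFDeriv (by norm_num))
  have i02 := integrable_mul_of_gaussian_le hβ hkc hc2 b0 hh2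
  have i01 := integrable_mul_of_gaussian_le hβ hkc hc1 b0 hh1
  have i11 := integrable_mul_of_gaussian_le hβ hk₁c hc1 b1 hh1
  have i10 := integrable_mul_of_gaussian_le hβ hk₁c hh.continuous b1 hh0
  have i20 := integrable_mul_of_gaussian_le hβ hk₂c hh.continuous b2 hh0
  refine ⟨i02, i20, ?_⟩
  have f1 : ∀ y, fderiv ℝ (fun y => heatKernel τ (x - y)) y e = k₁ y := fun y =>
    fderiv_heatKernel_sub x y e
  have f2 : ∀ y, fderiv ℝ k₁ y e = k₂ y := fun y => by
    rw [hk₁, (hasFDerivAt_inner_mul_heatKernel x y e).fderiv, hk₂]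
    simp only [add_apply, smul_apply, smul_eq_mul,
      innerSL_apply_apply, real_inner_self_eq_norm_sq, he]
    field_simp
    ring
  have s1 := integral_mul_fderiv_eq_neg_fderiv_mul_of_integrable (μ := (volume : Measure 𝕏))
    (f := fun y => heatKernel τ (x - y)) (g := fun y => fderiv ℝ h y e) (v := e)
    (by simpa only [f1] using i11) (by simpa only [hd2] using i02) i01
    (fun y _ => (hasFDerivAt_heatKernel_sub x y).differentiableAt)
    (fun y _ => (((hh.fderiv_right (m := 1) (by norm_num)).clm_apply
      contDiff_const).differentiable (by norm_num)) y)
  have s2 := integral_mul_fderiv_eq_neg_fderiv_mul_of_integrable (μ := (volume : Measure 𝕏))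
    (f := k₁) (g := h) (v := e)
    (by simpa only [f2] using i20) i11 i10
    (fun y _ => (hasFDerivAt_inner_mul_heatKernel x y e).differentiableAt)
    (fun y _ => (hh.differentiable (by norm_num)) y)
  simp only [f1, hd2] at s1
  simp only [f2] at s2
  rw [s1, s2, neg_neg]

/-- Green's formula for the heat kernel. -/
theorem integral_heatKernel_mul_laplacian {τ : ℝ} (hτ : 0 < τ) {h : 𝕏 → ℝ} {C : ℝ}
    (hh : ContDiff ℝ 2 h) (hC : ∀ k ≤ 2, ∀ x, ‖iteratedFDeriv ℝ k h x‖ ≤ C) (x : 𝕏) :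
    Integrable (fun y => heatKernel τ (x - y) * Laplacian.laplacian h y) ∧
    Integrable (fun y => (‖x - y‖ ^ 2 / (4 * τ ^ 2) - d / (2 * τ)) * heatKernel τ (x - y) * h y) ∧
    ∫ y, heatKernel τ (x - y) * Laplacian.laplacian h y
      = ∫ y, (‖x - y‖ ^ 2 / (4 * τ ^ 2) - d / (2 * τ)) * heatKernel τ (x - y) * h y := by
  set e := EuclideanSpace.basisFun (Fin d) ℝ with he
  have hG := fun i => integral_heatKernel_mul_fderiv_fderiv hτ hh hC x (e := e i) (by simp)
  have e1 : ∀ y, heatKernel τ (x - y) * Laplacian.laplacian h y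
      = ∑ i, heatKernel τ (x - y) * iteratedFDeriv ℝ 2 h y ![e i, e i] := fun y => by
    rw [InnerProductSpace.laplacian_eq_iteratedFDeriv_orthonormalBasis h e, Finset.mul_sum]
  -- By Parseval the directional factors add up to the factor found in `hasDerivAt_heatKernel`: this
  -- is the heat equation for the kernel.
  have e2 : ∀ y, (‖x - y‖ ^ 2 / (4 * τ ^ 2) - d / (2 * τ)) * heatKernel τ (x - y) * h y
      = ∑ i, ((inner ℝ (x - y) (e i)) ^ 2 / (4 * τ ^ 2) - 1 / (2 * τ))
        * heatKernel τ (x - y) * h y := fun y => by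
    rw [← Finset.sum_mul, ← Finset.sum_mul, Finset.sum_sub_distrib, ← Finset.sum_div,
      e.sum_sq_inner_left]
    simp
    left; left
    ring
  simp_rw [e1, e2]
  refine ⟨integrable_finsetSum _ fun i _ => (hG i).1,
    integrable_finsetSum _ fun i _ => (hG i).2.1, ?_⟩
  rw [integral_finsetSum _ fun i _ => (hG i).1, integral_finsetSum _ fun i _ => (hG i).2.1]
  exact Finset.sum_congr rfl fun i _ => (hG i).2.2

end Duhamel

end ParabolicSineGordon
namespace ParabolicSineGordon

/-! ### Duhamel's formula for classical solutions. -/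

section ClassicalDuhamel

variable {d : ℕ}

local notation "𝕏" => EuclideanSpace ℝ (Fin d)

/-- Bounded classical solutions of `∂ₛ v = κ² Δ v + g` on `[a, b]`, with bounded derivatives. -/
structure SolvesHeat (κ a b C : ℝ) (v g : ℝ → EuclideanSpace ℝ (Fin d) → ℝ) : Prop where
  contDiff : ∀ s ∈ Icc a b, ContDiff ℝ 2 (v s)
  bound : ∀ s ∈ Icc a b, ∀ k ≤ 2, ∀ x, ‖iteratedFDeriv ℝ k (v s) x‖ ≤ C
  continuousOn : ContinuousOn (fun p : ℝ × EuclideanSpace ℝ (Fin d) => v p.1 p.2)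
    (Icc a b ×ˢ univ)
  forcing_bound : ∀ s ∈ Icc a b, ∀ x, |g s x| ≤ C
  forcing_continuousOn : ContinuousOn (fun p : ℝ × EuclideanSpace ℝ (Fin d) => g p.1 p.2)
    (Icc a b ×ˢ univ)
  equation : ∀ s ∈ Icc a b, ∀ x,
    HasDerivAt (fun s => v s x) (κ ^ 2 * Laplacian.laplacian (v s) x + g s x) s

variable {κ a b C : ℝ} {v g : ℝ → EuclideanSpace ℝ (Fin d) → ℝ}

theorem abs_laplacian_le {h : 𝕏 → ℝ} (hC : ∀ x, ‖iteratedFDeriv ℝ 2 h x‖ ≤ C) (x : 𝕏) :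
    |Laplacian.laplacian h x| ≤ d * C := by
  rw [InnerProductSpace.laplacian_eq_iteratedFDeriv_orthonormalBasis h
    (EuclideanSpace.basisFun (Fin d) ℝ)]
  refine (Finset.abs_sum_le_sum_abs _ _).trans ?_
  refine (Finset.sum_le_sum (g := fun _ => C) fun i _ => ?_).trans (by simp)
  have := (iteratedFDeriv ℝ 2 h x).le_opNorm
    ![EuclideanSpace.basisFun (Fin d) ℝ i, EuclideanSpace.basisFun (Fin d) ℝ i]
  simp only [Fin.prod_univ_two, Matrix.cons_val_zero, Matrix.cons_val_one,
    OrthonormalBasis.norm_eq_one, mul_one] at this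
  exact this.trans (hC x)

theorem continuousOn_slice {S : Set ℝ} {f : ℝ → 𝕏 → ℝ}
    (h : ContinuousOn (fun p : ℝ × 𝕏 => f p.1 p.2) (S ×ˢ univ)) {s : ℝ} (hs : s ∈ S) :
    Continuous (f s) :=
  h.comp_continuous (f := fun x => (s, x)) (by fun_prop) fun _ => ⟨hs, mem_univ _⟩

theorem SolvesHeat.abs_le (h : SolvesHeat κ a b C v g) {s : ℝ} (hs : s ∈ Icc a b) (x : 𝕏) :
    |v s x| ≤ C := by
  simpa using h.bound s hs 0 (by norm_num) x

/-- Differentiating `e^{κ²(b-s)Δ} v(s)`, the time derivative of the kernel cancels against `κ²Δv` by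
Green's formula, and only the forcing is left. -/
theorem SolvesHeat.hasDerivAt (hκ : 0 < κ) (h : SolvesHeat κ a b C v g) (x : 𝕏) {s₀ : ℝ}
    (hs₀ : s₀ ∈ Ioo a b) : HasDerivAt (fun s => heatSemigroup (κ ^ 2 * (b - s)) (v s) x)
      (heatSemigroup (κ ^ 2 * (b - s₀)) (g s₀) x) s₀ := by
  have hC0 : 0 ≤ C := (abs_nonneg _).trans (h.abs_le (Ioo_subset_Icc_self hs₀) x)
  -- Staying below `b' < b` keeps the diffusion time away from `0`, where no uniform Gaussian bound
  -- holds.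
  obtain ⟨b', hb1, hb2⟩ := exists_between hs₀.2
  have hτ₁ : 0 < κ ^ 2 * (b - b') := mul_pos (by positivity) (by linarith)
  obtain ⟨A, β, hA, hβ, hAβ⟩ := exists_gaussian_bound (d := d) hτ₁
    (τ₂ := κ ^ 2 * (b - a)) (by have := hs₀.1; gcongr; linarith)
  set τ₁ := κ ^ 2 * (b - b') with hτ₁def
  have hN : Ioo a b' ∈ 𝓝 s₀ := Ioo_mem_nhds hs₀.1 hb1
  have hsub : ∀ s ∈ Ioo a b', s ∈ Icc a b := fun s hs => ⟨hs.1.le, hs.2.le.trans hb2.le⟩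
  have hτ : ∀ s ∈ Ioo a b', τ₁ ≤ κ ^ 2 * (b - s) ∧ κ ^ 2 * (b - s) ≤ κ ^ 2 * (b - a) := by
    intro s hs
    have h1 := hs.1
    have h2 := hs.2
    exact ⟨by rw [hτ₁def]; gcongr, by gcongr⟩
  have hmem := hsub s₀ ⟨hs₀.1, hb1⟩
  have hτ0 : 0 < κ ^ 2 * (b - s₀) := hτ₁.trans_le (hτ s₀ ⟨hs₀.1, hb1⟩).1
  obtain ⟨i1, i2, i3⟩ := integral_heatKernel_mul_laplacian hτ0 (h.contDiff s₀ hmem)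
    (h.bound s₀ hmem) x
  have i4 : Integrable fun y => heatKernel (κ ^ 2 * (b - s₀)) (x - y) * g s₀ y :=
    integrable_heatKernel_mul hτ0
      (continuousOn_slice h.forcing_continuousOn hmem).aestronglyMeasurable
      (Eventually.of_forall (h.forcing_bound s₀ hmem)) x
  let F' : ℝ → 𝕏 → ℝ := fun s y =>
    -κ ^ 2 * ((‖x - y‖ ^ 2 / (4 * (κ ^ 2 * (b - s)) ^ 2) - d / (2 * (κ ^ 2 * (b - s))))
      * heatKernel (κ ^ 2 * (b - s)) (x - y) * v s y)
    + (κ ^ 2 * (heatKernel (κ ^ 2 * (b - s)) (x - y) * Laplacian.laplacian (v s) y)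
      + heatKernel (κ ^ 2 * (b - s)) (x - y) * g s y)
  have hF'int : Integrable (F' s₀) := (i2.const_mul _).add ((i1.const_mul _).add i4)
  have key := hasDerivAt_integral_of_dominated_loc_of_deriv_le (μ := (volume : Measure 𝕏))
    (F := fun s y => heatKernel (κ ^ 2 * (b - s)) (x - y) * v s y) (F' := F')
    (bound := fun y => (κ ^ 2 * (1 / (4 * τ₁ ^ 2) + d / (2 * τ₁)) * C + (κ ^ 2 * (d * C) + C))
      * (A * Real.exp (-β * ‖x - y‖ ^ 2))) hN ?_ ?_ hF'int.aestronglyMeasurable ?_ ?_ ?_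
  · have e : ∫ y, F' s₀ y = heatSemigroup (κ ^ 2 * (b - s₀)) (g s₀) x := by
      have e1 := integral_add (i2.const_mul (-κ ^ 2)) ((i1.const_mul (κ ^ 2)).add i4)
      have e2 := integral_add (i1.const_mul (κ ^ 2)) i4
      simp only [Pi.add_apply] at e1
      simp only [F']
      rw [e1, e2, integral_const_mul, integral_const_mul, i3]
      unfold heatSemigroup
      ring
    rw [← e]
    exact key.2
  · filter_upwards [hN] with s hs
    exact (((continuous_heatKernel _).comp (by fun_prop)).mul
      (h.contDiff s (hsub s hs)).continuous).aestronglyMeasurable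
  · exact integrable_heatKernel_mul hτ0 (h.contDiff s₀ hmem).continuous.aestronglyMeasurable
      (Eventually.of_forall (h.abs_le hmem)) x
  · refine Eventually.of_forall fun y s hs => ?_
    obtain ⟨h1, h2⟩ := hτ s hs
    set τ := κ ^ 2 * (b - s) with hτdef
    have hτp : 0 < τ := hτ₁.trans_le h1
    have hk := heatKernel_pos hτp (x - y)
    have hG := hAβ τ h1 h2 (x - y)
    have hv := h.abs_le (hsub s hs) y
    have hg := h.forcing_bound s (hsub s hs) y
    have hl := abs_laplacian_le (h.bound s (hsub s hs) 2 le_rfl) y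
    have hp : |‖x - y‖ ^ 2 / (4 * τ ^ 2) - d / (2 * τ)|
        ≤ (1 / (4 * τ₁ ^ 2) + d / (2 * τ₁)) * (1 + ‖x - y‖ ^ 2) := by
      refine (abs_sub _ _).trans ?_
      rw [abs_of_nonneg (by positivity), abs_of_nonneg (by positivity)]
      have e1 : ‖x - y‖ ^ 2 / (4 * τ ^ 2) ≤ 1 / (4 * τ₁ ^ 2) * ‖x - y‖ ^ 2 := by
        rw [one_div_mul_eq_div]
        gcongr
      have e2 : (d : ℝ) / (2 * τ) ≤ d / (2 * τ₁) := by gcongr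
      have e3 : 0 ≤ (d : ℝ) / (2 * τ₁) * ‖x - y‖ ^ 2 := by positivity
      have e4 : 0 ≤ 1 / (4 * τ₁ ^ 2) := by positivity
      linarith
    have hk1 : heatKernel τ (x - y) ≤ (1 + ‖x - y‖ ^ 2) * heatKernel τ (x - y) :=
      le_mul_of_one_le_left hk.le (by nlinarith [sq_nonneg ‖x - y‖])
    have t1 : |-κ ^ 2 * ((‖x - y‖ ^ 2 / (4 * τ ^ 2) - d / (2 * τ)) * heatKernel τ (x - y) * v s y)|
        ≤ κ ^ 2 * (1 / (4 * τ₁ ^ 2) + d / (2 * τ₁)) * C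
          * ((1 + ‖x - y‖ ^ 2) * heatKernel τ (x - y)) := by
      rw [abs_mul, abs_mul, abs_mul, abs_of_pos hk, abs_neg, abs_of_nonneg (sq_nonneg κ)]
      calc _ ≤ κ ^ 2 * ((1 / (4 * τ₁ ^ 2) + d / (2 * τ₁)) * (1 + ‖x - y‖ ^ 2)
            * heatKernel τ (x - y) * C) := by gcongr
        _ = _ := by ring
    have t2 : |κ ^ 2 * (heatKernel τ (x - y) * Laplacian.laplacian (v s) y)
        + heatKernel τ (x - y) * g s y|
        ≤ (κ ^ 2 * (d * C) + C) * ((1 + ‖x - y‖ ^ 2) * heatKernel τ (x - y)) := by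
      refine (abs_add_le _ _).trans ?_
      rw [abs_mul, abs_mul, abs_mul, abs_of_pos hk, abs_of_nonneg (sq_nonneg κ)]
      calc _ ≤ κ ^ 2 * (heatKernel τ (x - y) * (d * C)) + heatKernel τ (x - y) * C := by gcongr
        _ = (κ ^ 2 * (d * C) + C) * heatKernel τ (x - y) := by ring
        _ ≤ _ := by gcongr
    rw [Real.norm_eq_abs]
    refine (abs_add_le _ _).trans ((add_le_add t1 t2).trans ?_)
    rw [← add_mul]
    gcongr
  · exact ((((integrable_gaussian hβ).comp_sub_left x).const_mul A).const_mul _)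
  · refine Eventually.of_forall fun y s hs => ?_
    have hτp : 0 < κ ^ 2 * (b - s) := hτ₁.trans_le (hτ s hs).1
    have h1 : HasDerivAt (fun s => κ ^ 2 * (b - s)) (-κ ^ 2) s := by
      have := ((hasDerivAt_const s b).sub (hasDerivAt_id s)).const_mul (κ ^ 2)
      simpa using this
    have h2 := (hasDerivAt_heatKernel hτp (x - y)).comp s h1
    have h3 := h2.mul (h.equation s (hsub s hs) y)
    convert! h3 using 1
    simp only [F', Function.comp]
    ring

/-- The scaled form of `e^{κ²(b-s)Δ} v(s)` makes sense, and is continuous, up to `s = b`, where it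
gives `v(b)`; the kernel formula is meant for positive diffusion times only. -/
theorem continuousOn_integral_scaled (hκ : 0 < κ)
    (hc : ContinuousOn (fun p : ℝ × 𝕏 => v p.1 p.2) (Icc a b ×ˢ univ))
    (hC : ∀ s ∈ Icc a b, ∀ x, |v s x| ≤ C) (x : 𝕏) :
    ContinuousOn (fun s => ∫ z, heatKernel (κ ^ 2) z * v s (x - √(b - s) • z)) (Icc a b) := by
  have hκ2 : 0 < κ ^ 2 := by positivity
  refine continuousOn_of_dominated (bound := fun z => heatKernel (κ ^ 2) z * C) ?_ ?_
    ((integrable_heatKernel hκ2).mul_const C) ?_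
  · intro s hs
    exact ((continuous_heatKernel _).mul ((continuousOn_slice hc hs).comp
      (by fun_prop))).aestronglyMeasurable
  · intro s hs
    refine Eventually.of_forall fun z => ?_
    rw [norm_mul, Real.norm_eq_abs, Real.norm_eq_abs, abs_of_pos (heatKernel_pos hκ2 z)]
    exact mul_le_mul_of_nonneg_left (hC s hs _) (heatKernel_pos hκ2 z).le
  · refine Eventually.of_forall fun z => continuousOn_const.mul ?_
    exact hc.comp (f := fun s => (s, x - √(b - s) • z)) (by fun_prop)
      (fun s hs => ⟨hs, mem_univ _⟩)

theorem integral_scaled_self (hκ : 0 < κ) (f : 𝕏 → ℝ) (x : 𝕏) :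
    ∫ z, heatKernel (κ ^ 2) z * f (x - √(b - b) • z) = f x := by
  have hκ2 : 0 < κ ^ 2 := by positivity
  simp only [sub_self, Real.sqrt_zero, zero_smul, sub_zero]
  rw [integral_mul_const, integral_heatKernel hκ2, one_mul]

theorem heatSemigroup_eq_scaled (hκ : 0 < κ) (f : 𝕏 → ℝ) (x : 𝕏) {s : ℝ} (hs : s < b) :
    heatSemigroup (κ ^ 2 * (b - s)) f x = ∫ z, heatKernel (κ ^ 2) z * f (x - √(b - s) • z) := by
  have hκ2 : 0 < κ ^ 2 := by positivity
  simpa [shiftedGaussian] using heatSemigroup_scaling hκ2 (sub_pos.2 hs) f 0 x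

theorem SolvesHeat.duhamel (hκ : 0 < κ) (hab : a < b) (h : SolvesHeat κ a b C v g) (x : 𝕏) :
    v b x = heatSemigroup (κ ^ 2 * (b - a)) (v a) x
      + ∫ s in a..b, heatSemigroup (κ ^ 2 * (b - s)) (g s) x := by
  set φ : ℝ → ℝ := fun s => ∫ z, heatKernel (κ ^ 2) z * v s (x - √(b - s) • z) with hφ
  have hφb : φ b = v b x := integral_scaled_self hκ (v b) x
  have hφs : ∀ s < b, φ s = heatSemigroup (κ ^ 2 * (b - s)) (v s) x := fun s hs =>
    (heatSemigroup_eq_scaled hκ (v s) x hs).symm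
  have hφc : ContinuousOn φ (Icc a b) :=
    continuousOn_integral_scaled hκ h.continuousOn (fun s hs => h.abs_le hs) x
  have hφd : ∀ s ∈ Ioo a b, HasDerivAt φ (heatSemigroup (κ ^ 2 * (b - s)) (g s) x) s := by
    intro s hs
    refine (h.hasDerivAt hκ x hs).congr_of_eventuallyEq ?_
    filter_upwards [Iio_mem_nhds hs.2] with r hr
    exact hφs r hr
  have hint : IntervalIntegrable (fun s => heatSemigroup (κ ^ 2 * (b - s)) (g s) x) volume a b := by
    rw [intervalIntegrable_iff_integrableOn_Ioo_of_le hab.le]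
    refine integrableOn_heatSemigroup hκ ?_ (C := C)
      (fun s hs => Eventually.of_forall (h.forcing_bound s (Ioo_subset_Icc_self hs))) x
    have hm := h.forcing_continuousOn.mono (prod_mono_left (Ioo_subset_Icc_self))
    have := hm.aestronglyMeasurable (μ := volume.prod volume)
      (measurableSet_Ioo.prod MeasurableSet.univ)
    rwa [← Measure.prod_restrict, Measure.restrict_univ] at this
  have := intervalIntegral.integral_eq_sub_of_hasDerivAt_of_le hab.le hφc hφd hint
  rw [this, hφb, hφs a hab]
  ring

end ClassicalDuhamel

end ParabolicSineGordon
namespace ParabolicSineGordon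

/-! ### Uniqueness, periodicity and restarting of mild solutions. -/

section MildSolutions

variable {d : ℕ}

local notation "𝕏" => EuclideanSpace ℝ (Fin d)

theorem aestronglyMeasurable_Ioo_of_Ioi {f : ℝ × 𝕏 → ℝ}
    (hf : AEStronglyMeasurable f ((volume.restrict (Ioi (0 : ℝ))).prod volume)) {a b : ℝ}
    (ha : 0 ≤ a) : AEStronglyMeasurable f ((volume.restrict (Ioo a b)).prod volume) := by
  refine hf.mono_measure (Measure.prod_mono ?_ le_rfl)
  exact Measure.restrict_mono (fun s hs => ha.trans_lt hs.1) le_rfl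

theorem aestronglyMeasurable_of_continuousOn {f : ℝ × 𝕏 → ℝ}
    (hf : ContinuousOn f (Ioi (0 : ℝ) ×ˢ univ)) :
    AEStronglyMeasurable f ((volume.restrict (Ioi (0 : ℝ))).prod volume) := by
  have := hf.aestronglyMeasurable (μ := volume.prod volume)
    (measurableSet_Ioi.prod MeasurableSet.univ)
  rwa [← Measure.prod_restrict, Measure.restrict_univ] at this

theorem abs_integral_heatSemigroup_sub_le {κ : ℝ} (hκ : 0 < κ) {t c : ℝ} (ht : 0 < t) {n : ℕ}
    {f g : ℝ → 𝕏 → ℝ}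
    (hf : AEStronglyMeasurable (fun p : ℝ × 𝕏 => f p.1 p.2)
      ((volume.restrict (Ioi (0 : ℝ))).prod volume))
    (hg : AEStronglyMeasurable (fun p : ℝ × 𝕏 => g p.1 p.2)
      ((volume.restrict (Ioi (0 : ℝ))).prod volume))
    (hf1 : ∀ s y, |f s y| ≤ 1) (hg1 : ∀ s y, |g s y| ≤ 1)
    (hfg : ∀ s, 0 < s → ∀ᵐ y, |f s y - g s y| ≤ c * s ^ n) (x : 𝕏) :
    |(∫ s in (0 : ℝ)..t, heatSemigroup (κ ^ 2 * (t - s)) (f s) x)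
      - ∫ s in (0 : ℝ)..t, heatSemigroup (κ ^ 2 * (t - s)) (g s) x|
      ≤ c * (t ^ (n + 1) / (n + 1)) := by
  have hf' := aestronglyMeasurable_Ioo_of_Ioi hf (b := t) le_rfl
  have hg' := aestronglyMeasurable_Ioo_of_Ioi hg (b := t) le_rfl
  have i1 := integrableOn_heatSemigroup hκ hf' (C := 1)
    (fun s _ => Eventually.of_forall (hf1 s)) x
  have i2 := integrableOn_heatSemigroup hκ hg' (C := 1)
    (fun s _ => Eventually.of_forall (hg1 s)) x
  have e : ∫ s in (0 : ℝ)..t, c * s ^ n = c * (t ^ (n + 1) / (n + 1)) := by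
    rw [intervalIntegral.integral_const_mul, integral_pow]
    simp
  rw [← e, intervalIntegral.integral_of_le ht.le, intervalIntegral.integral_of_le ht.le,
    intervalIntegral.integral_of_le ht.le, integral_Ioc_eq_integral_Ioo,
    integral_Ioc_eq_integral_Ioo, integral_Ioc_eq_integral_Ioo, ← integral_sub i1 i2,
    ← Real.norm_eq_abs]
  refine norm_integral_le_of_norm_le ((Continuous.integrableOn_Icc
    (by fun_prop)).mono_set Ioo_subset_Icc_self) ?_
  filter_upwards [hf'.prodMk_left, hg'.prodMk_left, ae_restrict_mem measurableSet_Ioo]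
    with s h1 h2 hs
  have hτ : 0 < κ ^ 2 * (t - s) := mul_pos (by positivity) (by linarith [hs.2])
  rw [← heatSemigroup_sub hτ h1 (Eventually.of_forall (hf1 s)) h2
    (Eventually.of_forall (hg1 s))]
  exact abs_heatSemigroup_le hτ (hfg s hs.1) x

/-- Iteration in place of Gronwall's inequality. The datum cancels and `|sin| ≤ 1` gives `|u - v| ≤
2t`; each use of the Lipschitz bound integrates once more, up to `2 tⁿ⁺¹/(n+1)! → 0`. No bound on
`u` or `v` is required. -/
theorem ae_eq_of_duhamel {κ : ℝ} (hκ : 0 < κ) {u₀ : 𝕏 → ℝ} {u v : ℝ → 𝕏 → ℝ}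
    (hum : AEStronglyMeasurable (fun p : ℝ × 𝕏 => u p.1 p.2)
      ((volume.restrict (Ioi (0 : ℝ))).prod volume))
    (hvm : AEStronglyMeasurable (fun p : ℝ × 𝕏 => v p.1 p.2)
      ((volume.restrict (Ioi (0 : ℝ))).prod volume))
    (hu : ∀ t, 0 < t → ∀ᵐ x, u t x = heatSemigroup (κ ^ 2 * t) u₀ x
      + ∫ s in (0 : ℝ)..t, heatSemigroup (κ ^ 2 * (t - s)) (fun y => Real.sin (u s y)) x)
    (hv : ∀ t, 0 < t → ∀ᵐ x, v t x = heatSemigroup (κ ^ 2 * t) u₀ x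
      + ∫ s in (0 : ℝ)..t, heatSemigroup (κ ^ 2 * (t - s)) (fun y => Real.sin (v s y)) x)
    {t : ℝ} (ht : 0 < t) : u t =ᵐ[volume] v t := by
  have hus := Real.continuous_sin.comp_aestronglyMeasurable hum
  have hvs := Real.continuous_sin.comp_aestronglyMeasurable hvm
  have key : ∀ n : ℕ, ∀ t, 0 < t → ∀ᵐ x, |u t x - v t x| ≤ 2 / (n + 1).factorial * t ^ (n + 1) := by
    intro n
    induction n with
    | zero =>
      intro t ht
      filter_upwards [hu t ht, hv t ht] with x h1 h2
      rw [h1, h2, add_sub_add_left_eq_sub]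
      refine (abs_sub _ _).trans ?_
      have := abs_duhamel_sin_le hκ u ht x
      have := abs_duhamel_sin_le hκ v ht x
      simp
      linarith
    | succ n ih =>
      intro t ht
      filter_upwards [hu t ht, hv t ht] with x h1 h2
      rw [h1, h2, add_sub_add_left_eq_sub]
      refine (abs_integral_heatSemigroup_sub_le hκ ht (c := 2 / (n + 1).factorial) (n := n + 1)
        hus hvs (fun _ _ => Real.abs_sin_le_one _) (fun _ _ => Real.abs_sin_le_one _)
        (fun s hs => ?_) x).trans (le_of_eq ?_)
      · filter_upwards [ih s hs] with y hy
        exact (Real.abs_sin_sub_sin_le _ _).trans hy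
      · rw [Nat.factorial_succ (n + 1)]
        push_cast
        field_simp
  have hall := ae_all_iff.2 fun n => key n t ht
  filter_upwards [hall] with x hx
  have hlim : Tendsto (fun n : ℕ => 2 * (t ^ (n + 1) / (n + 1).factorial)) atTop (𝓝 (2 * 0)) :=
    ((FloorSemiring.tendsto_pow_div_factorial_atTop t).comp (tendsto_add_atTop_nat 1)).const_mul 2
  have h0 : |u t x - v t x| ≤ 2 * 0 := ge_of_tendsto' hlim fun n => (hx n).trans (le_of_eq (by ring))
  rw [mul_zero] at h0
  exact sub_eq_zero.1 (abs_nonpos_iff.1 h0)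

/-- The translate by a period solves Duhamel's equation with the same datum, so uniqueness applies;
continuity removes the exceptional null set. -/
theorem DuhamelEq.periodic {κ : ℝ} (hκ : 0 < κ) {u₀ : 𝕏 → ℝ} (hper : TorusPeriodic u₀)
    {u : ℝ → 𝕏 → ℝ} (hu : DuhamelEq κ u₀ u)
    (hc : ContinuousOn (fun p : ℝ × 𝕏 => u p.1 p.2) (Ioi (0 : ℝ) ×ˢ univ)) {t : ℝ} (ht : 0 < t) :
    TorusPeriodic (u t) := by
  intro i
  set c : 𝕏 := EuclideanSpace.single i (2 * Real.pi) with hcdef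
  have hs : ContinuousOn (fun p : ℝ × 𝕏 => u p.1 (p.2 + c)) (Ioi (0 : ℝ) ×ˢ univ) :=
    hc.comp (f := fun p : ℝ × 𝕏 => (p.1, p.2 + c)) (by fun_prop) fun p hp => ⟨hp.1, mem_univ _⟩
  have h0 : (fun y => u₀ (y + c)) = u₀ := funext fun y => hper i y
  have hv : DuhamelEq κ u₀ (fun t x => u t (x + c)) := by
    intro t ht x
    simp only
    rw [hu t ht (x + c), ← heatSemigroup_comp_add, h0]
    congr 1
    refine intervalIntegral.integral_congr fun s _ => ?_
    exact (heatSemigroup_comp_add _ (fun y => Real.sin (u s y)) c x).symm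
  have h := ae_eq_of_duhamel hκ (aestronglyMeasurable_of_continuousOn hs)
    (aestronglyMeasurable_of_continuousOn hc)
    (fun t ht => Eventually.of_forall (hv t ht)) (fun t ht => Eventually.of_forall (hu t ht)) ht
  have h' := (Continuous.ae_eq_iff_eq volume (continuousOn_slice (f := fun t x => u t (x + c)) hs ht)
    (continuousOn_slice hc ht)).1 h
  exact fun x => congrFun h' x

theorem stronglyMeasurable_heatSemigroup {G : ℝ → 𝕏 → ℝ}
    (hG : Measurable fun p : ℝ × 𝕏 => G p.1 p.2) {φ : ℝ → ℝ} (hφ : Measurable φ) :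
    StronglyMeasurable fun p : ℝ × 𝕏 => heatSemigroup (φ p.1) (G p.1) p.2 := by
  have h : Measurable fun p : (ℝ × 𝕏) × 𝕏 => heatKernel (φ p.1.1) (p.1.2 - p.2) * G p.1.1 p.2 := by
    refine Measurable.mul ?_ ?_
    · exact measurable_heatKernel.comp (f := fun p : (ℝ × 𝕏) × 𝕏 => (φ p.1.1, p.1.2 - p.2))
        (by fun_prop)
    · exact hG.comp (f := fun p : (ℝ × 𝕏) × 𝕏 => (p.1.1, p.2)) (by fun_prop)
  exact h.stronglyMeasurable.integral_prod_right'

set_option maxHeartbeats 1000000 in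
/-- The heat semigroup applied to a Duhamel integral. -/
theorem heatSemigroup_duhamel {κ s t C : ℝ} (hκ : 0 < κ) (hs : 0 < s) (hst : s < t)
    {G : ℝ → 𝕏 → ℝ} (hG : Measurable fun p : ℝ × 𝕏 => G p.1 p.2) (hC : ∀ r y, |G r y| ≤ C)
    (x : 𝕏) :
    heatSemigroup (κ ^ 2 * (t - s))
      (fun y => ∫ r in (0 : ℝ)..s, heatSemigroup (κ ^ 2 * (s - r)) (G r) y) x
      = ∫ r in (0 : ℝ)..s, heatSemigroup (κ ^ 2 * (t - r)) (G r) x := by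
  have hτ : 0 < κ ^ 2 * (t - s) := mul_pos (by positivity) (by linarith)
  simp_rw [intervalIntegral.integral_of_le hs.le, integral_Ioc_eq_integral_Ioo]
  have hm := stronglyMeasurable_heatSemigroup hG (φ := fun r => κ ^ 2 * (s - r)) (by fun_prop)
  have hint : Integrable (fun p : 𝕏 × ℝ => heatKernel (κ ^ 2 * (t - s)) (x - p.1)
      * heatSemigroup (κ ^ 2 * (s - p.2)) (G p.2) p.1)
      ((volume : Measure 𝕏).prod (volume.restrict (Ioo 0 s))) := by
    have hb : Integrable (fun p : 𝕏 × ℝ => heatKernel (κ ^ 2 * (t - s)) (x - p.1) * C)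
        ((volume : Measure 𝕏).prod (volume.restrict (Ioo 0 s))) :=
      Integrable.mul_prod (integrable_heatKernel_sub hτ x) (integrable_const C)
    refine hb.mono' ?_ ?_
    · refine (Measurable.mul ?_ ?_).aestronglyMeasurable
      · exact (continuous_heatKernel _).measurable.comp (by fun_prop)
      · exact hm.measurable.comp measurable_swap
    · have : ∀ᵐ p ∂((volume : Measure 𝕏).prod (volume.restrict (Ioo 0 s))), p.2 ∈ Ioo 0 s :=
        Measure.quasiMeasurePreserving_snd.ae (ae_restrict_mem measurableSet_Ioo)
      filter_upwards [this] with p hp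
      rw [norm_mul, Real.norm_eq_abs, Real.norm_eq_abs, abs_of_pos (heatKernel_pos hτ _)]
      refine mul_le_mul_of_nonneg_left ?_ (heatKernel_pos hτ _).le
      exact abs_heatSemigroup_le (mul_pos (by positivity) (by linarith [hp.2]))
        (Eventually.of_forall (hC p.2)) p.1
  rw [heatSemigroup]
  simp_rw [← integral_const_mul]
  rw [integral_integral_swap hint]
  refine setIntegral_congr_fun measurableSet_Ioo fun r hr => ?_
  have hGr : AEStronglyMeasurable (G r) volume :=
    (hG.comp (f := fun y : 𝕏 => (r, y)) (by fun_prop)).aestronglyMeasurable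
  have hτr : 0 < κ ^ 2 * (s - r) := mul_pos (pow_pos hκ 2) (sub_pos.2 hr.2)
  have := heatSemigroup_heatSemigroup hτ hτr hGr (Eventually.of_forall (hC r)) x
  rw [show κ ^ 2 * (t - s) + κ ^ 2 * (s - r) = κ ^ 2 * (t - r) by ring] at this
  exact this

/-- Applying `e^{κ²(t-s)Δ}` to the formula at time `s` yields, by the semigroup law, the free term
at time `t` and the part of the integral over `(0, s)`. -/
theorem DuhamelEq.restart {κ : ℝ} (hκ : 0 < κ) {u₀ : 𝕏 → ℝ} {B : ℝ} (hu₀ : Measurable u₀)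
    (hB : ∀ y, |u₀ y| ≤ B) {u : ℝ → 𝕏 → ℝ} (hu : DuhamelEq κ u₀ u)
    (hc : ContinuousOn (fun p : ℝ × 𝕏 => u p.1 p.2) (Ioi (0 : ℝ) ×ˢ univ)) {s t : ℝ} (hs : 0 < s)
    (hst : s < t) (x : 𝕏) :
    u t x = heatSemigroup (κ ^ 2 * (t - s)) (u s) x
      + ∫ r in s..t, heatSemigroup (κ ^ 2 * (t - r)) (fun y => Real.sin (u r y)) x := by
  classical
  have ht : 0 < t := hs.trans hst
  have hτ : 0 < κ ^ 2 * (t - s) := mul_pos (by positivity) (by linarith)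
  have hτs : 0 < κ ^ 2 * s := by positivity
  -- Set to `0` for `r ≤ 0`, which makes the forcing measurable on the whole space; integrals over
  -- positive times do not notice.
  set G : ℝ → 𝕏 → ℝ := fun r y => (Ioi (0 : ℝ) ×ˢ (univ : Set 𝕏)).piecewise
    (fun p : ℝ × 𝕏 => Real.sin (u p.1 p.2)) (fun _ => 0) (r, y) with hGdef
  have hG : Measurable fun p : ℝ × 𝕏 => G p.1 p.2 :=
    ContinuousOn.measurable_piecewise (Real.continuous_sin.comp_continuousOn hc)
      continuousOn_const (measurableSet_Ioi.prod MeasurableSet.univ)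
  have hGe : ∀ r, 0 < r → G r = fun y => Real.sin (u r y) := fun r hr => by
    funext y
    exact piecewise_eq_of_mem _ _ _ (show (r, y) ∈ Ioi (0 : ℝ) ×ˢ univ from ⟨hr, mem_univ _⟩)
  have hG1 : ∀ r y, |G r y| ≤ 1 := by
    intro r y
    by_cases h : (r, y) ∈ Ioi (0 : ℝ) ×ˢ (univ : Set 𝕏)
    · rw [hGdef]
      simp only [piecewise_eq_of_mem _ _ _ h]
      exact Real.abs_sin_le_one _
    · rw [hGdef]
      simp only [piecewise_eq_of_notMem _ _ _ h]
      simp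
  have hI : ∀ a b c : ℝ, 0 ≤ a → a ≤ b →
      ∫ r in a..b, heatSemigroup (κ ^ 2 * (c - r)) (fun y => Real.sin (u r y)) x
        = ∫ r in a..b, heatSemigroup (κ ^ 2 * (c - r)) (G r) x := by
    intro a b c ha hab
    rw [intervalIntegral.integral_of_le hab, intervalIntegral.integral_of_le hab]
    refine setIntegral_congr_fun measurableSet_Ioc fun r hr => ?_
    rw [hGe r (ha.trans_lt hr.1)]
  have hD := heatSemigroup_duhamel hκ hs hst hG hG1 x
  have hP : StronglyMeasurable fun y => heatSemigroup (κ ^ 2 * s) u₀ y :=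
    (stronglyMeasurable_heatSemigroup (G := fun _ => u₀) (hu₀.comp measurable_snd)
      (φ := fun _ => κ ^ 2 * s) measurable_const).comp_measurable
      (g := fun y : 𝕏 => ((0 : ℝ), y)) (by fun_prop)
  have e1 : (fun y => ∫ r in (0 : ℝ)..s, heatSemigroup (κ ^ 2 * (s - r)) (G r) y)
      = fun y => u s y - heatSemigroup (κ ^ 2 * s) u₀ y := by
    funext y
    have h1 : ∫ r in (0 : ℝ)..s, heatSemigroup (κ ^ 2 * (s - r)) (G r) y
        = ∫ r in (0 : ℝ)..s, heatSemigroup (κ ^ 2 * (s - r)) (fun y => Real.sin (u r y)) y := by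
      rw [intervalIntegral.integral_of_le hs.le, intervalIntegral.integral_of_le hs.le]
      refine setIntegral_congr_fun measurableSet_Ioc fun r hr => ?_
      rw [hGe r hr.1]
    rw [h1, hu s hs y]
    ring
  rw [e1, heatSemigroup_sub hτ (continuousOn_slice hc hs).aestronglyMeasurable
    (Eventually.of_forall fun y => hu.abs_le hκ (Eventually.of_forall hB) hs y)
    hP.aestronglyMeasurable
    (Eventually.of_forall fun y => abs_heatSemigroup_le hτs (Eventually.of_forall hB) y),
    heatSemigroup_heatSemigroup hτ hτs hu₀.aestronglyMeasurable (Eventually.of_forall hB),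
    show κ ^ 2 * (t - s) + κ ^ 2 * s = κ ^ 2 * t by ring] at hD
  have hint : IntegrableOn (fun r => heatSemigroup (κ ^ 2 * (t - r)) (G r) x) (Ioo 0 t) :=
    integrableOn_heatSemigroup hκ hG.aestronglyMeasurable (C := 1)
      (fun r _ => Eventually.of_forall (hG1 r)) x
  have hadj := intervalIntegral.integral_add_adjacent_intervals (μ := volume)
    (f := fun r => heatSemigroup (κ ^ 2 * (t - r)) (G r) x) (a := 0) (b := s) (c := t)
    (by
      rw [intervalIntegrable_iff_integrableOn_Ioo_of_le hs.le]
      exact hint.mono_set (Ioo_subset_Ioo_right hst.le))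
    (by
      rw [intervalIntegrable_iff_integrableOn_Ioo_of_le hst.le]
      exact hint.mono_set (Ioo_subset_Ioo_left hs.le))
  rw [hu t ht x, hI 0 t t le_rfl ht.le, hI s t t hs.le hst.le]
  linarith

end MildSolutions

end ParabolicSineGordon
namespace ParabolicSineGordon

/-! ### Bounds from periodicity, and recovery of a forcing from its Duhamel integrals. -/

section Regularity

variable {d : ℕ}

local notation "𝕏" => EuclideanSpace ℝ (Fin d)

/-- The basis `2π eᵢ` of the lattice of periods. -/
noncomputable def periodBasis (d : ℕ) : Module.Basis (Fin d) ℝ (EuclideanSpace ℝ (Fin d)) :=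
  (EuclideanSpace.basisFun (Fin d) ℝ).toBasis.isUnitSMul (w := fun _ => 2 * Real.pi)
    (fun _ => (by positivity : (2 * Real.pi) ≠ 0).isUnit)

theorem periodBasis_apply (i : Fin d) :
    periodBasis d i = EuclideanSpace.single i (2 * Real.pi) := by
  rw [periodBasis, Module.Basis.isUnitSMul_apply]
  ext j
  simp

theorem eq_of_mem_span_periodBasis {α : Type*} {f : 𝕏 → α}
    (hf : ∀ (i : Fin d) x, f (x + EuclideanSpace.single i (2 * Real.pi)) = f x) {w : 𝕏}
    (hw : w ∈ Submodule.span ℤ (range (periodBasis d))) (x : 𝕏) : f (x + w) = f x := by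
  induction hw using Submodule.span_induction generalizing x with
  | mem w hw =>
    obtain ⟨i, rfl⟩ := hw
    rw [periodBasis_apply]
    exact hf i x
  | zero => rw [add_zero]
  | add v w _ _ hv hw => rw [← add_assoc, hw, hv]
  | smul n w _ hw => exact (Function.Periodic.zsmul (f := f) (c := w) hw n) x

/-- Reduction modulo the lattice of periods; the representative `y` serves all periodic functions
simultaneously. -/
theorem exists_mem_closedBall_of_periodic {α : Type*} (d : ℕ) : ∃ R : ℝ,
    ∀ x : EuclideanSpace ℝ (Fin d), ∃ y ∈ Metric.closedBall (0 : EuclideanSpace ℝ (Fin d)) R,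
      ∀ f : EuclideanSpace ℝ (Fin d) → α,
        (∀ (i : Fin d) x, f (x + EuclideanSpace.single i (2 * Real.pi)) = f x) → f x = f y := by
  obtain ⟨R, hR⟩ := (ZSpan.fundamentalDomain_isBounded (periodBasis d)).subset_closedBall 0
  refine ⟨R, fun x => ⟨ZSpan.fract (periodBasis d) x,
    hR (ZSpan.fract_mem_fundamentalDomain _ x), fun f hf => ?_⟩⟩
  have := eq_of_mem_span_periodBasis hf (ZSpan.floor (periodBasis d) x).2
    (ZSpan.fract (periodBasis d) x)
  rw [← this, ZSpan.fract_apply, sub_add_cancel]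

/-- Periodicity reduces space to a compact ball. This supplies the uniform bounds in `SolvesHeat`,
which are not part of the notion of classical solution. -/
theorem exists_bound_of_periodic {E : Type*} [NormedAddCommGroup E] {a b : ℝ} {f : ℝ → 𝕏 → E}
    (hc : ContinuousOn (fun p : ℝ × 𝕏 => f p.1 p.2) (Icc a b ×ˢ univ))
    (hper : ∀ s ∈ Icc a b, ∀ (i : Fin d) x,
      f s (x + EuclideanSpace.single i (2 * Real.pi)) = f s x) :
    ∃ C, ∀ s ∈ Icc a b, ∀ x, ‖f s x‖ ≤ C := by
  obtain ⟨R, hR⟩ := exists_mem_closedBall_of_periodic (α := E) d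
  obtain ⟨C, hC⟩ := (isCompact_Icc.prod (isCompact_closedBall (0 : 𝕏) R)).exists_bound_of_continuousOn
    (hc.mono (prod_mono_right (subset_univ _)))
  refine ⟨C, fun s hs x => ?_⟩
  obtain ⟨y, hy, h⟩ := hR x
  rw [h (f s) (hper s hs)]
  exact hC (s, y) ⟨hs, hy⟩

theorem TorusPeriodic.iteratedFDeriv {f : 𝕏 → ℝ} (hf : TorusPeriodic f) (k : ℕ) (i : Fin d)
    (x : 𝕏) : iteratedFDeriv ℝ k f (x + EuclideanSpace.single i (2 * Real.pi))
      = iteratedFDeriv ℝ k f x := by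
  rw [← iteratedFDeriv_comp_add_right]
  congr 1
  exact funext (hf i)

theorem exists_solvesHeat {κ a b : ℝ} (ha : 0 < a) {v g : ℝ → 𝕏 → ℝ}
    (hper : ∀ t, 0 < t → TorusPeriodic (v t)) (hgper : ∀ t, 0 < t → TorusPeriodic (g t))
    (hcd : ∀ t, 0 < t → ContDiff ℝ 2 (v t))
    (hc : ∀ k : ℕ, k ≤ 2 → ContinuousOn
      (fun p : ℝ × 𝕏 => iteratedFDeriv ℝ k (v p.1) p.2) (Ioi (0 : ℝ) ×ˢ univ))
    (hgc : ContinuousOn (fun p : ℝ × 𝕏 => g p.1 p.2) (Ioi (0 : ℝ) ×ˢ univ))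
    (heq : ∀ t, 0 < t → ∀ x : 𝕏,
      HasDerivAt (fun s => v s x) (κ ^ 2 * Laplacian.laplacian (v t) x + g t x) t) :
    ∃ C, SolvesHeat κ a b C v g := by
  have hsub : Icc a b ⊆ Ioi 0 := fun s hs => ha.trans_le hs.1
  have hsub' : Icc a b ×ˢ (univ : Set 𝕏) ⊆ Ioi (0 : ℝ) ×ˢ univ := prod_mono_left hsub
  have hk : ∀ k : ℕ, k ≤ 2 → ∃ C, ∀ s ∈ Icc a b, ∀ x, ‖iteratedFDeriv ℝ k (v s) x‖ ≤ C :=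
    fun k hk => exists_bound_of_periodic ((hc k hk).mono hsub')
      fun s hs i x => (hper s (hsub hs)).iteratedFDeriv k i x
  obtain ⟨C0, h0⟩ := hk 0 (by norm_num)
  obtain ⟨C1, h1⟩ := hk 1 (by norm_num)
  obtain ⟨C2, h2⟩ := hk 2 (by norm_num)
  obtain ⟨Cg, hg⟩ := exists_bound_of_periodic (hgc.mono hsub')
    fun s hs => hgper s (hsub hs)
  refine ⟨max (max C0 C1) (max C2 Cg), fun s hs => hcd s (hsub hs), ?_, ?_, ?_, hgc.mono hsub',
    fun s hs => heq s (hsub hs)⟩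
  · intro s hs k hk x
    interval_cases k
    · exact (h0 s hs x).trans (by simp)
    · exact (h1 s hs x).trans (by simp)
    · exact (h2 s hs x).trans (by simp)
  · have := (continuousMultilinearCurryFin0 ℝ 𝕏 ℝ).continuous.comp_continuousOn
      ((hc 0 (by norm_num)).mono hsub')
    refine this.congr fun p _ => ?_
    simp [iteratedFDeriv_zero_eq_comp]
  · exact fun s hs x => (hg s hs x).trans (by simp)

theorem continuousOn_laplacian {v : ℝ → 𝕏 → ℝ} {S : Set (ℝ × 𝕏)}
    (hc : ContinuousOn (fun p : ℝ × 𝕏 => iteratedFDeriv ℝ 2 (v p.1) p.2) S) :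
    ContinuousOn (fun p : ℝ × 𝕏 => Laplacian.laplacian (v p.1) p.2) S := by
  simp_rw [InnerProductSpace.laplacian_eq_iteratedFDeriv_orthonormalBasis _
    (EuclideanSpace.basisFun (Fin d) ℝ)]
  refine continuousOn_finsetSum _ fun i _ => ?_
  exact (ContinuousMultilinearMap.apply ℝ (fun _ : Fin 2 => 𝕏) ℝ
    ![EuclideanSpace.basisFun (Fin d) ℝ i, EuclideanSpace.basisFun (Fin d) ℝ i]).continuous.comp_continuousOn hc

theorem TorusPeriodic.laplacian {f : 𝕏 → ℝ} (hf : TorusPeriodic f) :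
    TorusPeriodic (Laplacian.laplacian f) := by
  intro i x
  simp_rw [InnerProductSpace.laplacian_eq_iteratedFDeriv_orthonormalBasis _
    (EuclideanSpace.basisFun (Fin d) ℝ), hf.iteratedFDeriv 2 i x]

theorem contDiffAt_iteratedFDeriv {u : ℝ → 𝕏 → ℝ}
    (hu : ∀ t, 0 < t → ∀ x, ContDiffAt ℝ ∞ (fun p : ℝ × 𝕏 => u p.1 p.2) (t, x)) (k : ℕ) :
    ∀ t, 0 < t → ∀ x,
      ContDiffAt ℝ ∞ (fun p : ℝ × 𝕏 => _root_.iteratedFDeriv ℝ k (u p.1) p.2) (t, x) := by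
  induction k with
  | zero =>
    intro t ht x
    simp_rw [iteratedFDeriv_zero_eq_comp]
    exact (continuousMultilinearCurryFin0 ℝ 𝕏 ℝ).symm.contDiff.contDiffAt.comp _ (hu t ht x)
  | succ k ih =>
    intro t ht x
    simp_rw [iteratedFDeriv_succ_eq_comp_left]
    have h : ContDiffAt ℝ ∞
        (fun p : ℝ × 𝕏 => fderiv ℝ (_root_.iteratedFDeriv ℝ k (u p.1)) p.2) (t, x) := by
      refine ContDiffAt.fderiv (f := fun (p : ℝ × 𝕏) y => _root_.iteratedFDeriv ℝ k (u p.1) y)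
        (g := fun p : ℝ × 𝕏 => p.2) (n := ∞) ?_ contDiffAt_snd (by simp)
      have hpr : ContDiffAt ℝ ∞ (fun q : (ℝ × 𝕏) × 𝕏 => (q.1.1, q.2)) ((t, x), x) := by fun_prop
      exact ContDiffAt.comp ((t, x), x) (ih t ht x) hpr
    exact (LinearIsometryEquiv.contDiff (𝕜 := ℝ) (n := ∞) (E := 𝕏 →L[ℝ] 𝕏 [×k]→L[ℝ] ℝ)
      (F := 𝕏 [×(k + 1)]→L[ℝ] ℝ) (continuousMultilinearCurryLeftEquiv ℝ
        (fun _ : Fin (k + 1) => 𝕏) ℝ).symm).contDiffAt.comp (t, x) h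

/-- Differentiation in the lower limit gives `ψ = 0` inside the interval; continuity carries this to
the endpoint `b`. -/
theorem eq_zero_of_integral_eq_zero {a b : ℝ} {ψ : ℝ → ℝ} (hab : a < b)
    (hc : ContinuousOn ψ (Icc a b)) (h : ∀ c ∈ Ioo a b, ∫ s in c..b, ψ s = 0) : ψ b = 0 := by
  have h0 : ∀ c ∈ Ioo a b, ψ c = 0 := by
    intro c hcm
    have hN : Icc a b ∈ 𝓝 c := Icc_mem_nhds hcm.1 hcm.2
    have hd := intervalIntegral.integral_hasDerivAt_left (f := ψ) (a := c) (b := b)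
      ((hc.mono (by rw [uIcc_of_le hcm.2.le]; exact Icc_subset_Icc_left hcm.1.le)).intervalIntegrable)
      (hc.stronglyMeasurableAtFilter_nhdsWithin measurableSet_Icc c |>.filter_mono
        (by rw [nhdsWithin_eq_nhds.2 hN])) (hc.continuousAt hN)
    have hz : (fun u => ∫ x in u..b, ψ x) =ᶠ[𝓝 c] fun _ => (0 : ℝ) := by
      filter_upwards [Ioo_mem_nhds hcm.1 hcm.2] with r hr using h r hr
    have := (hd.congr_of_eventuallyEq hz.symm).unique (hasDerivAt_const c (0 : ℝ))
    linarith
  have hne : (𝓝[Ioo a b] b).NeBot := by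
    rw [← mem_closure_iff_nhdsWithin_neBot, closure_Ioo hab.ne]
    exact right_mem_Icc.2 hab.le
  have ht : Tendsto ψ (𝓝[Ioo a b] b) (𝓝 (ψ b)) :=
    (hc b (right_mem_Icc.2 hab.le)).mono_left (nhdsWithin_mono _ Ioo_subset_Icc_self)
  refine tendsto_nhds_unique ht (tendsto_const_nhds.congr' ?_)
  filter_upwards [self_mem_nhdsWithin] with c hcm using (h0 c hcm).symm

/-- In scaled form the integrands extend continuously to `s = b` with values `f b x` and `g b x`, so
equality of the integrals over all short intervals ending at `b` forces these to agree. -/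
theorem eq_of_integral_heatSemigroup_eq {κ a b C : ℝ} (hκ : 0 < κ) (hab : a < b)
    {f g : ℝ → 𝕏 → ℝ}
    (hf : ContinuousOn (fun p : ℝ × 𝕏 => f p.1 p.2) (Icc a b ×ˢ univ))
    (hg : ContinuousOn (fun p : ℝ × 𝕏 => g p.1 p.2) (Icc a b ×ˢ univ))
    (hfC : ∀ s ∈ Icc a b, ∀ x, |f s x| ≤ C) (hgC : ∀ s ∈ Icc a b, ∀ x, |g s x| ≤ C) (x : 𝕏)
    (h : ∀ c ∈ Ioo a b, ∫ s in c..b, heatSemigroup (κ ^ 2 * (b - s)) (f s) x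
      = ∫ s in c..b, heatSemigroup (κ ^ 2 * (b - s)) (g s) x) : f b x = g b x := by
  have c1 := continuousOn_integral_scaled hκ hf hfC x
  have c2 := continuousOn_integral_scaled hκ hg hgC x
  have key := eq_zero_of_integral_eq_zero hab (c1.sub c2) fun c hc => ?_
  · simp only [Pi.sub_apply] at key
    rw [integral_scaled_self hκ (f b) x, integral_scaled_self hκ (g b) x] at key
    linarith
  have hsub : uIcc c b ⊆ Icc a b := by
    rw [uIcc_of_le hc.2.le]
    exact Icc_subset_Icc_left hc.1.le
  have e : ∀ w : ℝ → 𝕏 → ℝ, ∫ s in c..b, heatSemigroup (κ ^ 2 * (b - s)) (w s) x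
      = ∫ s in c..b, ∫ z, heatKernel (κ ^ 2) z * w s (x - √(b - s) • z) := by
    intro w
    rw [intervalIntegral.integral_of_le hc.2.le, intervalIntegral.integral_of_le hc.2.le,
      integral_Ioc_eq_integral_Ioo, integral_Ioc_eq_integral_Ioo]
    exact setIntegral_congr_fun measurableSet_Ioo fun s hs => heatSemigroup_eq_scaled hκ _ x hs.2
  have h' := h c hc
  rw [e, e] at h'
  simp only [Pi.sub_apply]
  rw [intervalIntegral.integral_sub (c1.mono hsub).intervalIntegrable
    (c2.mono hsub).intervalIntegrable, h', sub_self]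

end Regularity

end ParabolicSineGordon
namespace ParabolicSineGordon

/-! ### The differential equation and the maximum principle. -/

section Equation

variable {d : ℕ}

local notation "𝕏" => EuclideanSpace ℝ (Fin d)

theorem contDiff_slice {u : ℝ → 𝕏 → ℝ}
    (hsm : ∀ t, 0 < t → ∀ x, ContDiffAt ℝ ∞ (fun p : ℝ × 𝕏 => u p.1 p.2) (t, x)) {t : ℝ}
    (ht : 0 < t) : ContDiff ℝ ∞ (u t) := by
  rw [contDiff_iff_contDiffAt]
  intro x
  have h : ContDiffAt ℝ ∞ (fun y : 𝕏 => (t, y)) x := by fun_prop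
  exact ContDiffAt.comp (g := fun p : ℝ × 𝕏 => u p.1 p.2) x (hsm t ht x) h

theorem continuousOn_iteratedFDeriv {u : ℝ → 𝕏 → ℝ}
    (hsm : ∀ t, 0 < t → ∀ x, ContDiffAt ℝ ∞ (fun p : ℝ × 𝕏 => u p.1 p.2) (t, x)) (k : ℕ) :
    ContinuousOn (fun p : ℝ × 𝕏 => iteratedFDeriv ℝ k (u p.1) p.2) (Ioi (0 : ℝ) ×ˢ univ) :=
  fun p hp => (contDiffAt_iteratedFDeriv hsm k p.1 hp.1 p.2).continuousAt.continuousWithinAt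

theorem hasDerivAt_time {u : ℝ → 𝕏 → ℝ}
    (hsm : ∀ t, 0 < t → ∀ x, ContDiffAt ℝ ∞ (fun p : ℝ × 𝕏 => u p.1 p.2) (t, x)) {t : ℝ}
    (ht : 0 < t) (x : 𝕏) :
    HasDerivAt (fun s => u s x) (fderiv ℝ (fun p : ℝ × 𝕏 => u p.1 p.2) (t, x) (1, 0)) t := by
  have h1 := ((hsm t ht x).differentiableAt (by simp)).hasFDerivAt
  have h2 : HasDerivAt (fun s : ℝ => (s, x)) ((1 : ℝ), (0 : 𝕏)) t :=
    (hasDerivAt_id t).prodMk (hasDerivAt_const t x)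
  exact HasFDerivAt.comp_hasDerivAt t h1 h2

theorem continuousOn_deriv_time {u : ℝ → 𝕏 → ℝ}
    (hsm : ∀ t, 0 < t → ∀ x, ContDiffAt ℝ ∞ (fun p : ℝ × 𝕏 => u p.1 p.2) (t, x)) :
    ContinuousOn (fun p : ℝ × 𝕏 => deriv (fun s => u s p.2) p.1) (Ioi (0 : ℝ) ×ˢ univ) := by
  have h : ContinuousOn (fun p : ℝ × 𝕏 => fderiv ℝ (fun p : ℝ × 𝕏 => u p.1 p.2) p (1, 0))
      (Ioi (0 : ℝ) ×ˢ univ) := fun p hp =>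
    (((hsm p.1 hp.1 p.2).fderiv_right (m := 0) (by simp)).continuousAt.clm_apply
      continuousAt_const).continuousWithinAt
  exact h.congr fun p hp => (hasDerivAt_time hsm hp.1 p.2).deriv

/-- Smooth solutions of Duhamel's equation solve the differential equation. -/
theorem DuhamelEq.hasDerivAt {κ : ℝ} (hκ : 0 < κ) {u₀ : 𝕏 → ℝ} {B : ℝ} (hu₀ : Measurable u₀)
    (hB : ∀ y, |u₀ y| ≤ B) {u : ℝ → 𝕏 → ℝ} (hu : DuhamelEq κ u₀ u)
    (hsm : ∀ t, 0 < t → ∀ x, ContDiffAt ℝ ∞ (fun p : ℝ × 𝕏 => u p.1 p.2) (t, x))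
    (hper : ∀ t, 0 < t → TorusPeriodic (u t)) {t : ℝ} (ht : 0 < t) (x : 𝕏) :
    HasDerivAt (fun s => u s x) (κ ^ 2 * Laplacian.laplacian (u t) x + Real.sin (u t x)) t := by
  have hc : ContinuousOn (fun p : ℝ × 𝕏 => u p.1 p.2) (Ioi (0 : ℝ) ×ˢ univ) :=
    fun p hp => (hsm p.1 hp.1 p.2).continuousAt.continuousWithinAt
  have hD : ∀ t, 0 < t → ∀ x, HasDerivAt (fun s => u s x) (deriv (fun s => u s x) t) t :=
    fun t ht x => (hasDerivAt_time hsm ht x).differentiableAt.hasDerivAt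
  -- Tautologically `u` solves the heat equation with this forcing. Comparing its Duhamel formula on
  -- `[c, t]` with the restarted mild formula identifies `g` with `sin u`.
  set g : ℝ → 𝕏 → ℝ := fun s x => deriv (fun s => u s x) s - κ ^ 2 * Laplacian.laplacian (u s) x
    with hg
  have hgc : ContinuousOn (fun p : ℝ × 𝕏 => g p.1 p.2) (Ioi (0 : ℝ) ×ˢ univ) :=
    (continuousOn_deriv_time hsm).sub
      (continuousOn_const.mul (continuousOn_laplacian (continuousOn_iteratedFDeriv hsm 2)))
  have hgper : ∀ t, 0 < t → TorusPeriodic (g t) := by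
    intro t ht i x
    simp only [hg]
    rw [(hper t ht).laplacian i x]
    congr 1
    refine Filter.EventuallyEq.deriv_eq ?_
    filter_upwards [Ioi_mem_nhds ht] with s hs using hper s hs i x
  have hsol : ∀ a b, 0 < a → ∃ C, SolvesHeat κ a b C u g := fun a b ha =>
    exists_solvesHeat ha hper hgper
      (fun t ht => (contDiff_slice hsm ht).of_le (by norm_cast))
      (fun k _ => continuousOn_iteratedFDeriv hsm k) hgc
      (fun t ht x => by
        simp only [hg, add_sub_cancel]
        exact hD t ht x)
  have ht2 : 0 < t / 2 := by positivity
  have ht3 : t / 2 < t := by linarith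
  have hsub : Icc (t / 2) t ×ˢ (univ : Set 𝕏) ⊆ Ioi (0 : ℝ) ×ˢ univ :=
    prod_mono_left fun s hs => ht2.trans_le hs.1
  obtain ⟨C, hC⟩ := hsol (t / 2) t ht2
  have key := eq_of_integral_heatSemigroup_eq hκ ht3 (f := g)
    (g := fun s y => Real.sin (u s y)) (C := max C 1) (hgc.mono hsub)
    (Real.continuous_sin.comp_continuousOn (hc.mono hsub))
    (fun s hs y => (hC.forcing_bound s hs y).trans (le_max_left _ _))
    (fun s _ y => (Real.abs_sin_le_one _).trans (le_max_right _ _)) x ?_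
  · have := hD t ht x
    rw [← key]
    simp only [hg, add_sub_cancel]
    exact this
  · intro c hcm
    have hc0 : 0 < c := ht2.trans hcm.1
    obtain ⟨C', hC'⟩ := hsol c t hc0
    have e1 := hC'.duhamel hκ hcm.2 x
    have e2 := hu.restart hκ hu₀ hB hc hc0 hcm.2 x
    linarith

/-- From `sin z ≤ |π - z|`: below `π` the sum `z + sin z` is at most `π`, above it at most `π + 2(z
- π)`. The lower bound follows by oddness. -/
theorem abs_add_sin_le {y ε : ℝ} (hε : 0 ≤ ε) (hy : |y| ≤ Real.pi + ε) :
    |y + Real.sin y| ≤ Real.pi + 2 * ε := by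
  have key : ∀ z, z ≤ Real.pi + ε → z + Real.sin z ≤ Real.pi + 2 * ε := by
    intro z hz
    have h1 : Real.sin z ≤ |Real.pi - z| := by
      rw [← Real.sin_pi_sub]
      exact (le_abs_self _).trans Real.abs_sin_le_abs
    rcases abs_cases (Real.pi - z) with h | h <;> linarith [h.1]
  obtain ⟨h1, h2⟩ := abs_le.1 hy
  have h3 := key y h2
  have h4 := key (-y) (by linarith)
  rw [Real.sin_neg] at h4
  exact abs_le.2 ⟨by linarith, h3⟩

theorem exists_solvesHeat_exp {κ a b : ℝ} (ha : 0 < a) {u : ℝ → 𝕏 → ℝ}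
    (hsm : ∀ t, 0 < t → ∀ x, ContDiffAt ℝ ∞ (fun p : ℝ × 𝕏 => u p.1 p.2) (t, x))
    (hper : ∀ t, 0 < t → TorusPeriodic (u t))
    (heq : ∀ t, 0 < t → ∀ x : 𝕏, HasDerivAt (fun s => u s x)
      (κ ^ 2 * Laplacian.laplacian (u t) x + Real.sin (u t x)) t) :
    ∃ C, SolvesHeat κ a b C (fun t x => Real.exp t * u t x)
      (fun t x => Real.exp t * (u t x + Real.sin (u t x))) := by
  have hc : ContinuousOn (fun p : ℝ × 𝕏 => u p.1 p.2) (Ioi (0 : ℝ) ×ˢ univ) :=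
    fun p hp => (hsm p.1 hp.1 p.2).continuousAt.continuousWithinAt
  have hsm' : ∀ t, 0 < t → ∀ x,
      ContDiffAt ℝ ∞ (fun p : ℝ × 𝕏 => Real.exp p.1 * u p.1 p.2) (t, x) := fun t ht x =>
    (Real.contDiff_exp.contDiffAt.comp _ contDiffAt_fst).mul (hsm t ht x)
  refine exists_solvesHeat ha (fun t ht i x => ?_) (fun t ht i x => ?_)
    (fun t ht => (contDiff_slice (u := fun t x => Real.exp t * u t x) hsm' ht).of_le (by norm_cast))
    (fun k _ => continuousOn_iteratedFDeriv (u := fun t x => Real.exp t * u t x) hsm' k) ?_ fun t ht x => ?_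
  · simp only [hper t ht i x]
  · simp only [hper t ht i x]
  · have h1 := Real.continuous_sin.comp_continuousOn hc
    exact (Continuous.continuousOn (by fun_prop)).mul (hc.add h1)
  · have hl : Laplacian.laplacian (fun x => Real.exp t * u t x) x
        = Real.exp t * Laplacian.laplacian (u t) x :=
      InnerProductSpace.laplacian_smul (Real.exp t)
        ((contDiff_slice hsm ht).contDiffAt.of_le (by norm_cast))
    rw [hl]
    convert! (Real.hasDerivAt_exp t).mul (heq t ht x) using 1
    ring

/-- Improvement of a bound on a solution by means of the equation for `eᵗ u`. -/
theorem abs_le_pi_add_improve {κ : ℝ} (hκ : 0 < κ) {u : ℝ → 𝕏 → ℝ}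
    (hsm : ∀ t, 0 < t → ∀ x, ContDiffAt ℝ ∞ (fun p : ℝ × 𝕏 => u p.1 p.2) (t, x))
    (hper : ∀ t, 0 < t → TorusPeriodic (u t))
    (heq : ∀ t, 0 < t → ∀ x : 𝕏, HasDerivAt (fun s => u s x)
      (κ ^ 2 * Laplacian.laplacian (u t) x + Real.sin (u t x)) t)
    (h0 : ∀ t, 0 < t → ∀ x, |u t x| ≤ Real.pi + t) {c : ℝ} {n : ℕ} (hc0 : 0 ≤ c)
    (hn : ∀ t, 0 < t → ∀ x, |u t x| ≤ Real.pi + c * t ^ n) {t : ℝ} (ht : 0 < t) (x : 𝕏) :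
    |u t x| ≤ Real.pi + 2 * c * (t ^ (n + 1) / (n + 1)) := by
  -- The equation holds only for positive times, so Duhamel's formula starts at `a > 0`; the bound
  -- `π + a` on `u(a)` costs an error `a`, removed at the end.
  have key : ∀ a ∈ Ioo 0 t, |u t x| ≤ Real.pi + 2 * c * (t ^ (n + 1) / (n + 1)) + a := by
    intro a ha
    obtain ⟨C, hC⟩ := exists_solvesHeat_exp (κ := κ) (b := t) ha.1 hsm hper heq
    have hD := hC.duhamel hκ ha.2 x
    have b1 : |heatSemigroup (κ ^ 2 * (t - a)) (fun x => Real.exp a * u a x) x|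
        ≤ Real.exp a * (Real.pi + a) := by
      refine abs_heatSemigroup_le (mul_pos (pow_pos hκ 2) (sub_pos.2 ha.2))
        (Eventually.of_forall fun y => ?_) x
      rw [abs_mul, Real.abs_exp]
      exact mul_le_mul_of_nonneg_left (h0 a ha.1 y) (Real.exp_pos a).le
    have b2 : |∫ s in a..t, heatSemigroup (κ ^ 2 * (t - s))
        (fun x => Real.exp s * (u s x + Real.sin (u s x))) x|
        ≤ ∫ s in a..t, (Real.exp s * Real.pi + Real.exp t * (2 * c) * s ^ n) := by
      rw [intervalIntegral.integral_of_le ha.2.le, intervalIntegral.integral_of_le ha.2.le,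
        integral_Ioc_eq_integral_Ioo, integral_Ioc_eq_integral_Ioo, ← Real.norm_eq_abs]
      refine norm_integral_le_of_norm_le ((Continuous.integrableOn_Icc
        (by fun_prop)).mono_set Ioo_subset_Icc_self) ?_
      filter_upwards [ae_restrict_mem measurableSet_Ioo] with s hs
      have hs0 : 0 < s := ha.1.trans hs.1
      refine abs_heatSemigroup_le (mul_pos (pow_pos hκ 2) (sub_pos.2 hs.2))
        (Eventually.of_forall fun y => ?_) x
      rw [abs_mul, Real.abs_exp]
      have h1 := abs_add_sin_le (by positivity) (hn s hs0 y)
      have h2 : Real.exp s ≤ Real.exp t := Real.exp_le_exp.2 hs.2.le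
      have h3 : 0 ≤ 2 * (c * s ^ n) := by positivity
      have h4 := mul_le_mul_of_nonneg_left h1 (Real.exp_pos s).le
      have h5 := mul_le_mul_of_nonneg_right h2 h3
      linarith
    -- The part `(eᵗ - eᵃ)π` and the contribution `eᵃπ` of the initial value add up to exactly
    -- `eᵗπ`, so the level `π` is reproduced without loss.
    have e : ∫ s in a..t, (Real.exp s * Real.pi + Real.exp t * (2 * c) * s ^ n)
        = (Real.exp t - Real.exp a) * Real.pi
          + Real.exp t * (2 * c) * ((t ^ (n + 1) - a ^ (n + 1)) / (n + 1)) := by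
      rw [intervalIntegral.integral_add (Continuous.intervalIntegrable (by fun_prop) _ _)
        (Continuous.intervalIntegrable (by fun_prop) _ _), intervalIntegral.integral_mul_const,
        intervalIntegral.integral_const_mul, integral_exp, integral_pow]
    have h6 : Real.exp a * a ≤ Real.exp t * a :=
      mul_le_mul_of_nonneg_right (Real.exp_le_exp.2 ha.2.le) ha.1.le
    have h7 : Real.exp t * (2 * c) * ((t ^ (n + 1) - a ^ (n + 1)) / (n + 1))
        ≤ Real.exp t * (2 * c) * (t ^ (n + 1) / (n + 1)) := by
      have := ha.1
      have h8 : (t ^ (n + 1) - a ^ (n + 1)) / ((n : ℝ) + 1) ≤ t ^ (n + 1) / (n + 1) := by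
        refine div_le_div_of_nonneg_right ?_ (by positivity)
        linarith [pow_pos this (n + 1)]
      exact mul_le_mul_of_nonneg_left h8 (by positivity)
    have h9 : Real.exp t * |u t x| ≤ Real.exp t * (Real.pi
        + 2 * c * (t ^ (n + 1) / (n + 1)) + a) := by
      rw [← Real.abs_exp, ← abs_mul, Real.abs_exp, hD]
      refine (abs_add_le _ _).trans ?_
      rw [e] at b2
      linarith
    exact le_of_mul_le_mul_left h9 (Real.exp_pos t)
  refine le_of_forall_pos_le_add fun ε hε => ?_
  refine (key (min ε (t / 2)) ⟨lt_min hε (by linarith), (min_le_right _ _).trans_lt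
    (by linarith)⟩).trans ?_
  linarith [min_le_left ε (t / 2)]

/-- The maximum principle. -/
theorem abs_le_pi_of_abs_le_pi_add {κ : ℝ} (hκ : 0 < κ) {u : ℝ → 𝕏 → ℝ}
    (hsm : ∀ t, 0 < t → ∀ x, ContDiffAt ℝ ∞ (fun p : ℝ × 𝕏 => u p.1 p.2) (t, x))
    (hper : ∀ t, 0 < t → TorusPeriodic (u t))
    (heq : ∀ t, 0 < t → ∀ x : 𝕏, HasDerivAt (fun s => u s x)
      (κ ^ 2 * Laplacian.laplacian (u t) x + Real.sin (u t x)) t)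
    (h0 : ∀ t, 0 < t → ∀ x, |u t x| ≤ Real.pi + t) {t : ℝ} (ht : 0 < t) (x : 𝕏) :
    |u t x| ≤ Real.pi := by
  -- The improvement iterated from `π + t`. The excess is `(2t)ⁿ⁺¹ / (2 (n+1)!)`, which tends to
  -- `0`.
  have key : ∀ n : ℕ, ∀ t, 0 < t → ∀ x,
      |u t x| ≤ Real.pi + 2 ^ n / (n + 1).factorial * t ^ (n + 1) := by
    intro n
    induction n with
    | zero =>
      intro t ht x
      simpa using h0 t ht x
    | succ n ih =>
      intro t ht x
      refine (abs_le_pi_add_improve hκ hsm hper heq h0 (by positivity) ih ht x).trans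
        (le_of_eq ?_)
      rw [Nat.factorial_succ (n + 1)]
      push_cast
      field_simp
      ring
  have hlim : Tendsto (fun n : ℕ => Real.pi + (2 * t) ^ (n + 1) / (n + 1).factorial / 2) atTop
      (𝓝 (Real.pi + 0 / 2)) :=
    (((FloorSemiring.tendsto_pow_div_factorial_atTop (2 * t)).comp
      (tendsto_add_atTop_nat 1)).div_const 2).const_add _
  have := ge_of_tendsto' hlim fun n => (key n t ht x).trans (le_of_eq (by
    rw [mul_pow, pow_succ 2 n]
    ring))
  simpa using this

end Equation

end ParabolicSineGordon
namespace ParabolicSineGordon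

/-! ### Integration of periodic functions over the torus cell. -/

section TorusCell

open scoped Pointwise

variable {d : ℕ}

local notation "𝕏" => EuclideanSpace ℝ (Fin d)

theorem repr_periodBasis (x : 𝕏) (i : Fin d) :
    (periodBasis d).repr x i = x i / (2 * Real.pi) := by
  have h : x = ∑ i, (x i / (2 * Real.pi)) • periodBasis d i := by
    ext j
    simp only [periodBasis_apply, WithLp.ofLp_sum, WithLp.ofLp_smul,
      Finset.sum_apply, Pi.smul_apply, PiLp.single_apply, smul_eq_mul, mul_ite, mul_zero,
      Finset.sum_ite_eq, Finset.mem_univ, if_true]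
    field_simp
  conv_lhs => rw [h]
  rw [Module.Basis.repr_sum_self]

/-- The centre of the fundamental domain `[0, 2π)^d` of the lattice of periods. -/
noncomputable def halfPeriod (d : ℕ) : EuclideanSpace ℝ (Fin d) := WithLp.toLp 2 fun _ => Real.pi

theorem vadd_fundamentalDomain_eq :
    (-halfPeriod d) +ᵥ ZSpan.fundamentalDomain (periodBasis d)
      = {x : 𝕏 | ∀ i, x i ∈ Ico (-Real.pi) Real.pi} := by
  ext x
  rw [mem_vadd_set_iff_neg_vadd_mem, ZSpan.mem_fundamentalDomain, mem_ofPred_eq]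
  refine forall_congr' fun i => ?_
  have hpi := Real.pi_pos
  rw [repr_periodBasis]
  simp only [neg_neg, vadd_eq_add, PiLp.add_apply, halfPeriod, mem_Ico]
  rw [le_div_iff₀ (by positivity), div_lt_iff₀ (by positivity)]
  constructor <;> rintro ⟨h1, h2⟩ <;> constructor <;> linarith

theorem torusCell_ae_eq :
    torusCell d =ᵐ[volume] ((-halfPeriod d) +ᵥ ZSpan.fundamentalDomain (periodBasis d) : Set 𝕏) := by
  rw [vadd_fundamentalDomain_eq]
  have h := (Measure.univ_pi_Ico_ae_eq_Icc (μ := fun _ : Fin d => (volume : Measure ℝ))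
    (f := fun _ => -Real.pi) (g := fun _ => Real.pi)).symm
  have h2 := (PiLp.volume_preserving_ofLp (Fin d)).quasiMeasurePreserving.preimage_ae_eq h
  have e1 : torusCell d
      = WithLp.ofLp ⁻¹' Icc (fun _ : Fin d => -Real.pi) (fun _ => Real.pi) := by
    ext x
    simp [torusCell, Pi.le_def, forall_and]
  have e2 : {x : 𝕏 | ∀ i, x i ∈ Ico (-Real.pi) Real.pi}
      = WithLp.ofLp ⁻¹' (univ.pi fun _ : Fin d => Ico (-Real.pi) Real.pi) := by
    ext x
    simp
  rw [e1, e2]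
  exact h2

theorem isAddFundamentalDomain_vadd (h : 𝕏) :
    IsAddFundamentalDomain (Submodule.span ℤ (range (periodBasis d))).toAddSubgroup
      (h +ᵥ ZSpan.fundamentalDomain (periodBasis d)) volume := by
  have := ZSpan.isAddFundamentalDomain' (periodBasis d) (volume : Measure 𝕏)
  exact this.vadd_of_comm h

instance countable_periodLattice :
    Countable (Submodule.span ℤ (range (periodBasis d))).toAddSubgroup :=
  inferInstanceAs (Countable (Submodule.span ℤ (range (periodBasis d))))

/-- Any translate of the fundamental domain is one as well, and an invariant function has the same
integral over all of them; the closed cell is such a translate up to a null set. -/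
theorem setLIntegral_fundamentalDomain_eq {F : 𝕏 → ℝ≥0∞}
    (hF : ∀ (i : Fin d) x, F (x + EuclideanSpace.single i (2 * Real.pi)) = F x) (h : 𝕏) :
    ∫⁻ x in h +ᵥ ZSpan.fundamentalDomain (periodBasis d), F x = ∫⁻ x in torusCell d, F x := by
  rw [setLIntegral_congr torusCell_ae_eq]
  refine (isAddFundamentalDomain_vadd h).setLIntegral_eq (isAddFundamentalDomain_vadd _) F ?_
  intro w x
  change F ((w : 𝕏) + x) = F x
  rw [add_comm]
  exact eq_of_mem_span_periodBasis hF w.2 x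

theorem setLIntegral_torusCell_comp_sub {F : 𝕏 → ℝ≥0∞}
    (hF : ∀ (i : Fin d) x, F (x + EuclideanSpace.single i (2 * Real.pi)) = F x) (h : 𝕏) :
    ∫⁻ x in torusCell d, F (x - h) = ∫⁻ x in torusCell d, F x := by
  have hF' : ∀ (i : Fin d) x, F (x + EuclideanSpace.single i (2 * Real.pi) - h) = F (x - h) :=
    fun i x => by rw [add_sub_right_comm, hF]
  rw [← setLIntegral_fundamentalDomain_eq hF 0,
    ← setLIntegral_fundamentalDomain_eq (F := fun x => F (x - h)) hF' h, zero_vadd]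
  have := (measurePreserving_add_left (volume : Measure 𝕏) h).setLIntegral_comp_emb
    (measurableEmbedding_addLeft h) (fun x => F (x - h)) (ZSpan.fundamentalDomain (periodBasis d))
  simp only [add_sub_cancel_left] at this
  rw [this]
  rfl

theorem lintegral_eq_zero_of_torusCell {F : 𝕏 → ℝ≥0∞}
    (hF : ∀ (i : Fin d) x, F (x + EuclideanSpace.single i (2 * Real.pi)) = F x)
    (h0 : ∫⁻ x in torusCell d, F x = 0) : ∫⁻ x, F x = 0 := by
  rw [(isAddFundamentalDomain_vadd (0 : 𝕏)).lintegral_eq_tsum'' F, ENNReal.tsum_eq_zero]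
  intro w
  have : ∀ x, F (w +ᵥ x) = F x := fun x => by
    change F ((w : 𝕏) + x) = F x
    rw [add_comm]
    exact eq_of_mem_span_periodBasis hF w.2 x
  simp_rw [this]
  rw [setLIntegral_fundamentalDomain_eq hF 0, h0]

theorem torusCell_subset_closedBall : ∃ R : ℝ, torusCell d ⊆ Metric.closedBall 0 R := by
  refine ⟨√(∑ _i : Fin d, Real.pi ^ 2), fun x hx => ?_⟩
  rw [mem_closedBall_zero_iff, EuclideanSpace.norm_eq]
  refine Real.sqrt_le_sqrt (Finset.sum_le_sum fun i _ => ?_)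
  rw [Real.norm_eq_abs, sq_abs]
  exact sq_le_sq' (hx i).1 (hx i).2

theorem volume_torusCell_lt_top : volume (torusCell d) < ⊤ := by
  obtain ⟨R, hR⟩ := torusCell_subset_closedBall (d := d)
  exact (measure_mono hR).trans_lt measure_closedBall_lt_top

theorem measurableSet_torusCell : MeasurableSet (torusCell d) := by
  have : torusCell d = ⋂ i, (fun x : 𝕏 => x i) ⁻¹' Icc (-Real.pi) Real.pi := by
    ext x
    simp [torusCell]
  rw [this]
  exact MeasurableSet.iInter fun i => measurableSet_Icc.preimage (by fun_prop)

/-- Translations act continuously on `L¹`; the action is `DomAddAct`. -/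
theorem tendsto_eLpNorm_comp_add_sub {w : 𝕏 → ℝ} (hw : MemLp w 1 volume) :
    Tendsto (fun h : 𝕏 => eLpNorm (fun x => w (h + x) - w x) 1 volume) (𝓝 0) (𝓝 0) := by
  have : Fact ((1 : ℝ≥0∞) ≠ ⊤) := ⟨ENNReal.one_ne_top⟩
  have hc : Continuous fun h : 𝕏 => (DomAddAct.mk h) +ᵥ hw.toLp w :=
    DomAddAct.continuous_mk.vadd continuous_const
  have h0 := (hc.edist continuous_const (g := fun _ => hw.toLp w)).tendsto 0
  have he : ∀ h : 𝕏, edist (DomAddAct.mk h +ᵥ hw.toLp w) (hw.toLp w)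
      = eLpNorm (fun x => w (h + x) - w x) 1 volume := by
    intro h
    rw [DomAddAct.mk_vadd_toLp, Lp.edist_toLp_toLp]
    rfl
  simp_rw [he] at h0
  simpa using h0

end TorusCell

end ParabolicSineGordon
namespace ParabolicSineGordon

/-! ### Behaviour of the heat flow in `L¹` of the torus as `t → 0`. -/

section InitialValue

variable {d : ℕ}

local notation "𝕏" => EuclideanSpace ℝ (Fin d)

theorem lintegral_enorm_heatKernel {τ : ℝ} (hτ : 0 < τ) :
    ∫⁻ z : 𝕏, ‖heatKernel τ z‖ₑ = 1 := by
  rw [← ofReal_integral_norm_eq_lintegral_enorm (integrable_heatKernel hτ)]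
  simp_rw [Real.norm_eq_abs, abs_of_pos (heatKernel_pos hτ _)]
  rw [integral_heatKernel hτ, ENNReal.ofReal_one]

/-- Minkowski's integral inequality in `L¹`, that is, Tonelli. It gives both the `L¹` contraction
and the estimate of `e^{τΔ} f - f`. -/
theorem lintegral_enorm_integral_le {S : Set (EuclideanSpace ℝ (Fin d))} {K : 𝕏 → ℝ}
    (hK : Measurable K) {F : 𝕏 → 𝕏 → ℝ}
    (hF : AEStronglyMeasurable (fun p : 𝕏 × 𝕏 => F p.1 p.2) ((volume.restrict S).prod volume)) :
    ∫⁻ x in S, ‖∫ z, K z * F x z‖ₑ ≤ ∫⁻ z, ‖K z‖ₑ * ∫⁻ x in S, ‖F x z‖ₑ := by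
  have hm : AEMeasurable (fun p : 𝕏 × 𝕏 => ‖K p.2‖ₑ * ‖F p.1 p.2‖ₑ)
      ((volume.restrict S).prod volume) :=
    (hK.comp measurable_snd).enorm.aemeasurable.mul hF.enorm
  calc ∫⁻ x in S, ‖∫ z, K z * F x z‖ₑ
      ≤ ∫⁻ x in S, ∫⁻ z, ‖K z‖ₑ * ‖F x z‖ₑ := by
        refine lintegral_mono fun x => (enorm_integral_le_lintegral_enorm _).trans (le_of_eq ?_)
        simp_rw [enorm_mul]
    _ = ∫⁻ z, ∫⁻ x in S, ‖K z‖ₑ * ‖F x z‖ₑ := lintegral_lintegral_swap hm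
    _ = ∫⁻ z, ‖K z‖ₑ * ∫⁻ x in S, ‖F x z‖ₑ := by
        simp_rw [lintegral_const_mul' _ _ enorm_ne_top]

theorem aestronglyMeasurable_comp_sub {f : 𝕏 → ℝ} (hf : AEStronglyMeasurable f volume)
    (S : Set (EuclideanSpace ℝ (Fin d))) :
    AEStronglyMeasurable (fun p : 𝕏 × 𝕏 => f (p.1 - p.2)) ((volume.restrict S).prod volume) :=
  (hf.comp_quasiMeasurePreserving
    (quasiMeasurePreserving_sub_of_right_invariant volume volume)).mono_measure
    (Measure.prod_mono Measure.restrict_le_self le_rfl)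

/-- The heat semigroup is a contraction in `L¹` of the torus. -/
theorem lintegral_heatSemigroup_le {τ : ℝ} (hτ : 0 < τ) {f : 𝕏 → ℝ} (hper : TorusPeriodic f)
    (hf : AEStronglyMeasurable f volume) :
    ∫⁻ x in torusCell d, ‖heatSemigroup τ f x‖ₑ ≤ ∫⁻ x in torusCell d, ‖f x‖ₑ := by
  simp_rw [heatSemigroup_eq_integral_sub]
  refine (lintegral_enorm_integral_le (F := fun x z => f (x - z))
    (continuous_heatKernel τ).measurable (aestronglyMeasurable_comp_sub hf _)).trans ?_
  have h : ∀ z, ∫⁻ x in torusCell d, ‖f (x - z)‖ₑ = ∫⁻ x in torusCell d, ‖f x‖ₑ := fun z =>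
    setLIntegral_torusCell_comp_sub (F := fun x => ‖f x‖ₑ) (fun i x => by simp only [hper i x]) z
  simp_rw [h]
  rw [lintegral_mul_const _ (continuous_heatKernel τ).measurable.enorm,
    lintegral_enorm_heatKernel hτ, one_mul]

theorem tendsto_heatSemigroup_nhdsGT_zero {κ : ℝ} (hκ : 0 < κ) {f : 𝕏 → ℝ} {C : ℝ}
    (hf : Measurable f) (hC : ∀ y, |f y| ≤ C) {x : 𝕏} (hx : ContinuousAt f x) :
    Tendsto (fun t => heatSemigroup (κ ^ 2 * t) f x) (𝓝[>] (0 : ℝ)) (𝓝 (f x)) := by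
  have hκ2 : 0 < κ ^ 2 := by positivity
  have h0 : ∫ z : 𝕏, heatKernel (κ ^ 2) z * f x = f x := by
    rw [integral_mul_const, integral_heatKernel hκ2, one_mul]
  have key : Tendsto (fun t : ℝ => ∫ z, heatKernel (κ ^ 2) z * f (x - √t • z)) (𝓝[>] (0 : ℝ))
      (𝓝 (∫ z : 𝕏, heatKernel (κ ^ 2) z * f x)) := by
    refine tendsto_integral_filter_of_dominated_convergence
      (fun z => heatKernel (κ ^ 2) z * C) ?_ ?_ ((integrable_heatKernel hκ2).mul_const C) ?_
    · exact Eventually.of_forall fun t => ((continuous_heatKernel _).measurable.mul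
        (hf.comp (by fun_prop))).aestronglyMeasurable
    · refine Eventually.of_forall fun t => Eventually.of_forall fun z => ?_
      rw [norm_mul, Real.norm_eq_abs, Real.norm_eq_abs, abs_of_pos (heatKernel_pos hκ2 z)]
      exact mul_le_mul_of_nonneg_left (hC _) (heatKernel_pos hκ2 z).le
    · refine Eventually.of_forall fun z => Tendsto.const_mul _ ?_
      have h1 : Tendsto (fun t : ℝ => x - √t • z) (𝓝[>] 0) (𝓝 x) := by
        have : Continuous fun t : ℝ => x - √t • z := by fun_prop
        simpa using (this.tendsto 0).mono_left nhdsWithin_le_nhds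
      exact hx.tendsto.comp h1
  rw [h0] at key
  refine key.congr' ?_
  filter_upwards [self_mem_nhdsWithin] with t ht
  have := heatSemigroup_eq_scaled hκ f x (b := t) (s := 0) ht
  simpa using this.symm

/-- The modulus of continuity in `L¹` of the torus. -/
noncomputable def shiftModulus (f : EuclideanSpace ℝ (Fin d) → ℝ)
    (h : EuclideanSpace ℝ (Fin d)) : ℝ≥0∞ :=
  ∫⁻ x in torusCell d, ‖f (x - h) - f x‖ₑ

theorem shiftModulus_congr {f g : 𝕏 → ℝ} (h : f =ᵐ[volume] g) :
    shiftModulus f = shiftModulus g := by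
  funext z
  refine lintegral_congr_ae (ae_restrict_of_ae ?_)
  have h' := (measurePreserving_sub_right (volume : Measure 𝕏) z).quasiMeasurePreserving.ae_eq_comp h
  filter_upwards [h, h'] with x h1 h2
  simp only [Function.comp] at h2
  rw [h1, h2]

theorem measurable_shiftModulus {f : 𝕏 → ℝ} (hf : Measurable f) : Measurable (shiftModulus f) := by
  have : Measurable fun p : 𝕏 × 𝕏 => ‖f (p.2 - p.1) - f p.2‖ₑ := by fun_prop
  exact this.lintegral_prod_right'

theorem shiftModulus_le {f : 𝕏 → ℝ} {C : ℝ} (hC : ∀ y, |f y| ≤ C) (h : 𝕏) :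
    shiftModulus f h ≤ ENNReal.ofReal (2 * C) * volume (torusCell d) := by
  rw [← setLIntegral_const]
  refine lintegral_mono fun x => ?_
  rw [Real.enorm_eq_ofReal_abs]
  refine ENNReal.ofReal_le_ofReal ((abs_sub _ _).trans ?_)
  linarith [hC (x - h), hC x]

theorem tendsto_shiftModulus {f : 𝕏 → ℝ} {C : ℝ} (hf : Measurable f) (hC : ∀ y, |f y| ≤ C) :
    Tendsto (shiftModulus f) (𝓝 0) (𝓝 0) := by
  obtain ⟨R, hR⟩ := torusCell_subset_closedBall (d := d)
  -- A bounded function becomes integrable when cut off to a ball; the extra radius `1` makes the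
  -- cut-off invisible on the cell for translations of length at most `1`.
  set B := Metric.closedBall (0 : 𝕏) (R + 1)
  have hw : MemLp (B.indicator f) 1 volume := by
    rw [memLp_one_iff_integrable, integrable_indicator_iff measurableSet_closedBall]
    exact Measure.integrableOn_of_bounded measure_closedBall_lt_top.ne hf.aestronglyMeasurable
      (M := C) (Eventually.of_forall fun x => hC x)
  have h0 := (tendsto_eLpNorm_comp_add_sub hw).comp (f := fun h : 𝕏 => -h) (x := 𝓝 0) (by
    simpa using (continuous_neg (G := 𝕏)).tendsto 0)
  refine tendsto_of_tendsto_of_tendsto_of_le_of_le' tendsto_const_nhds h0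
    (Eventually.of_forall fun _ => zero_le) ?_
  filter_upwards [Metric.closedBall_mem_nhds (0 : 𝕏) one_pos] with h hh
  rw [Function.comp, eLpNorm_one_eq_lintegral_enorm]
  refine le_trans (le_of_eq ?_) (setLIntegral_le_lintegral (torusCell d) _)
  refine setLIntegral_congr_fun measurableSet_torusCell fun x hx => ?_
  have hx' := mem_closedBall_zero_iff.1 (hR hx)
  have hh' := mem_closedBall_zero_iff.1 hh
  have m1 : x ∈ B := mem_closedBall_zero_iff.2 (by linarith)
  have m2 : -h + x ∈ B := mem_closedBall_zero_iff.2 ((norm_add_le _ _).trans (by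
    rw [norm_neg]; linarith))
  rw [indicator_of_mem m1, indicator_of_mem m2, neg_add_eq_sub]

/-- As the kernel has mass one, `e^{τΔ} f - f` is an average of the differences `f(x - z) - f(x)`.
-/
theorem lintegral_heatSemigroup_sub_self_le {τ : ℝ} (hτ : 0 < τ) {f : 𝕏 → ℝ} {C : ℝ}
    (hf : AEStronglyMeasurable f volume) (hC : ∀ᵐ y, |f y| ≤ C) :
    ∫⁻ x in torusCell d, ‖heatSemigroup τ f x - f x‖ₑ
      ≤ ∫⁻ z, ‖heatKernel τ z‖ₑ * shiftModulus f z := by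
  have e : ∀ x, heatSemigroup τ f x - f x = ∫ z, heatKernel τ z * (f (x - z) - f x) := by
    intro x
    have i1 : Integrable fun z => heatKernel τ z * f (x - z) := by
      have := (integrable_heatKernel_mul hτ hf hC x).comp_sub_left x
      simpa using this
    simp_rw [mul_sub]
    rw [integral_sub i1 ((integrable_heatKernel hτ).mul_const _), integral_mul_const,
      integral_heatKernel hτ, one_mul, heatSemigroup_eq_integral_sub]
  simp_rw [e]
  exact lintegral_enorm_integral_le (F := fun x z => f (x - z) - f x)
    (continuous_heatKernel τ).measurable
    ((aestronglyMeasurable_comp_sub hf _).sub hf.restrict.comp_fst)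

/-- The heat flow attains its initial value in `L¹` of the torus. -/
theorem tendsto_lintegral_heatSemigroup_sub_self {κ : ℝ} (hκ : 0 < κ) {f : 𝕏 → ℝ} {C : ℝ}
    (hf : AEStronglyMeasurable f volume) (hC : ∀ᵐ y, |f y| ≤ C) {f' : 𝕏 → ℝ} (hf' : Measurable f')
    (hC' : ∀ y, |f' y| ≤ C) (hff' : f =ᵐ[volume] f') :
    Tendsto (fun t => ∫⁻ x in torusCell d, ‖heatSemigroup (κ ^ 2 * t) f x - f x‖ₑ)
      (𝓝[>] (0 : ℝ)) (𝓝 0) := by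
  -- The upper bound is the heat flow of this function at the origin, where it is continuous and
  -- vanishes. The sign in `-z` compensates the `0 - z` of the convolution.
  set M : 𝕏 → ℝ := fun z => (shiftModulus f' (-z)).toReal with hM
  set D : ℝ≥0∞ := ENNReal.ofReal (2 * C) * volume (torusCell d) with hD
  have hDt : D ≠ ⊤ := ENNReal.mul_ne_top ENNReal.ofReal_ne_top volume_torusCell_lt_top.ne
  have hle : ∀ z, shiftModulus f' z ≤ D := shiftModulus_le hC'
  have hfin : ∀ z, shiftModulus f' z ≠ ⊤ := fun z => ((hle z).trans_lt hDt.lt_top).ne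
  have hMm : Measurable M := ((measurable_shiftModulus hf').comp measurable_neg).ennreal_toReal
  have hMC : ∀ z, |M z| ≤ D.toReal := fun z => by
    rw [abs_of_nonneg ENNReal.toReal_nonneg]
    exact ENNReal.toReal_mono hDt (hle _)
  have hz : shiftModulus f' 0 = 0 := by simp [shiftModulus]
  have hMz : M 0 = 0 := by simp [hM, hz]
  have hMc : ContinuousAt M 0 := by
    rw [ContinuousAt, hMz]
    have h1 := (tendsto_shiftModulus hf' hC').comp (f := fun h : 𝕏 => -h) (x := 𝓝 0) (by
      simpa using (continuous_neg (G := 𝕏)).tendsto 0)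
    exact (ENNReal.tendsto_toReal ENNReal.zero_ne_top).comp h1
  have h2 := ENNReal.tendsto_ofReal (tendsto_heatSemigroup_nhdsGT_zero hκ hMm hMC hMc)
  rw [hMz, ENNReal.ofReal_zero] at h2
  refine tendsto_of_tendsto_of_tendsto_of_le_of_le' tendsto_const_nhds h2
    (Eventually.of_forall fun _ => zero_le) ?_
  filter_upwards [self_mem_nhdsWithin] with t ht
  have hτ : 0 < κ ^ 2 * t := mul_pos (pow_pos hκ 2) ht
  refine (lintegral_heatSemigroup_sub_self_le hτ hf hC).trans (le_of_eq ?_)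
  have hi : Integrable fun z => heatKernel (κ ^ 2 * t) z * M (0 - z) := by
    have := (integrable_heatKernel_mul hτ hMm.aestronglyMeasurable
      (Eventually.of_forall hMC) 0).comp_sub_left 0
    simpa using this
  rw [shiftModulus_congr hff', heatSemigroup_eq_integral_sub,
    ofReal_integral_eq_lintegral_ofReal hi (Eventually.of_forall fun z =>
      mul_nonneg (heatKernel_pos hτ z).le ENNReal.toReal_nonneg)]
  refine lintegral_congr fun z => ?_
  rw [ENNReal.ofReal_mul (heatKernel_pos hτ z).le, Real.enorm_eq_ofReal (heatKernel_pos hτ z).le]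
  simp only [hM, zero_sub, neg_neg]
  rw [ENNReal.ofReal_toReal (hfin z)]

end InitialValue

end ParabolicSineGordon
namespace ParabolicSineGordon

/-! ### Classical solutions are mild, and the mild solution attains its datum in `L¹`. -/

section ClassicalSolutions

variable {d : ℕ}

local notation "𝕏" => EuclideanSpace ℝ (Fin d)

theorem aestronglyMeasurable_heatSemigroup_slice {f : 𝕏 → ℝ} (hf : AEStronglyMeasurable f volume)
    (τ : ℝ) : AEStronglyMeasurable (heatSemigroup τ f) volume := by
  have e : heatSemigroup τ f = heatSemigroup τ (hf.mk f) :=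
    funext fun x => heatSemigroup_congr_ae hf.ae_eq_mk x
  have h := (stronglyMeasurable_heatSemigroup (G := fun _ => hf.mk f)
    (hf.stronglyMeasurable_mk.measurable.comp measurable_snd) (φ := fun _ => τ)
    measurable_const).comp_measurable (g := fun y : 𝕏 => ((0 : ℝ), y)) (by fun_prop)
  rw [e]
  exact h.aestronglyMeasurable

theorem TorusPeriodic.heatSemigroup {f : 𝕏 → ℝ} (hf : TorusPeriodic f) (τ : ℝ) :
    TorusPeriodic (heatSemigroup τ f) := by
  intro i x
  rw [← heatSemigroup_comp_add, funext (hf i)]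

theorem tendsto_heatSemigroup_time {κ t : ℝ} (hκ : 0 < κ) (ht : 0 < t) {f : 𝕏 → ℝ} {C : ℝ}
    (hf : AEStronglyMeasurable f volume) (hC : ∀ᵐ y, |f y| ≤ C) (x : 𝕏) :
    Tendsto (fun s => heatSemigroup (κ ^ 2 * (t - s)) f x) (𝓝[>] 0)
      (𝓝 (heatSemigroup (κ ^ 2 * t) f x)) := by
  have hτ₁ : 0 < κ ^ 2 * (t / 2) := by positivity
  obtain ⟨A, β, hA, hβ, hAβ⟩ := exists_gaussian_bound (d := d) hτ₁ (τ₂ := κ ^ 2 * t)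
    (mul_le_mul_of_nonneg_left (by linarith) (by positivity))
  have hev : ∀ᶠ s in 𝓝[>] (0 : ℝ), s ∈ Ioo 0 (t / 2) := Ioo_mem_nhdsGT (by positivity)
  unfold ParabolicSineGordon.heatSemigroup
  refine tendsto_integral_filter_of_dominated_convergence
    (fun y => A * Real.exp (-β * ‖x - y‖ ^ 2) * C) ?_ ?_ ?_ ?_
  · exact Eventually.of_forall fun s =>
      ((continuous_heatKernel _).comp (by fun_prop)).aestronglyMeasurable.mul hf
  · filter_upwards [hev] with s hs
    filter_upwards [hC] with y hy
    have h1 : κ ^ 2 * (t / 2) ≤ κ ^ 2 * (t - s) :=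
      mul_le_mul_of_nonneg_left (by linarith [hs.2]) (by positivity)
    have h2 : κ ^ 2 * (t - s) ≤ κ ^ 2 * t :=
      mul_le_mul_of_nonneg_left (by linarith [hs.1]) (by positivity)
    have hk := heatKernel_pos (hτ₁.trans_le h1) (x - y)
    have h3 := hAβ _ h1 h2 (x - y)
    have h4 : heatKernel (κ ^ 2 * (t - s)) (x - y)
        ≤ (1 + ‖x - y‖ ^ 2) * heatKernel (κ ^ 2 * (t - s)) (x - y) :=
      le_mul_of_one_le_left hk.le (by nlinarith [sq_nonneg ‖x - y‖])
    rw [norm_mul, Real.norm_eq_abs, Real.norm_eq_abs, abs_of_pos hk]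
    exact mul_le_mul (h4.trans h3) hy (abs_nonneg _) (by positivity)
  · exact (((integrable_gaussian hβ).comp_sub_left x).const_mul A).mul_const C
  · refine Eventually.of_forall fun y => Tendsto.mul_const _ ?_
    have h1 : ContinuousAt (fun s : ℝ => κ ^ 2 * (t - s)) 0 := by fun_prop
    have h2 : Tendsto (fun s : ℝ => κ ^ 2 * (t - s)) (𝓝[>] 0) (𝓝 (κ ^ 2 * t)) := by
      simpa using h1.tendsto.mono_left nhdsWithin_le_nhds
    exact (hasDerivAt_heatKernel (by positivity) (x - y)).continuousAt.tendsto.comp h2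

theorem integrableOn_heatSemigroup_sin {κ : ℝ} (hκ : 0 < κ) {v : ℝ → 𝕏 → ℝ}
    (hv : ContinuousOn (fun p : ℝ × 𝕏 => v p.1 p.2) (Ioi (0 : ℝ) ×ˢ univ)) (t : ℝ) (x : 𝕏) :
    IntegrableOn (fun s => heatSemigroup (κ ^ 2 * (t - s)) (fun y => Real.sin (v s y)) x)
      (Ioo 0 t) :=
  integrableOn_heatSemigroup hκ (aestronglyMeasurable_Ioo_of_Ioi
    (aestronglyMeasurable_of_continuousOn (f := fun p => Real.sin (v p.1 p.2))
      (Real.continuous_sin.comp_continuousOn hv)) le_rfl) (C := 1)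
    (fun _ _ => Eventually.of_forall fun _ => Real.abs_sin_le_one _) x

theorem tendsto_integral_heatSemigroup_sin {κ t : ℝ} (hκ : 0 < κ) (ht : 0 < t) {v : ℝ → 𝕏 → ℝ}
    (hv : ContinuousOn (fun p : ℝ × 𝕏 => v p.1 p.2) (Ioi (0 : ℝ) ×ˢ univ)) (x : 𝕏) :
    Tendsto (fun a => ∫ s in a..t, heatSemigroup (κ ^ 2 * (t - s)) (fun y => Real.sin (v s y)) x)
      (𝓝[>] 0)
      (𝓝 (∫ s in (0 : ℝ)..t, heatSemigroup (κ ^ 2 * (t - s)) (fun y => Real.sin (v s y)) x)) := by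
  have hi : IntervalIntegrable
      (fun s => heatSemigroup (κ ^ 2 * (t - s)) (fun y => Real.sin (v s y)) x) volume t 0 := by
    refine IntervalIntegrable.symm ?_
    rw [intervalIntegrable_iff_integrableOn_Ioo_of_le ht.le]
    exact integrableOn_heatSemigroup_sin hκ hv t x
  have hc := (intervalIntegral.continuousOn_primitive_interval' hi left_mem_uIcc) 0 right_mem_uIcc
  have h1 : Tendsto
      (fun a => ∫ s in t..a, heatSemigroup (κ ^ 2 * (t - s)) (fun y => Real.sin (v s y)) x)
      (𝓝[>] 0)
      (𝓝 (∫ s in t..0, heatSemigroup (κ ^ 2 * (t - s)) (fun y => Real.sin (v s y)) x)) := by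
    refine hc.mono_left (nhdsWithin_le_of_mem ?_)
    rw [uIcc_of_ge ht.le]
    exact mem_of_superset (Ioo_mem_nhdsGT ht) Ioo_subset_Icc_self
  have h2 := h1.neg
  simpa only [← intervalIntegral.integral_symm] using h2

theorem IsClassicalSolution.continuousOn_uncurry {κ : ℝ} {u₀ : 𝕏 → ℝ} {v : ℝ → 𝕏 → ℝ}
    (hv : IsClassicalSolution κ u₀ v) :
    ContinuousOn (fun p : ℝ × 𝕏 => v p.1 p.2) (Ioi (0 : ℝ) ×ˢ univ) := by
  have := (continuousMultilinearCurryFin0 ℝ 𝕏 ℝ).continuous.comp_continuousOn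
    (hv.continuousOn 0 (by norm_num))
  refine this.congr fun p _ => ?_
  simp [iteratedFDeriv_zero_eq_comp]

/-- Classical solutions are mild solutions. -/
theorem IsClassicalSolution.duhamel {κ : ℝ} (hκ : 0 < κ) {u₀ : 𝕏 → ℝ} {B : ℝ}
    (hper : TorusPeriodic u₀) (hu₀ : AEStronglyMeasurable u₀ volume) (hB : ∀ᵐ y, |u₀ y| ≤ B)
    {v : ℝ → 𝕏 → ℝ} (hv : IsClassicalSolution κ u₀ v) {t : ℝ} (ht : 0 < t) :
    ∀ᵐ x, v t x = heatSemigroup (κ ^ 2 * t) u₀ x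
      + ∫ s in (0 : ℝ)..t, heatSemigroup (κ ^ 2 * (t - s)) (fun y => Real.sin (v s y)) x := by
  have hc := hv.continuousOn_uncurry
  have hvs : ∀ s, 0 < s → AEStronglyMeasurable (v s) volume := fun s hs =>
    (continuousOn_slice hc hs).aestronglyMeasurable
  set I : ℝ → 𝕏 → ℝ := fun a x =>
    ∫ s in a..t, heatSemigroup (κ ^ 2 * (t - s)) (fun y => Real.sin (v s y)) x with hI
  -- The defect in Duhamel's formula. It is the pointwise limit of `e^{κ²(t-s)Δ}(v(s) - u₀)`, whose
  -- `L¹` norm on the torus is at most that of `v(s) - u₀`; Fatou's lemma gives `R = 0` almost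
  -- everywhere on the cell, and periodicity does the rest.
  set R : 𝕏 → ℝ := fun x => v t x - heatSemigroup (κ ^ 2 * t) u₀ x - I 0 x with hR
  -- A sequence of starting times, as Fatou's lemma and measurability of the limit want; the shift
  -- by `2` keeps `s n < t` already at `n = 0`.
  set s : ℕ → ℝ := fun n => t / (n + 2) with hs
  have hs0 : ∀ n, 0 < s n := fun n => by positivity
  have hst : ∀ n, s n < t := fun n => div_lt_self ht (by
    have : (0 : ℝ) ≤ n := n.cast_nonneg
    linarith)
  have hslim : Tendsto s atTop (𝓝[>] 0) := by
    refine tendsto_nhdsWithin_iff.2 ⟨?_, Eventually.of_forall hs0⟩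
    exact tendsto_const_nhds.div_atTop
      (tendsto_atTop_add_const_right _ _ tendsto_natCast_atTop_atTop)
  have hτ : ∀ n, 0 < κ ^ 2 * (t - s n) := fun n => mul_pos (pow_pos hκ 2) (sub_pos.2 (hst n))
  have hdec : ∀ n x, heatSemigroup (κ ^ 2 * (t - s n)) (fun y => v (s n) y - u₀ y) x
      = v t x - heatSemigroup (κ ^ 2 * (t - s n)) u₀ x - I (s n) x := by
    intro n x
    obtain ⟨C, hC⟩ := exists_solvesHeat (κ := κ) (b := t) (hs0 n) hv.periodic
      (g := fun s y => Real.sin (v s y)) (fun r hr i y => by simp only [hv.periodic r hr i y])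
      hv.contDiff hv.continuousOn (Real.continuous_sin.comp_continuousOn hc) hv.equation
    rw [heatSemigroup_sub (hτ n) (hvs _ (hs0 n)) (Eventually.of_forall
      (hC.abs_le (left_mem_Icc.2 (hst n).le))) hu₀ hB, hC.duhamel hκ (hst n) x]
    ring
  have hRlim : ∀ x, Tendsto (fun n => heatSemigroup (κ ^ 2 * (t - s n))
      (fun y => v (s n) y - u₀ y) x) atTop (𝓝 (R x)) := by
    intro x
    simp_rw [hdec]
    exact (tendsto_const_nhds.sub ((tendsto_heatSemigroup_time hκ ht hu₀ hB x).comp hslim)).sub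
      ((tendsto_integral_heatSemigroup_sin hκ ht hc x).comp hslim)
  have hm : ∀ n, AEStronglyMeasurable (heatSemigroup (κ ^ 2 * (t - s n))
      (fun y => v (s n) y - u₀ y)) volume := fun n =>
    aestronglyMeasurable_heatSemigroup_slice ((hvs _ (hs0 n)).sub hu₀) _
  have hRm : AEStronglyMeasurable R volume :=
    aestronglyMeasurable_of_tendsto_ae atTop hm (Eventually.of_forall hRlim)
  have hup : Tendsto (fun n => ∫⁻ x in torusCell d, ‖v (s n) x - u₀ x‖ₑ) atTop (𝓝 0) := by
    have := hv.initial.comp hslim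
    simpa only [Function.comp_def, eLpNorm_one_eq_lintegral_enorm] using this
  have hlow : Tendsto (fun n => ∫⁻ x in torusCell d, ‖heatSemigroup (κ ^ 2 * (t - s n))
      (fun y => v (s n) y - u₀ y) x‖ₑ) atTop (𝓝 0) := by
    refine tendsto_of_tendsto_of_tendsto_of_le_of_le tendsto_const_nhds hup (fun _ => zero_le) ?_
    intro n
    exact lintegral_heatSemigroup_le (hτ n)
      (fun i x => by simp only [hv.periodic _ (hs0 n) i x, hper i x]) ((hvs _ (hs0 n)).sub hu₀)
  have hcell : ∫⁻ x in torusCell d, ‖R x‖ₑ = 0 := by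
    have h1 := lintegral_liminf_le' (μ := volume.restrict (torusCell d)) (u := atTop)
      (fun n => (hm n).restrict.enorm)
    rw [hlow.liminf_eq] at h1
    refine le_antisymm (le_trans (le_of_eq (lintegral_congr fun x => ?_)) h1) zero_le
    exact ((hRlim x).enorm.liminf_eq).symm
  have hRper : TorusPeriodic R := by
    have hIper : TorusPeriodic (I 0) := by
      intro i x
      simp only [hI]
      rw [intervalIntegral.integral_of_le ht.le, intervalIntegral.integral_of_le ht.le]
      refine setIntegral_congr_fun measurableSet_Ioc fun r hr => ?_
      exact TorusPeriodic.heatSemigroup (f := fun y => Real.sin (v r y))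
        (fun i y => by simp only [hv.periodic r hr.1 i y]) _ i x
    intro i x
    simp only [hR]
    rw [hv.periodic t ht i x, hper.heatSemigroup _ i x, hIper i x]
  have hall := lintegral_eq_zero_of_torusCell (F := fun x => ‖R x‖ₑ)
    (fun i x => by simp only [hRper i x]) hcell
  rw [lintegral_eq_zero_iff' hRm.enorm] at hall
  filter_upwards [hall] with x hx
  have hx' : R x = 0 := by simpa using hx
  simp only [hR] at hx'
  linarith

/-- The free term converges by the `L¹` modulus of continuity, and the Duhamel integral is at most
`t` in absolute value. -/
theorem DuhamelEq.tendsto_eLpNorm {κ : ℝ} (hκ : 0 < κ) {u₀ : 𝕏 → ℝ} {C : ℝ}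
    (hf : AEStronglyMeasurable u₀ volume) (hC : ∀ᵐ y, |u₀ y| ≤ C) {f : 𝕏 → ℝ} (hf' : Measurable f)
    (hC' : ∀ y, |f y| ≤ C) (hff' : u₀ =ᵐ[volume] f) {u : ℝ → 𝕏 → ℝ} (hu : DuhamelEq κ u₀ u) :
    Tendsto (fun t => eLpNorm (fun x => u t x - u₀ x) 1 (volume.restrict (torusCell d)))
      (𝓝[>] (0 : ℝ)) (𝓝 0) := by
  have h1 := tendsto_lintegral_heatSemigroup_sub_self hκ hf hC hf' hC' hff'
  have h2 : Tendsto (fun t : ℝ => ENNReal.ofReal t * volume (torusCell d)) (𝓝[>] 0) (𝓝 0) := by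
    have h3 : Tendsto (fun t : ℝ => ENNReal.ofReal t) (𝓝[>] 0) (𝓝 0) := by
      simpa using (ENNReal.continuous_ofReal.tendsto 0).mono_left nhdsWithin_le_nhds
    simpa using ENNReal.Tendsto.mul_const h3 (Or.inr volume_torusCell_lt_top.ne)
  have h4 := h1.add h2
  rw [add_zero] at h4
  refine tendsto_of_tendsto_of_tendsto_of_le_of_le' tendsto_const_nhds h4
    (Eventually.of_forall fun _ => zero_le) ?_
  filter_upwards [self_mem_nhdsWithin] with t ht
  rw [eLpNorm_one_eq_lintegral_enorm, ← setLIntegral_const,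
    ← lintegral_add_right _ measurable_const]
  refine lintegral_mono fun x => ?_
  have e : u t x - u₀ x = (heatSemigroup (κ ^ 2 * t) u₀ x - u₀ x)
      + ∫ s in (0 : ℝ)..t, heatSemigroup (κ ^ 2 * (t - s)) (fun y => Real.sin (u s y)) x := by
    rw [hu t ht x]
    ring
  rw [e]
  refine (enorm_add_le _ _).trans (add_le_add le_rfl ?_)
  rw [Real.enorm_eq_ofReal_abs]
  exact ENNReal.ofReal_le_ofReal (abs_duhamel_sin_le hκ u ht x)

end ClassicalSolutions

end ParabolicSineGordon
namespace ParabolicSineGordon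

/-! ### Reduction to bounded measurable data, and the conclusion. -/

section WellPosedness

variable {d : ℕ}

local notation "𝕏" => EuclideanSpace ℝ (Fin d)

theorem ae_abs_le_of_supNorm_le {f : 𝕏 → ℝ} {C : ℝ} (hC : 0 ≤ C)
    (h : supNorm f ≤ ENNReal.ofReal C) : ∀ᵐ x, |f x| ≤ C := by
  rw [supNorm, eLpNorm_exponent_top] at h
  filter_upwards [ae_le_eLpNormEssSup (f := f) (μ := volume)] with x hx
  have := hx.trans h
  rwa [Real.enorm_eq_ofReal_abs, ENNReal.ofReal_le_ofReal_iff hC] at this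

theorem supNorm_le_of_ae_abs_le {f : 𝕏 → ℝ} {C : ℝ} (h : ∀ᵐ x, |f x| ≤ C) :
    supNorm f ≤ ENNReal.ofReal C := by
  rw [supNorm, eLpNorm_exponent_top]
  refine eLpNormEssSup_le_of_ae_enorm_bound ?_
  filter_upwards [h] with x hx
  rw [Real.enorm_eq_ofReal_abs]
  exact ENNReal.ofReal_le_ofReal hx

/-- The construction evaluates the datum pointwise, hence wants it measurable and bounded
everywhere; truncating a measurable representative achieves this. -/
theorem exists_measurable_modification {f : 𝕏 → ℝ} {C : ℝ} (hC : 0 ≤ C)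
    (hf : AEStronglyMeasurable f volume) (h : ∀ᵐ x, |f x| ≤ C) :
    ∃ f' : 𝕏 → ℝ, Measurable f' ∧ (∀ x, |f' x| ≤ C) ∧ f =ᵐ[volume] f' := by
  refine ⟨fun x => max (-C) (min C (hf.mk f x)), ?_, fun x => ?_, ?_⟩
  · exact measurable_const.max (measurable_const.min hf.stronglyMeasurable_mk.measurable)
  · exact abs_le.2 ⟨le_max_left _ _, max_le (by linarith) (min_le_left _ _)⟩
  · filter_upwards [h, hf.ae_eq_mk] with x h1 h2
    rw [← h2, min_eq_right (abs_le.1 h1).2, max_eq_right (abs_le.1 h1).1]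

theorem exists_duhamelEq_initial {κ : ℝ} (hκ : 0 < κ) {f : 𝕏 → ℝ} {B : ℝ} (hf : Measurable f)
    (hB : ∀ y, |f y| ≤ B) (u₀ : 𝕏 → ℝ) : ∃ u : ℝ → 𝕏 → ℝ, u 0 = u₀ ∧ DuhamelEq κ f u ∧
      ContinuousOn (fun p : ℝ × 𝕏 => u p.1 p.2) (Ioi (0 : ℝ) ×ˢ univ) := by
  obtain ⟨w, hw, hwc⟩ := exists_duhamelEq hκ hf hB
  -- The constructed function has no prescribed value at `t = 0`. Inserting `u₀` there leaves the
  -- integrals over `(0, t]` unchanged.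
  set u : ℝ → 𝕏 → ℝ := fun t => if 0 < t then w t else u₀ with hu
  have huw : ∀ t, 0 < t → u t = w t := fun t ht => if_pos ht
  refine ⟨u, if_neg (lt_irrefl _), fun t ht x => ?_, hwc.congr fun p hp => ?_⟩
  · rw [huw t ht, hw t ht x]
    congr 1
    rw [intervalIntegral.integral_of_le ht.le, intervalIntegral.integral_of_le ht.le]
    refine setIntegral_congr_fun measurableSet_Ioc fun s hs => ?_
    rw [huw s hs.1]
  · rw [huw p.1 hp.1]

end WellPosedness

end ParabolicSineGordon

theorem theorem2p1 (d : ℕ) (hd : 1 ≤ d) (κ : ℝ) (hκ : 0 < κ)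
    (u₀ : EuclideanSpace ℝ (Fin d) → ℝ)
    (hu₀_per : TorusPeriodic u₀)
    (hu₀_meas : AEStronglyMeasurable u₀ volume)
    (hu₀ : supNorm u₀ ≤ ENNReal.ofReal Real.pi) :
    ∃ u : ℝ → EuclideanSpace ℝ (Fin d) → ℝ,
      -- `u` is a global solution, in the mild sense and, for `t > 0`, in the classical sense
      IsMildSolution κ u₀ u ∧
      IsClassicalSolution κ u₀ u ∧
      -- `u` is smooth on `t > 0`
      ContDiffOn ℝ ∞ (fun p : ℝ × EuclideanSpace ℝ (Fin d) => u p.1 p.2)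
        (Ioi (0 : ℝ) ×ˢ univ) ∧
      -- the maximum principle
      (⨆ (t : ℝ) (_ : 0 ≤ t), supNorm (u t)) ≤ ENNReal.ofReal Real.pi ∧
      -- `u` is the only mild solution
      (∀ v, IsMildSolution κ u₀ v → ∀ t, 0 ≤ t → v t =ᵐ[volume] u t) ∧
      -- `u` is the only classical solution
      (∀ v, IsClassicalSolution κ u₀ v → ∀ t, 0 < t → ∀ x, v t x = u t x) := by
  have hB := ae_abs_le_of_supNorm_le Real.pi_pos.le hu₀
  obtain ⟨f, hf, hfB, hff⟩ := exists_measurable_modification Real.pi_pos.le hu₀_meas hB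
  obtain ⟨u, hu0, huf, huc⟩ := exists_duhamelEq_initial hκ hf hfB u₀
  -- The construction uses `f`, but the semigroup does not distinguish it from `u₀`, which is the
  -- one known to be periodic.
  have hu : DuhamelEq κ u₀ u := fun t ht x => by
    rw [heatSemigroup_congr_ae hff]
    exact huf t ht x
  have hsm : ∀ t, 0 < t → ∀ x,
      ContDiffAt ℝ ∞ (fun p : ℝ × EuclideanSpace ℝ (Fin d) => u p.1 p.2) (t, x) :=
    fun t ht x => huf.contDiffAt hκ hf hfB huc ht x
  have hper : ∀ t, 0 < t → TorusPeriodic (u t) := fun t ht => hu.periodic hκ hu₀_per huc ht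
  have heq : ∀ t, 0 < t → ∀ x, HasDerivAt (fun s => u s x)
      (κ ^ 2 * Laplacian.laplacian (u t) x + Real.sin (u t x)) t :=
    fun t ht x => huf.hasDerivAt hκ hf hfB hsm hper ht x
  have hum := aestronglyMeasurable_of_continuousOn huc
  have hae : ∀ v : ℝ → EuclideanSpace ℝ (Fin d) → ℝ,
      AEStronglyMeasurable (fun p : ℝ × EuclideanSpace ℝ (Fin d) => v p.1 p.2)
        ((volume.restrict (Ioi (0 : ℝ))).prod volume) →
      (∀ t, 0 < t → ∀ᵐ x, v t x = heatSemigroup (κ ^ 2 * t) u₀ x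
        + ∫ s in (0 : ℝ)..t, heatSemigroup (κ ^ 2 * (t - s)) (fun y => Real.sin (v s y)) x) →
      ∀ t, 0 < t → v t =ᵐ[volume] u t := fun v hvm hv t ht =>
    ae_eq_of_duhamel hκ hvm hum hv (fun t ht => Eventually.of_forall (hu t ht)) ht
  refine ⟨u, ⟨fun t ht => ?_, hum, by rw [hu0], fun t ht => Eventually.of_forall (hu t ht)⟩,
    ⟨hper, fun t ht => (contDiff_slice hsm ht).of_le (by norm_cast),
      fun k _ => continuousOn_iteratedFDeriv hsm k, heq,
      hu.tendsto_eLpNorm hκ hu₀_meas hB hf hfB hff⟩,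
    fun p hp => (hsm p.1 hp.1 p.2).contDiffWithinAt, ?_, fun v hv t ht => ?_,
    fun v hv t ht => ?_⟩
  · rcases ht.eq_or_lt with rfl | ht
    · rwa [hu0]
    · exact hper t ht
  · refine iSup₂_le fun t ht => ?_
    rcases ht.eq_or_lt with rfl | ht
    · rwa [hu0]
    · exact supNorm_le_of_ae_abs_le (Eventually.of_forall fun x =>
        abs_le_pi_of_abs_le_pi_add hκ hsm hper heq (fun t ht x => hu.abs_le hκ hB ht x) ht x)
  · rcases ht.eq_or_lt with rfl | ht
    · rw [hu0]
      exact hv.initial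
    · exact hae v hv.measurable hv.duhamel t ht
  -- A classical solution is mild, and continuity of both slices turns equality almost everywhere
  -- into equality everywhere.
  · have hvc := hv.continuousOn_uncurry
    have h := hae v (aestronglyMeasurable_of_continuousOn hvc)
      (fun t ht => hv.duhamel hκ hu₀_per hu₀_meas hB ht) t ht
    exact congrFun ((Continuous.ae_eq_iff_eq volume (continuousOn_slice hvc ht)
      (continuousOn_slice huc ht)).1 h)
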